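/- Let $\Bbbk$ be a field. A *conic quantum space* is a pair $(A_1,\mathcal A)$ consisting of a unital associative $\Bbbk$-algebra $\mathcal A\neq 0$ and a finite-dimensional subspace $A_1\subset\mathcal A$ generating $\mathcal A$, such that $\mathcal A=\bigoplus_{n\ge 0}A_n$ with $A_n=(A_1)^n$, $A_0=\Bbbk$; equivalently $\mathcal A=A_1^{\otimes}/I$, where $A_1^\otimes$ is the tensor algebra and $I=\bigoplus_{n\ge2}I_n$ a graded ideal. Morphisms are algebra morphisms $\alpha:\mathcal A\to\mathcal B$ with $\alpha(A_1)\subset B_1$; the resulting category is $\mathrm{CA}$. Put $\mathcal A\circ\mathcal B=\bigoplus_n A_n\otimes B_n$. *Cochains and twists.* For a vector space $V$, a 1-cochain is a family $\theta=(\theta_n)$ of linear automorphisms of $V^{\otimes n}$, and a 2-cochain is a family $\psi=(\psi_{r,s})$ of linear automorphisms of $V^{\otimes r}\otimes V^{\otimes s}$. Identifying $V^{\otimes r}\otimes V^{\otimes s}$ with $V^{\otimes(r+s)}$, set $(\partial\theta)_{r,s}=\theta_{r+s}(\theta_r\otimes\theta_s)^{-1}$. A counital 2-cocycle of $V$ is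 a 2-cochain with $\psi_{0,s}=\mathrm{id}=\psi_{r,0}$ and $\psi_{r+s,t}(\psi_{r,s}\otimes 1)=\psi_{r,s+t}(1\otimes\psi_{s,t})$; these form the set $\mathfrak Z^2[V]$. Every $\psi\in\mathfrak Z^2[V]$ is $\partial\theta$ for a unique $\theta$ with $\theta_0=\mathrm{id}$, $\theta_1=\mathrm{id}$; put $\mathfrak i\psi=\partial(\theta^{-1})$. Let $\psi^!$ be the 2-cochain of $V^*$ ($\dim V<\infty$) given by $\psi^!_{r,s}=(\psi_{r,s}^{-1})^*$, and for 2-cochains $\psi,\chi,\dots$ of $V,W,\dots$ let $\mathfrak j(\psi,\chi,\dots)$ be the 2-cochain of $V\otimes W\otimes\cdots$ acting as $\psi$ on the $V$-factors, as $\chi$ on the $W$-factors, and so on. A 2-cochain $\psi$ of $A_1$ is *$\mathcal A$-admissible* if each $\psi_{r,s}$ maps the kernel $I_r\otimes A_1^{\otimes s}+A_1^{\otimes r}\otimes I_s$ of $A_1^{\otimes r}\otimes A_1^{\otimes s}\to A_r\otimes A_s$ onto itself. It is *2nd $\mathcal A$-admissible* if it maps onto themselves all the subspaces $(A_1^{\otimes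 i}\otimes I_j\otimes A_1^{\otimes l})\otimes A_1^{\otimes s}$ (under $\psi_{i+j+l,s}$) and $A_1^{\otimes s}\otimes(A_1^{\otimes i}\otimes I_j\otimes A_1^{\otimes l})$ (under $\psi_{s,i+j+l}$). If $\psi\in\mathfrak Z^2[A_1]$ is $\mathcal A$-admissible, the *twist* $\mathcal A_\psi$ is the conic quantum space with the same graded vector space and generators as $\mathcal A$ and with the product induced by $m\circ\psi$, where $m$ is the product of the tensor algebra. Conic quantum spaces $\mathcal A,\mathcal B$ are *gauge equivalent*, $\mathcal A\sim\mathcal B$, if $\mathcal B\cong\mathcal A_\psi$ in $\mathrm{CA}$ for some $\mathcal A$-admissible $\psi\in\mathfrak Z^2[A_1]$. *The coHom objects.* $\underline{hom}[\mathcal B,\mathcal A]$ is the initial object of the comma category of pairs $\langle\varphi,\mathcal H\rangle$ with $\mathcal H\in\mathrm{CA}$ and $\varphi:\mathcal A\to\mathcal H\circ\mathcal B$ a morphism of $\mathrm{CA}$. Given $\omega\in\mathfrak Z^2[B_1^*\otimes A_1\otimes B_1]$, consider pairs $\langle\varphi,\mathcal H\rangle$ where $\varphi:\mathcal A\to\mathcal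 H\circ\mathcal B$ is only a degree-preserving linear map; a morphism $\langle\varphi,\mathcal H\rangle\to\langle\chi,\mathcal G\rangle$ is a morphism $\alpha:\mathcal H\to\mathcal G$ of $\mathrm{CA}$ with $(\alpha\circ 1)\varphi=\chi$. Let $H_1^\varphi\subset H_1$ be the image of $\pi^\varphi:B_1^*\otimes A_1\to H_1$, $b\otimes a\mapsto(1\otimes b)\varphi(a)$, and let $\mathcal H^\varphi\subset\mathcal H$ be the subalgebra generated by $H_1^\varphi$. Then $\Omega^{\mathcal A,\mathcal B}$ is the full subcategory of those $\langle\varphi,\mathcal H\rangle$ for which $\omega$ descends along the surjection $\pi^\varphi\otimes 1$ to an $(\mathcal H^\varphi\circ\mathcal B)$-admissible counital 2-cocycle of $H_1^\varphi\otimes B_1$, again denoted $\omega$, and $\varphi$ is a morphism $\mathcal A\to(\mathcal H^\varphi\circ\mathcal B)_\omega$ of $\mathrm{CA}$. Its initial object is denoted $\underline{hom}^\Omega[\mathcal B,\mathcal A]$. **Statement.** Let $\psi_{\mathcal A}\in\mathfrak Z^2[A_1]$ $(\mathcal A\in\mathrm{CA})$ be a collection such that every $\mathfrak i\psi_{\mathcal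 A}$ is 2nd $\mathcal A$-admissible, and let the categories $\Omega^{\mathcal A,\mathcal B}$ be defined by the factorizable collection $\omega_{\mathcal A,\mathcal B}=\mathfrak j(\psi_{\mathcal B}^!,\psi_{\mathcal A},\mathrm{id})\in\mathfrak Z^2[B_1^*\otimes A_1\otimes B_1]$. Then for all conic quantum spaces $\mathcal A,\mathcal B$ the initial objects $\underline{hom}^\Omega[\mathcal B,\mathcal A]$ and $\underline{hom}[\mathcal B,\mathcal A]$ exist, and $$\underline{hom}^\Omega[\mathcal B,\mathcal A]\sim\underline{hom}[\mathcal B,\mathcal A].$$ -/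

import Mathlib

open scoped TensorProduct
open CategoryTheory

set_option maxSynthPendingDepth 3

universe u

namespace QuantumSpace

noncomputable section

section Cochains

variable (k : Type u) [Field k] (V : Type u) [AddCommGroup V] [Module k V]

/-- Homogeneous `1`-cochains of `V`: families of linear automorphisms of the tensor powers `V^{⊗n}`,
that is, degree-preserving linear automorphisms of the tensor algebra of `V`. -/
abbrev OneCochain : Type u :=
  ∀ n : ℕ, (⨂[k]^n V) ≃ₗ[k] (⨂[k]^n V)

/-- Homogeneous `2`-cochains of `V`: families of linear automorphisms of `V^{⊗r} ⊗ V^{⊗s}`,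
that is, bidegree-preserving linear automorphisms of the tensor square of the tensor algebra. -/
abbrev TwoCochain : Type u :=
  ∀ r s : ℕ, ((⨂[k]^r V) ⊗[k] (⨂[k]^s V)) ≃ₗ[k] ((⨂[k]^r V) ⊗[k] (⨂[k]^s V))

variable {k V}

/-- The concatenation isomorphism `V^{⊗r} ⊗ V^{⊗s} ≃ V^{⊗(r+s)}`. -/
abbrev conc (r s : ℕ) : ((⨂[k]^r V) ⊗[k] (⨂[k]^s V)) ≃ₗ[k] (⨂[k]^(r + s) V) :=
  TensorPower.mulEquiv

/-- The coface `1 ⊗ ψ`. -/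
def face0 (ψ : TwoCochain k V) (r s t : ℕ) :
    (((⨂[k]^r V) ⊗[k] (⨂[k]^s V)) ⊗[k] (⨂[k]^t V)) ≃ₗ[k]
      (((⨂[k]^r V) ⊗[k] (⨂[k]^s V)) ⊗[k] (⨂[k]^t V)) :=
  TensorProduct.assoc k _ _ _ ≪≫ₗ
    TensorProduct.congr (LinearEquiv.refl k _) (ψ s t) ≪≫ₗ (TensorProduct.assoc k _ _ _).symm

/-- The coface of `ψ` that merges the first two tensor factors. -/
def face1 (ψ : TwoCochain k V) (r s t : ℕ) :
    (((⨂[k]^r V) ⊗[k] (⨂[k]^s V)) ⊗[k] (⨂[k]^t V)) ≃ₗ[k]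
      (((⨂[k]^r V) ⊗[k] (⨂[k]^s V)) ⊗[k] (⨂[k]^t V)) :=
  TensorProduct.congr (conc r s) (LinearEquiv.refl k _) ≪≫ₗ ψ (r + s) t ≪≫ₗ
    (TensorProduct.congr (conc r s) (LinearEquiv.refl k _)).symm

/-- The coface of `ψ` that merges the last two tensor factors. -/
def face2 (ψ : TwoCochain k V) (r s t : ℕ) :
    (((⨂[k]^r V) ⊗[k] (⨂[k]^s V)) ⊗[k] (⨂[k]^t V)) ≃ₗ[k]
      (((⨂[k]^r V) ⊗[k] (⨂[k]^s V)) ⊗[k] (⨂[k]^t V)) :=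
  (TensorProduct.assoc k _ _ _ ≪≫ₗ TensorProduct.congr (LinearEquiv.refl k _) (conc s t)) ≪≫ₗ
    ψ r (s + t) ≪≫ₗ
    (TensorProduct.assoc k _ _ _ ≪≫ₗ TensorProduct.congr (LinearEquiv.refl k _) (conc s t)).symm

/-- The coface `ψ ⊗ 1`. -/
def face3 (ψ : TwoCochain k V) (r s t : ℕ) :
    (((⨂[k]^r V) ⊗[k] (⨂[k]^s V)) ⊗[k] (⨂[k]^t V)) ≃ₗ[k]
      (((⨂[k]^r V) ⊗[k] (⨂[k]^s V)) ⊗[k] (⨂[k]^t V)) :=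
  TensorProduct.congr (ψ r s) (LinearEquiv.refl k _)

/-- The coboundary of a `1`-cochain: `(∂θ)_{r,s} = θ_{r+s} ∘ (θ_r ⊗ θ_s)⁻¹`. -/
def coboundary (θ : OneCochain k V) : TwoCochain k V := fun r s =>
  (TensorProduct.congr (θ r) (θ s)).symm ≪≫ₗ conc r s ≪≫ₗ θ (r + s) ≪≫ₗ (conc r s).symm

variable (k V) in
/-- Counital `2`-cocycles. -/
structure CounitalCocycle where
  toFun : TwoCochain k V
  counit_left : ∀ s, toFun 0 s = LinearEquiv.refl k _
  counit_right : ∀ r, toFun r 0 = LinearEquiv.refl k _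
  cocycle : ∀ r s t,
    face3 toFun r s t ≪≫ₗ face1 toFun r s t = face0 toFun r s t ≪≫ₗ face2 toFun r s t

/-- The primitive `θ` of a counital `2`-cocycle `ψ`, that is, the `1`-cochain with `ψ = ∂θ` which is
the identity in degrees `0` and `1`; explicitly `θ_{n+1} = ψ_{n,1} ∘ (θ_n ⊗ 1)`. -/
def CounitalCocycle.primitive (ψ : CounitalCocycle k V) : OneCochain k V
  | 0 => LinearEquiv.refl k _
  | n + 1 => (conc n 1).symm ≪≫ₗ
      TensorProduct.congr (ψ.primitive n) (LinearEquiv.refl k _) ≪≫ₗ ψ.toFun n 1 ≪≫ₗ conc n 1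

/-- The gauge inverse `𝔦ψ = ∂(θ⁻¹)` of `ψ = ∂θ`. -/
def CounitalCocycle.inv (ψ : CounitalCocycle k V) : TwoCochain k V :=
  coboundary fun n => (ψ.primitive n).symm

/-- The canonical map `X^{⊗n} ⊗ Y^{⊗n} → (X ⊗ Y)^{⊗n}`. -/
def shuffle (k X Y : Type u) [Field k] [AddCommGroup X] [Module k X] [AddCommGroup Y] [Module k Y]
    (n : ℕ) : ((⨂[k]^n X) ⊗[k] (⨂[k]^n Y)) →ₗ[k] (⨂[k]^n (X ⊗[k] Y)) :=
  TensorProduct.lift (PiTensorProduct.map₂ fun _ => TensorProduct.mk k X Y)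

theorem shuffle_tmul (X Y : Type u) [AddCommGroup X] [Module k X] [AddCommGroup Y] [Module k Y]
    (n : ℕ) (x : Fin n → X) (y : Fin n → Y) :
    shuffle k X Y n (PiTensorProduct.tprod k x ⊗ₜ PiTensorProduct.tprod k y) =
      PiTensorProduct.tprod k fun i => x i ⊗ₜ[k] y i := by
  simp [shuffle, PiTensorProduct.map₂_tprod_tprod]

theorem shuffle_bijective (X Y : Type u) [AddCommGroup X] [Module k X] [AddCommGroup Y] [Module k Y]
    (n : ℕ) : Function.Bijective (shuffle k X Y n) := by
  classical
  let bX := Module.Free.chooseBasis k X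
  let bY := Module.Free.chooseBasis k Y
  let B1 := (Basis.piTensorProduct fun _ : Fin n => bX).tensorProduct
    (Basis.piTensorProduct fun _ : Fin n => bY)
  let B2 := (Basis.piTensorProduct fun _ : Fin n => bX.tensorProduct bY)
  let e := B1.equiv B2 (Equiv.arrowProdEquivProdArrow (Fin n) (fun _ => _) (fun _ => _)).symm
  have : shuffle k X Y n = e.toLinearMap := by
    refine B1.ext fun p => ?_
    rw [LinearEquiv.coe_coe, Module.Basis.equiv_apply]
    simp only [B1, B2, Basis.piTensorProduct_apply,
      Module.Basis.tensorProduct_apply', shuffle_tmul]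
    rfl
  rw [this]
  exact e.bijective

/-- The canonical isomorphism `X^{⊗n} ⊗ Y^{⊗n} ≃ (X ⊗ Y)^{⊗n}`. -/
def shuffleEquiv (k X Y : Type u) [Field k] [AddCommGroup X] [Module k X] [AddCommGroup Y]
    [Module k Y] (n : ℕ) : ((⨂[k]^n X) ⊗[k] (⨂[k]^n Y)) ≃ₗ[k] (⨂[k]^n (X ⊗[k] Y)) :=
  LinearEquiv.ofBijective (shuffle k X Y n) (shuffle_bijective X Y n)

variable {X Y : Type u} [AddCommGroup X] [Module k X] [AddCommGroup Y] [Module k Y]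

/-- The cochain `𝔧(ψ, χ)` of `X ⊗ Y` acting as `ψ` on the `X`-letters and as `χ` on the `Y`-letters. -/
def joint (ψ : TwoCochain k X) (χ : TwoCochain k Y) : TwoCochain k (X ⊗[k] Y) := fun r s =>
  let e : (((⨂[k]^r X) ⊗[k] (⨂[k]^s X)) ⊗[k] ((⨂[k]^r Y) ⊗[k] (⨂[k]^s Y))) ≃ₗ[k]
      ((⨂[k]^r (X ⊗[k] Y)) ⊗[k] (⨂[k]^s (X ⊗[k] Y))) :=
    TensorProduct.tensorTensorTensorComm k _ _ _ _ ≪≫ₗ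
      TensorProduct.congr (shuffleEquiv k X Y r) (shuffleEquiv k X Y s)
  e.symm ≪≫ₗ TensorProduct.congr (ψ r s) (χ r s) ≪≫ₗ e

/-- The identity cochain. -/
def idCochain (k V : Type u) [Field k] [AddCommGroup V] [Module k V] : TwoCochain k V :=
  fun _ _ => LinearEquiv.refl k _

/-- The contragredient cochain `ψ^!` on the dual space: `ψ^!_{r,s} = (ψ_{r,s}⁻¹)^*`, where
`(V^*)^{⊗r} ⊗ (V^*)^{⊗s}` is identified with the dual of `V^{⊗r} ⊗ V^{⊗s}`. -/
def contragredient [Module.Finite k V] (ψ : TwoCochain k V) : TwoCochain k (Module.Dual k V) :=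
  fun r s =>
    let e : ((⨂[k]^r (Module.Dual k V)) ⊗[k] (⨂[k]^s (Module.Dual k V))) ≃ₗ[k]
        Module.Dual k ((⨂[k]^r V) ⊗[k] (⨂[k]^s V)) :=
      TensorProduct.congr PiTensorProduct.dualDistribEquiv PiTensorProduct.dualDistribEquiv ≪≫ₗ
        TensorProduct.dualDistribEquiv k _ _
    e ≪≫ₗ (ψ r s).symm.dualMap ≪≫ₗ e.symm

end Cochains
section Spaces

/-- Conic quantum spaces: pairs `(A₁, A)` of a `k`-algebra `A` and a finite-dimensional subspace
`A₁ ⊆ A` generating it, such that `A` is graded by the powers of `A₁`; thus `A = ⨁ A₁ⁿ`, `A₀ = k`. -/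
structure ConicSpace (k : Type u) [Field k] where
  carrier : Type u
  [ring : Ring carrier]
  [algebra : Algebra k carrier]
  [nontrivial : Nontrivial carrier]
  gen : Submodule k carrier
  [finite : Module.Finite k gen]
  adjoin_gen : Algebra.adjoin k (gen : Set carrier) = ⊤
  indep : iSupIndep fun n : ℕ => gen ^ n

attribute [instance] ConicSpace.ring ConicSpace.algebra ConicSpace.nontrivial ConicSpace.finite

variable {k : Type u} [Field k]

/-- Morphisms of conic quantum spaces: algebra morphisms mapping generators to generators. -/
@[ext]
structure ConicSpace.Hom (A B : ConicSpace k) where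
  toAlgHom : A.carrier →ₐ[k] B.carrier
  map_gen : ∀ x ∈ A.gen, toAlgHom x ∈ B.gen

instance : Category (ConicSpace k) where
  Hom A B := ConicSpace.Hom A B
  id A := ⟨AlgHom.id k _, fun _ h => h⟩
  comp f g := ⟨g.toAlgHom.comp f.toAlgHom, fun x h => g.map_gen _ (f.map_gen x h)⟩

theorem ConicSpace.hom_ext {A B : ConicSpace k} {f g : A ⟶ B}
    (h : f.toAlgHom = g.toAlgHom) : f = g :=
  ConicSpace.Hom.ext h

theorem map_pow_mem {R S : Type u} [Ring R] [Algebra k R] [Ring S] [Algebra k S] (f : R →ₐ[k] S)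
    (P : Submodule k R) (Q : Submodule k S) (h : ∀ x ∈ P, f x ∈ Q) (n : ℕ) (x : R)
    (hx : x ∈ P ^ n) : f x ∈ Q ^ n := by
  have h1 : P.map f.toLinearMap ≤ Q := by
    rintro _ ⟨y, hy, rfl⟩
    exact h y hy
  have h2 : (P ^ n).map f.toLinearMap = (P.map f.toLinearMap) ^ n := Submodule.map_pow P f n
  have h3 : f x ∈ (P.map f.toLinearMap) ^ n := h2 ▸ Submodule.mem_map_of_mem hx
  exact pow_le_pow_left' h1 n h3

/-- The forgetful functor from conic quantum spaces to graded vector spaces. -/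
def forgetGraded (k : Type u) [Field k] : ConicSpace k ⥤ GradedObject ℕ (ModuleCat.{u} k) where
  obj A := fun n => ModuleCat.of k ↥(A.gen ^ n)
  map {A B} f := fun n => ModuleCat.ofHom
    (f.toAlgHom.toLinearMap.restrict (map_pow_mem f.toAlgHom A.gen B.gen f.map_gen n))
  map_id A := by
    funext n
    rfl
  map_comp f g := by
    funext n
    rfl

theorem indep_of_injective {M N : Type u} [AddCommGroup M] [Module k M] [AddCommGroup N]
    [Module k N] (f : M →ₗ[k] N) (hf : Function.Injective f) (P : ℕ → Submodule k M)
    (Q : ℕ → Submodule k N) (h : ∀ n, (P n).map f ≤ Q n) (hQ : iSupIndep Q) : iSupIndep P := by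
  intro n
  rw [Submodule.disjoint_def]
  intro x h1 h2
  have h3 : f x ∈ Q n := h n (Submodule.mem_map_of_mem h1)
  have h4 : f x ∈ ⨆ j, ⨆ (_ : j ≠ n), Q j := by
    have h5 : (⨆ j, ⨆ (_ : j ≠ n), P j).map f ≤ ⨆ j, ⨆ (_ : j ≠ n), Q j := by
      simp only [Submodule.map_iSup]
      exact iSup₂_mono fun j _ => h j
    exact h5 (Submodule.mem_map_of_mem h2)
  have h6 := (Submodule.disjoint_def.1 (hQ n)) (f x) h3 h4
  exact hf (h6.trans (map_zero f).symm)

theorem indep_of_proj {M : Type u} [AddCommGroup M] [Module k M] (P : ℕ → Submodule k M)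
    (p : ℕ → M →ₗ[k] M) (h1 : ∀ n, ∀ x ∈ P n, p n x = x)
    (h2 : ∀ n m, m ≠ n → ∀ x ∈ P m, p n x = 0) : iSupIndep P := by
  intro n
  rw [Submodule.disjoint_def]
  intro x hx hx'
  have h3 : (⨆ j, ⨆ (_ : j ≠ n), P j) ≤ LinearMap.ker (p n) :=
    iSup₂_le fun j hj y hy => h2 n j hj y hy
  rw [← h1 n x hx]
  exact h3 hx'

theorem ConicSpace.iSup_gen_pow (A : ConicSpace k) : ⨆ n : ℕ, A.gen ^ n = ⊤ := by
  rw [eq_top_iff, ← Algebra.top_toSubmodule, ← A.adjoin_gen, Algebra.adjoin_eq_span]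
  refine Submodule.span_le.2 fun x hx => ?_
  have : ∃ n, x ∈ A.gen ^ n := by
    induction hx using Submonoid.closure_induction with
    | mem x hx => exact ⟨1, by simpa using hx⟩
    | one => exact ⟨0, by simp⟩
    | mul x y _ _ hx hy =>
      obtain ⟨n, hn⟩ := hx
      obtain ⟨m, hm⟩ := hy
      exact ⟨n + m, by rw [pow_add]; exact Submodule.mul_mem_mul hn hm⟩
  obtain ⟨n, hn⟩ := this
  exact Submodule.mem_iSup_of_mem n hn

theorem ConicSpace.exists_proj (A : ConicSpace k) (n : ℕ) : ∃ p : A.carrier →ₗ[k] A.carrier,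
    (∀ x ∈ A.gen ^ n, p x = x) ∧ ∀ m, m ≠ n → ∀ x ∈ A.gen ^ m, p x = 0 := by
  classical
  have hi : DirectSum.IsInternal (fun n : ℕ => A.gen ^ n) :=
    DirectSum.isInternal_submodule_of_iSupIndep_of_iSup_eq_top A.indep A.iSup_gen_pow
  let e := LinearEquiv.ofBijective (DirectSum.coeLinearMap fun n : ℕ => A.gen ^ n) hi
  have he : ∀ m (x : A.carrier) (hx : x ∈ A.gen ^ m),
      e.symm x = DirectSum.lof k ℕ (fun n => ↥(A.gen ^ n)) m ⟨x, hx⟩ := fun m x hx => by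
    rw [LinearEquiv.symm_apply_eq]
    exact (DirectSum.coeLinearMap_lof (fun n : ℕ => A.gen ^ n) m ⟨x, hx⟩).symm
  refine ⟨(A.gen ^ n).subtype ∘ₗ DirectSum.component k ℕ _ n ∘ₗ e.symm.toLinearMap, ?_, ?_⟩
  · intro x hx
    simp [he n x hx, DirectSum.component.lof_self]
  · intro m hm x hx
    simp [he m x hx, DirectSum.component.of, hm]

/-- The algebra generated by a finite-dimensional subspace `W` with independent powers. -/
def ofSubmodule (R : Type u) [Ring R] [Algebra k R] [Nontrivial R] (W : Submodule k R)
    [Module.Finite k W] (hW : iSupIndep fun n : ℕ => W ^ n) : ConicSpace k where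
  carrier := ↥(Algebra.adjoin k (W : Set R))
  gen := W.comap (Algebra.adjoin k (W : Set R)).val.toLinearMap
  finite := by
    refine Module.Finite.of_injective
      (((Algebra.adjoin k (W : Set R)).val.toLinearMap.restrict (p := W.comap _) (q := W)
        fun x hx => hx)) ?_
    intro x y h
    have h' := congrArg (fun w : W => (w : R)) h
    exact Subtype.ext (Subtype.ext h')
  adjoin_gen := by
    have : (↑(W.comap (Algebra.adjoin k (W : Set R)).val.toLinearMap) :
        Set ↥(Algebra.adjoin k (W : Set R))) = ((↑) : _ → R) ⁻¹' (W : Set R) := rfl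
    rw [this]
    exact Algebra.adjoin_adjoin_coe_preimage
  indep := by
    refine indep_of_injective (Algebra.adjoin k (W : Set R)).val.toLinearMap
      Subtype.val_injective _ (fun n : ℕ => W ^ n) ?_ hW
    rintro n _ ⟨x, hx, rfl⟩
    exact map_pow_mem (Algebra.adjoin k (W : Set R)).val _ W (fun y hy => hy) n x hx

/-- The canonical bijection between `W` and the generators of `ofSubmodule R W`. -/
def ofSubmoduleGen (R : Type u) [Ring R] [Algebra k R] [Nontrivial R] (W : Submodule k R)
    [Module.Finite k W] (hW : iSupIndep fun n : ℕ => W ^ n) : W ≃ₗ[k] (ofSubmodule R W hW).gen where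
  toFun w := ⟨⟨w.1, Algebra.subset_adjoin w.2⟩, w.2⟩
  invFun x := ⟨x.1.1, x.2⟩
  map_add' _ _ := rfl
  map_smul' _ _ := rfl
  left_inv _ := rfl
  right_inv _ := rfl

theorem map₂_mk_pow {R S : Type u} [Ring R] [Algebra k R] [Ring S] [Algebra k S]
    (P : Submodule k R) (Q : Submodule k S) (n : ℕ) :
    Submodule.map₂ (TensorProduct.mk k R S) P Q ^ n ≤
      Submodule.map₂ (TensorProduct.mk k R S) (P ^ n) (Q ^ n) := by
  induction n with
  | zero =>
    rw [pow_zero, Submodule.one_le]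
    exact Submodule.apply_mem_map₂ _ (Submodule.one_le.1 (pow_zero P).ge)
      (Submodule.one_le.1 (pow_zero Q).ge)
  | succ n ih =>
    rw [pow_succ, pow_succ, pow_succ]
    refine (mul_le_mul_left ih _).trans ?_
    rw [Submodule.map₂_eq_span_image2, Submodule.map₂_eq_span_image2, Submodule.span_mul_span,
      Submodule.span_le]
    rintro _ ⟨_, ⟨a, ha, b, hb, rfl⟩, _, ⟨c, hc, d, hd, rfl⟩, rfl⟩
    simp only [TensorProduct.mk_apply, Algebra.TensorProduct.tmul_mul_tmul, SetLike.mem_coe]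
    exact Submodule.apply_mem_map₂ _ (Submodule.mul_mem_mul ha hc) (Submodule.mul_mem_mul hb hd)

theorem segre_indep (H B : ConicSpace k) : iSupIndep fun n : ℕ =>
    Submodule.map₂ (TensorProduct.mk k H.carrier B.carrier) H.gen B.gen ^ n := by
  choose p hp hp' using H.exists_proj
  suffices h : iSupIndep fun n : ℕ => Submodule.map₂
      (TensorProduct.mk k H.carrier B.carrier) (H.gen ^ n) (B.gen ^ n) from
    h.mono fun n => map₂_mk_pow H.gen B.gen n
  refine indep_of_proj _ (fun n => (p n).rTensor B.carrier) ?_ ?_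
  · intro n x hx
    have : Submodule.map₂ (TensorProduct.mk k H.carrier B.carrier) (H.gen ^ n) (B.gen ^ n) ≤
        LinearMap.ker ((p n).rTensor B.carrier - LinearMap.id) :=
      Submodule.map₂_le.2 fun a ha b hb => by simp [hp n a ha]
    simpa [sub_eq_zero] using this hx
  · intro n m hm x hx
    have : Submodule.map₂ (TensorProduct.mk k H.carrier B.carrier) (H.gen ^ m) (B.gen ^ m) ≤
        LinearMap.ker ((p n).rTensor B.carrier) :=
      Submodule.map₂_le.2 fun a ha b hb => by simp [hp' n m hm a ha]
    exact this hx

instance (R S : Type u) [Ring R] [Algebra k R] [Ring S] [Algebra k S]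
    (P : Submodule k R) (Q : Submodule k S) [Module.Finite k P] [Module.Finite k Q] :
    Module.Finite k ↥(Submodule.map₂ (TensorProduct.mk k R S) P Q) :=
  Module.Finite.of_fg (Submodule.FG.map₂ _ (Module.Finite.iff_fg.1 inferInstance)
    (Module.Finite.iff_fg.1 inferInstance))

instance (H B : ConicSpace k) : Nontrivial (H.carrier ⊗[k] B.carrier) :=
  Algebra.TensorProduct.nontrivial_of_algebraMap_injective_of_flat_left k _ _
    (algebraMap k B.carrier).injective

/-- The morphism between generated algebras induced by an algebra morphism. -/
def ofSubmoduleMap {R S : Type u} [Ring R] [Algebra k R] [Nontrivial R] [Ring S] [Algebra k S]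
    [Nontrivial S] (W : Submodule k R) [Module.Finite k W] (hW : iSupIndep fun n : ℕ => W ^ n)
    (W' : Submodule k S) [Module.Finite k W'] (hW' : iSupIndep fun n : ℕ => W' ^ n)
    (f : R →ₐ[k] S) (hf : ∀ x ∈ W, f x ∈ W') : ofSubmodule R W hW ⟶ ofSubmodule S W' hW' where
  toAlgHom := (f.comp (Algebra.adjoin k (W : Set R)).val).codRestrict
    (Algebra.adjoin k (W' : Set S)) (by
      have : Algebra.adjoin k (W : Set R) ≤ (Algebra.adjoin k (W' : Set S)).comap f :=
        Algebra.adjoin_le fun x hx => Algebra.subset_adjoin (hf x hx)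
      exact fun x => this x.2)
  map_gen x hx := hf _ hx

/-- The product `H ∘ B = ⨁ Hₙ ⊗ Bₙ` of conic quantum spaces: the subalgebra of `H ⊗ B` generated
by `H₁ ⊗ B₁`. -/
def segre (H B : ConicSpace k) : ConicSpace k :=
  ofSubmodule (H.carrier ⊗[k] B.carrier)
    (Submodule.map₂ (TensorProduct.mk k H.carrier B.carrier) H.gen B.gen) (segre_indep H B)

/-- The inclusion of `H ∘ B` in `H ⊗ B`. -/
def segreVal (H B : ConicSpace k) : (segre H B).carrier →ₐ[k] H.carrier ⊗[k] B.carrier :=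
  Subalgebra.val _

/-- The canonical isomorphism of `H₁ ⊗ B₁` with the generators of `H ∘ B`. -/
def segreGen (H B : ConicSpace k) : (H.gen ⊗[k] B.gen) ≃ₗ[k] (segre H B).gen :=
  LinearEquiv.ofBijective
    (((TensorProduct.map H.gen.subtype B.gen.subtype).codRestrict
      (Submodule.map₂ (TensorProduct.mk k H.carrier B.carrier) H.gen B.gen) (fun x => by
        rw [← TensorProduct.range_mapIncl]
        exact ⟨x, rfl⟩))) (by
      constructor
      · intro x y h
        exact TensorProduct.map_injective_of_flat_flat _ _ Subtype.val_injective
          Subtype.val_injective (congrArg Subtype.val h)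
      · rintro ⟨x, hx⟩
        rw [← TensorProduct.range_mapIncl] at hx
        obtain ⟨y, rfl⟩ := hx
        exact ⟨y, rfl⟩) ≪≫ₗ
    ofSubmoduleGen (H.carrier ⊗[k] B.carrier) _ (segre_indep H B)

/-- The morphism `α ∘ 1 : H ∘ B ⟶ G ∘ B` induced by `α : H ⟶ G`. -/
def segreMap {H G : ConicSpace k} (α : H ⟶ G) (B : ConicSpace k) : segre H B ⟶ segre G B :=
  ofSubmoduleMap _ (segre_indep H B) _ (segre_indep G B)
    (Algebra.TensorProduct.map α.toAlgHom (AlgHom.id k B.carrier)) fun x hx => by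
      have : Submodule.map₂ (TensorProduct.mk k H.carrier B.carrier) H.gen B.gen ≤
          (Submodule.map₂ (TensorProduct.mk k G.carrier B.carrier) G.gen B.gen).comap
            (Algebra.TensorProduct.map α.toAlgHom (AlgHom.id k B.carrier)).toLinearMap :=
        Submodule.map₂_le.2 fun a ha b hb =>
          Submodule.apply_mem_map₂ _ (α.map_gen a ha) hb
      exact this hx

/-- The functor `H ↦ H ∘ B`. -/
def segreRight (B : ConicSpace k) : ConicSpace k ⥤ ConicSpace k where
  obj H := segre H B
  map α := segreMap α B
  map_id H := by
    refine ConicSpace.hom_ext (AlgHom.ext fun x => Subtype.ext ?_)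
    exact DFunLike.congr_fun (Algebra.TensorProduct.map_id (R := k) (S := k)) _
  map_comp f g := by
    refine ConicSpace.hom_ext (AlgHom.ext fun x => Subtype.ext ?_)
    refine Eq.trans ?_ (DFunLike.congr_fun (Algebra.TensorProduct.map_comp g.toAlgHom f.toAlgHom
      (AlgHom.id k B.carrier) (AlgHom.id k B.carrier)) _)
    rfl

end Spaces

section Twist

variable {k : Type u} [Field k]

/-- The canonical projection `A₁^{⊗n} → A`, with image `Aₙ` and kernel `Iₙ`, where `I` is the ideal
of relations of `A`. -/
def ev (A : ConicSpace k) (n : ℕ) : (⨂[k]^n A.gen) →ₗ[k] A.carrier :=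
  PiTensorProduct.lift
    ((MultilinearMap.mkPiAlgebraFin k n A.carrier).compLinearMap fun _ => A.gen.subtype)

/-- A `2`-cochain of `A₁` is `A`-admissible if it preserves the kernel of the projection onto
`A ⊗ A`, and thus descends to `A ⊗ A`. -/
def Admissible (A : ConicSpace k) (ψ : TwoCochain k A.gen) : Prop :=
  ∀ r s : ℕ, (LinearMap.ker (TensorProduct.map (ev A r) (ev A s))).map (ψ r s).toLinearMap =
    LinearMap.ker (TensorProduct.map (ev A r) (ev A s))

/-- The subspace `A₁^{⊗i} ⊗ Iⱼ ⊗ A₁^{⊗l}` of `A₁^{⊗(i+j+l)}`. -/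
def placedRelations (A : ConicSpace k) (i j l : ℕ) : Submodule k (⨂[k]^(i + j + l) A.gen) :=
  Submodule.map₂ (TensorProduct.curry (conc (i + j) l).toLinearMap)
    (Submodule.map₂ (TensorProduct.curry (conc i j).toLinearMap) ⊤ (LinearMap.ker (ev A j))) ⊤

/-- A `2`-cochain `ψ` of `A₁` is second `A`-admissible if it preserves the relations of `A` placed
anywhere in either of the two tensor factors, i.e. all the subspaces
`(A₁^{⊗i} ⊗ Iⱼ ⊗ A₁^{⊗l}) ⊗ A₁^{⊗s}` and `A₁^{⊗s} ⊗ (A₁^{⊗i} ⊗ Iⱼ ⊗ A₁^{⊗l})`. -/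
def SecondAdmissible (A : ConicSpace k) (ψ : TwoCochain k A.gen) : Prop :=
  ∀ i j l s : ℕ,
    (Submodule.map₂ (TensorProduct.mk k _ _) (placedRelations A i j l) ⊤).map
        (ψ (i + j + l) s).toLinearMap =
      Submodule.map₂ (TensorProduct.mk k _ _) (placedRelations A i j l) ⊤ ∧
    (Submodule.map₂ (TensorProduct.mk k _ _) ⊤ (placedRelations A i j l)).map
        (ψ s (i + j + l)).toLinearMap =
      Submodule.map₂ (TensorProduct.mk k _ _) ⊤ (placedRelations A i j l)

theorem ev_tprod (A : ConicSpace k) (n : ℕ) (a : Fin n → A.gen) :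
    ev A n (PiTensorProduct.tprod k a) = (List.ofFn fun i => (a i : A.carrier)).prod := by
  simp [ev]

theorem ev_conc (A : ConicSpace k) (r s : ℕ) (z : (⨂[k]^r A.gen) ⊗[k] (⨂[k]^s A.gen)) :
    ev A (r + s) (conc r s z) =
      LinearMap.mul' k A.carrier (TensorProduct.map (ev A r) (ev A s) z) := by
  suffices h : ev A (r + s) ∘ₗ (conc r s).toLinearMap =
      LinearMap.mul' k A.carrier ∘ₗ TensorProduct.map (ev A r) (ev A s) from
    LinearMap.congr_fun h z
  refine TensorProduct.ext ?_
  ext a b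
  have h := TensorPower.tprod_mul_tprod k a b
  rw [TensorPower.gMul_def] at h
  have h2 : (List.ofFn fun i => ((Fin.append a b i : A.gen) : A.carrier)) =
      (List.ofFn fun i => (a i : A.carrier)) ++ List.ofFn fun i => (b i : A.carrier) := by
    rw [← List.ofFn_fin_append]
    congr 1
    funext i
    refine Fin.addCases (fun i => ?_) (fun i => ?_) i <;> simp
  change ev A (r + s) (conc r s (PiTensorProduct.tprod k a ⊗ₜ PiTensorProduct.tprod k b)) =
    ev A r (PiTensorProduct.tprod k a) * ev A s (PiTensorProduct.tprod k b)
  rw [h, ev_tprod, ev_tprod, ev_tprod, h2, List.prod_append]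

theorem ev_zero (A : ConicSpace k) : ev A 0 (PiTensorProduct.tprod k Fin.elim0) = 1 := by
  simp [ev_tprod]

theorem range_ev_zero (A : ConicSpace k) : LinearMap.range (ev A 0) = 1 := by
  refine le_antisymm ?_ ?_
  · rintro _ ⟨x, rfl⟩
    induction x using PiTensorProduct.induction_on with
    | smul_tprod c a => 
      rw [map_smul, ev_tprod]
      refine Submodule.smul_mem _ _ ?_
      rw [List.ofFn_zero, List.prod_nil]
      exact Submodule.one_le.1 le_rfl
    | add x y hx hy => rw [map_add]; exact add_mem hx hy
  · rw [Submodule.one_le]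
    exact ⟨_, ev_zero A⟩

theorem range_ev_one (A : ConicSpace k) : LinearMap.range (ev A 1) = A.gen := by
  refine le_antisymm ?_ ?_
  · rintro _ ⟨x, rfl⟩
    induction x using PiTensorProduct.induction_on with
    | smul_tprod c a => 
      rw [map_smul, ev_tprod]
      exact Submodule.smul_mem _ _ (by simp)
    | add x y hx hy => rw [map_add]; exact add_mem hx hy
  · intro v hv
    exact ⟨PiTensorProduct.tprod k fun _ => ⟨v, hv⟩, by simp [ev_tprod]⟩

theorem range_ev (A : ConicSpace k) (n : ℕ) : LinearMap.range (ev A n) = A.gen ^ n := by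
  induction n with
  | zero => rw [range_ev_zero, pow_zero]
  | succ n ih =>
    have h0 : A.gen ^ (n + 1) = LinearMap.range (ev A n) * LinearMap.range (ev A 1) := by
      rw [ih, range_ev_one, pow_succ]
    rw [h0]
    refine le_antisymm ?_ (Submodule.mul_le.2 ?_)
    · rintro _ ⟨x, rfl⟩
      obtain ⟨z, rfl⟩ := (conc n 1).surjective x
      induction z using TensorProduct.induction_on with
      | zero => simp
      | tmul x y =>
        rw [ev_conc]
        exact Submodule.mul_mem_mul ⟨x, rfl⟩ ⟨y, rfl⟩
      | add x y hx hy => rw [map_add, map_add]; exact add_mem hx hy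
    · rintro _ ⟨x, rfl⟩ _ ⟨y, rfl⟩
      exact ⟨conc n 1 (x ⊗ₜ y), by rw [ev_conc]; simp⟩

theorem ev_comp_of_admissible (A : ConicSpace k) (ψ : TwoCochain k A.gen) (h : Admissible A ψ)
    (r s : ℕ) (z : (⨂[k]^r A.gen) ⊗[k] (⨂[k]^s A.gen))
    (hz : TensorProduct.map (ev A r) (ev A s) z = 0) : ev A (r + s) (conc r s (ψ r s z)) = 0 := by
  have : ψ r s z ∈ LinearMap.ker (TensorProduct.map (ev A r) (ev A s)) := by
    rw [← h r s]
    exact Submodule.mem_map_of_mem (f := (ψ r s).toLinearMap) hz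
  rw [ev_conc, LinearMap.mem_ker.1 this, map_zero]

/-- The product `m ∘ ψ` of the twisted algebra, given on representatives. -/
theorem exists_twistMul (A : ConicSpace k) (ψ : TwoCochain k A.gen) (h : Admissible A ψ) :
    ∃ m : A.carrier →ₗ[k] A.carrier →ₗ[k] A.carrier, ∀ r s x y,
      m (ev A r x) (ev A s y) = ev A (r + s) (conc r s (ψ r s (x ⊗ₜ y))) := by
  classical
  let M : ∀ r s : ℕ, (⨂[k]^r A.gen) →ₗ[k] (⨂[k]^s A.gen) →ₗ[k] A.carrier := fun r s =>
    TensorProduct.curry (ev A (r + s) ∘ₗ (conc r s).toLinearMap ∘ₗ (ψ r s).toLinearMap)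
  let E : (DirectSum ℕ fun n => ⨂[k]^n A.gen) →ₗ[k] A.carrier := DirectSum.toModule k ℕ _ (ev A)
  let T : (DirectSum ℕ fun n => ⨂[k]^n A.gen) →ₗ[k]
      (DirectSum ℕ fun n => ⨂[k]^n A.gen) →ₗ[k] A.carrier :=
    DirectSum.toModule k ℕ _ fun r =>
      (DirectSum.toModule k ℕ _ fun s => (M r s).flip).flip
  have hT : ∀ r s x y, T (DirectSum.lof k ℕ (fun n => ⨂[k]^n A.gen) r x)
      (DirectSum.lof k ℕ (fun n => ⨂[k]^n A.gen) s y) = M r s x y := fun r s x y => by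
    simp [T]
  have hE : ∀ r x, E (DirectSum.lof k ℕ (fun n => ⨂[k]^n A.gen) r x) = ev A r x := fun r x => by
    simp [E]
  have hker : ∀ z, E z = 0 → ∀ n, ev A n (z n) = 0 := by
    intro z hz n
    obtain ⟨p, hp, hp'⟩ := A.exists_proj n
    have : p ∘ₗ E = ev A n ∘ₗ DirectSum.component k ℕ (fun n => ⨂[k]^n A.gen) n := by
      refine DirectSum.linearMap_ext k fun m => LinearMap.ext fun x => ?_
      simp only [LinearMap.comp_apply, hE, DirectSum.component.of]
      by_cases hmn : m = n
      · subst hmn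
        simpa using hp _ (range_ev A m ▸ ⟨x, rfl⟩)
      · simpa [hmn] using hp' m hmn _ (range_ev A m ▸ ⟨x, rfl⟩)
    have h2 := LinearMap.congr_fun this z
    rw [LinearMap.comp_apply, hz, map_zero] at h2
    exact h2.symm
  have hl : ∀ z, E z = 0 → ∀ w, T z w = 0 := by
    intro z hz w
    have hz' := hker z hz
    rw [← DirectSum.sum_support_of z, map_sum, LinearMap.sum_apply]
    refine Finset.sum_eq_zero fun r _ => ?_
    rw [← DirectSum.sum_support_of w, map_sum]
    refine Finset.sum_eq_zero fun s _ => ?_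
    refine (hT r s (z r) (w s)).trans (ev_comp_of_admissible A ψ h r s _ ?_)
    rw [TensorProduct.mk_apply, TensorProduct.map_tmul, hz' r, TensorProduct.zero_tmul]
  have hr : ∀ z, E z = 0 → ∀ w, T w z = 0 := by
    intro z hz w
    have hz' := hker z hz
    rw [← DirectSum.sum_support_of w, map_sum, LinearMap.sum_apply]
    refine Finset.sum_eq_zero fun r _ => ?_
    rw [← DirectSum.sum_support_of z, map_sum]
    refine Finset.sum_eq_zero fun s _ => ?_
    refine (hT r s (w r) (z s)).trans (ev_comp_of_admissible A ψ h r s _ ?_)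
    rw [TensorProduct.mk_apply, TensorProduct.map_tmul, hz' s, TensorProduct.tmul_zero]
  have hsurj : LinearMap.range E = ⊤ := by
    rw [eq_top_iff, ← A.iSup_gen_pow, iSup_le_iff]
    intro n
    rw [← range_ev]
    rintro _ ⟨x, rfl⟩
    exact ⟨_, hE n x⟩
  obtain ⟨g, hg⟩ := E.exists_rightInverse_of_surjective hsurj
  have hg' : ∀ a, E (g a) = a := fun a => LinearMap.congr_fun hg a
  have hm : ∀ x y, T (g (E x)) (g (E y)) = T x y := by
    intro x y
    have h1 := hl (g (E x) + (-1 : k) • x) (by rw [map_add, map_smul, hg']; simp) (g (E y))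
    have h2 := hr (g (E y) + (-1 : k) • y) (by rw [map_add, map_smul, hg']; simp) x
    rw [map_add, map_smul, LinearMap.add_apply, LinearMap.smul_apply, neg_one_smul,
      add_neg_eq_zero] at h1
    rw [map_add, map_smul, neg_one_smul, add_neg_eq_zero] at h2
    rw [h1, h2]
  refine ⟨T.compl₁₂ g g, fun r s x y => ?_⟩
  rw [LinearMap.compl₁₂_apply, ← hE, ← hE, hm, hT]
  rfl

/-- The product of the twisted algebra: it is induced by `m ∘ ψ`, where `m` is the product of the
tensor algebra of `A₁`. -/
def twistMul (A : ConicSpace k) (ψ : TwoCochain k A.gen) (h : Admissible A ψ) :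
    A.carrier →ₗ[k] A.carrier →ₗ[k] A.carrier :=
  (exists_twistMul A ψ h).choose

theorem twistMul_ev (A : ConicSpace k) (ψ : TwoCochain k A.gen) (h : Admissible A ψ) (r s : ℕ)
    (x : ⨂[k]^r A.gen) (y : ⨂[k]^s A.gen) :
    twistMul A ψ h (ev A r x) (ev A s y) = ev A (r + s) (conc r s (ψ r s (x ⊗ₜ y))) :=
  (exists_twistMul A ψ h).choose_spec r s x y

theorem ConicSpace.induction {A : ConicSpace k} {p : A.carrier → Prop}
    (h : ∀ n x, p (ev A n x)) (hadd : ∀ a b, p a → p b → p (a + b)) (a : A.carrier) : p a := by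
  have ha : a ∈ ⨆ n : ℕ, A.gen ^ n := A.iSup_gen_pow ▸ Submodule.mem_top
  induction ha using Submodule.iSup_induction' with
  | mem n x hx =>
    rw [← range_ev] at hx
    obtain ⟨y, rfl⟩ := hx
    exact h n y
  | zero => simpa using h 0 0
  | add x y _ _ hx hy => exact hadd x y hx hy

theorem twistMul_one (A : ConicSpace k) (ψ : CounitalCocycle k A.gen) (h : Admissible A ψ.toFun)
    (a : A.carrier) : twistMul A ψ.toFun h a 1 = a := by
  induction a using ConicSpace.induction with
  | h n x =>
    rw [← ev_zero, twistMul_ev, ψ.counit_right, LinearEquiv.refl_apply, ev_conc]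
    simp [ev_zero]
  | hadd a b ha hb => rw [map_add, LinearMap.add_apply, ha, hb]

theorem one_twistMul (A : ConicSpace k) (ψ : CounitalCocycle k A.gen) (h : Admissible A ψ.toFun)
    (a : A.carrier) : twistMul A ψ.toFun h 1 a = a := by
  induction a using ConicSpace.induction with
  | h n x =>
    rw [← ev_zero, twistMul_ev, ψ.counit_left, LinearEquiv.refl_apply, ev_conc]
    simp [ev_zero]
  | hadd a b ha hb => rw [map_add, ha, hb]

theorem twistMul_assoc (A : ConicSpace k) (ψ : CounitalCocycle k A.gen) (h : Admissible A ψ.toFun)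
    (a b c : A.carrier) : twistMul A ψ.toFun h (twistMul A ψ.toFun h a b) c =
      twistMul A ψ.toFun h a (twistMul A ψ.toFun h b c) := by
  induction a using ConicSpace.induction with
  | hadd a a' ha ha' => simp only [map_add, LinearMap.add_apply, ha, ha']
  | h r x =>
  induction b using ConicSpace.induction with
  | hadd a a' ha ha' => simp only [map_add, LinearMap.add_apply, ha, ha']
  | h s y =>
  induction c using ConicSpace.induction with
  | hadd a a' ha ha' => simp only [map_add, ha, ha']
  | h t z =>
  let e3 := LinearMap.mul' k A.carrier ∘ₗ
    TensorProduct.map (LinearMap.mul' k A.carrier ∘ₗ TensorProduct.map (ev A r) (ev A s)) (ev A t)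
  have h1 : ∀ w, ev A (r + s + t) (conc (r + s) t
      (TensorProduct.congr (conc r s) (LinearEquiv.refl k _) w)) = e3 w := by
    intro w
    suffices hh : LinearMap.mul' k A.carrier ∘ₗ TensorProduct.map (ev A (r + s)) (ev A t) ∘ₗ
        (TensorProduct.congr (conc r s) (LinearEquiv.refl k (⨂[k]^t A.gen))).toLinearMap = e3 by
      rw [ev_conc]; exact LinearMap.congr_fun hh w
    refine TensorProduct.ext_threefold fun x y z => ?_
    simp [e3, ev_conc]
  have h2 : ∀ w, ev A (r + (s + t)) (conc r (s + t)
      ((TensorProduct.assoc k _ _ _ ≪≫ₗ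
        TensorProduct.congr (LinearEquiv.refl k _) (conc s t)) w)) = e3 w := by
    intro w
    suffices hh : LinearMap.mul' k A.carrier ∘ₗ TensorProduct.map (ev A r) (ev A (s + t)) ∘ₗ
        (TensorProduct.assoc k (⨂[k]^r A.gen) (⨂[k]^s A.gen) (⨂[k]^t A.gen) ≪≫ₗ
          TensorProduct.congr (LinearEquiv.refl k _) (conc s t)).toLinearMap = e3 by
      rw [ev_conc]; exact LinearMap.congr_fun hh w
    refine TensorProduct.ext_threefold fun x y z => ?_
    simp [e3, ev_conc, mul_assoc]
  have hc := LinearEquiv.congr_fun (ψ.cocycle r s t) ((x ⊗ₜ y) ⊗ₜ z)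
  rw [twistMul_ev, twistMul_ev, twistMul_ev, twistMul_ev]
  have h3 := h1 ((face3 ψ.toFun r s t ≪≫ₗ face1 ψ.toFun r s t) ((x ⊗ₜ y) ⊗ₜ z))
  have h4 := h2 ((face0 ψ.toFun r s t ≪≫ₗ face2 ψ.toFun r s t) ((x ⊗ₜ y) ⊗ₜ z))
  have h5 := h3.trans ((congrArg e3 hc).trans h4.symm)
  simpa only [face0, face1, face2, face3, LinearEquiv.trans_apply, LinearEquiv.apply_symm_apply,
    TensorProduct.congr_tmul, LinearEquiv.refl_apply, TensorProduct.assoc_tmul] using h5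

/-- The vector space underlying the twisted algebra `A_ψ`, namely that of `A`. -/
def TwistCarrier (A : ConicSpace k) (ψ : CounitalCocycle k A.gen) (_ : Admissible A ψ.toFun) : Type u :=
  A.carrier

variable (A : ConicSpace k) (ψ : CounitalCocycle k A.gen) (h : Admissible A ψ.toFun)

instance : AddCommGroup (TwistCarrier A ψ h) := inferInstanceAs (AddCommGroup A.carrier)

instance : Nontrivial (TwistCarrier A ψ h) := inferInstanceAs (Nontrivial A.carrier)

instance : Module k (TwistCarrier A ψ h) := inferInstanceAs (Module k A.carrier)

/-- The identification of the vector spaces underlying `A` and `A_ψ`. -/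
def toTwist : A.carrier ≃ₗ[k] TwistCarrier A ψ h := LinearEquiv.refl k A.carrier

instance : Ring (TwistCarrier A ψ h) :=
  { (inferInstance : AddCommGroup (TwistCarrier A ψ h)) with
    mul := fun a b => toTwist A ψ h
      (twistMul A ψ.toFun h ((toTwist A ψ h).symm a) ((toTwist A ψ h).symm b))
    one := toTwist A ψ h 1
    mul_assoc := fun a b c => twistMul_assoc A ψ h a b c
    one_mul := fun a => one_twistMul A ψ h a
    mul_one := fun a => twistMul_one A ψ h a
    left_distrib := fun a b c => (twistMul A ψ.toFun h a).map_add b c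
    right_distrib := fun a b c => (twistMul A ψ.toFun h).map_add₂ a b c
    zero_mul := fun a => (twistMul A ψ.toFun h).map_zero₂ a
    mul_zero := fun a => (twistMul A ψ.toFun h a).map_zero }

instance : Algebra k (TwistCarrier A ψ h) :=
  Algebra.ofModule (fun c a b => (twistMul A ψ.toFun h).map_smul₂ c a b)
    (fun c a b => (twistMul A ψ.toFun h a).map_smul c b)

theorem toTwist_mul (a b : A.carrier) : toTwist A ψ h a * toTwist A ψ h b =
    toTwist A ψ h (twistMul A ψ.toFun h a b) := rfl

theorem toTwist_pow (n : ℕ) : (A.gen.map (toTwist A ψ h).toLinearMap) ^ n =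
    (A.gen ^ n).map (toTwist A ψ h).toLinearMap := by
  induction n with
  | zero =>
    rw [pow_zero, pow_zero, Submodule.one_eq_span, Submodule.one_eq_span, Submodule.map_span,
      Set.image_singleton]
    rfl
  | succ n ih =>
    have h0 : (A.gen.map (toTwist A ψ h).toLinearMap) ^ (n + 1) =
        (LinearMap.range (ev A n)).map (toTwist A ψ h).toLinearMap *
          (LinearMap.range (ev A 1)).map (toTwist A ψ h).toLinearMap := by
      rw [range_ev_one, range_ev, ← ih, pow_succ]
    rw [h0, ← range_ev]
    refine le_antisymm (Submodule.mul_le.2 ?_) ?_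
    · rintro _ ⟨_, ⟨x, rfl⟩, rfl⟩ _ ⟨_, ⟨y, rfl⟩, rfl⟩
      exact ⟨_, ⟨conc n 1 (ψ.toFun n 1 (x ⊗ₜ y)), rfl⟩,
        congrArg (toTwist A ψ h) (twistMul_ev A ψ.toFun h n 1 x y).symm⟩
    · rintro _ ⟨_, ⟨x, rfl⟩, rfl⟩
      obtain ⟨z, rfl⟩ := (conc n 1).surjective x
      obtain ⟨z, rfl⟩ := (ψ.toFun n 1).surjective z
      induction z using TensorProduct.induction_on with
      | zero => simp
      | tmul x y =>
        rw [← twistMul_ev A ψ.toFun h]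
        exact Submodule.mul_mem_mul ⟨_, ⟨x, rfl⟩, rfl⟩ ⟨_, ⟨y, rfl⟩, rfl⟩
      | add x y hx hy => simp only [map_add]; exact add_mem hx hy

/-- The twist `A_ψ` of a conic quantum space by an admissible counital `2`-cocycle. -/
def twist : ConicSpace k where
  carrier := TwistCarrier A ψ h
  gen := A.gen.map (toTwist A ψ h).toLinearMap
  adjoin_gen := by
    rw [eq_top_iff]
    rintro x -
    have hx : (toTwist A ψ h).symm x ∈ ⨆ n : ℕ, A.gen ^ n := A.iSup_gen_pow ▸ Submodule.mem_top
    have hx' := Submodule.mem_map_of_mem (f := (toTwist A ψ h).toLinearMap) hx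
    rw [Submodule.map_iSup] at hx'
    have hle : (⨆ n : ℕ, (A.gen ^ n).map (toTwist A ψ h).toLinearMap) ≤
        (Algebra.adjoin k (↑(A.gen.map (toTwist A ψ h).toLinearMap) :
          Set (TwistCarrier A ψ h))).toSubmodule := by
      refine iSup_le fun n => ?_
      rw [← toTwist_pow]
      induction n with
      | zero => rw [pow_zero, Submodule.one_le]; exact Subalgebra.one_mem _
      | succ n ih =>
        rw [pow_succ]
        exact Submodule.mul_le.2 fun a ha b hb =>
          Subalgebra.mul_mem _ (ih ha) (Algebra.subset_adjoin hb)
    exact hle hx'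
  indep := by
    refine indep_of_injective (toTwist A ψ h).symm.toLinearMap (toTwist A ψ h).symm.injective _
      (fun n : ℕ => A.gen ^ n) ?_ A.indep
    intro n
    rw [toTwist_pow, ← Submodule.map_comp]
    rintro _ ⟨x, hx, rfl⟩
    exact hx

end Twist

section CoHom

variable {k : Type u} [Field k]

/-- The comma category `(𝔥 A ↓ 𝔥 (CA ∘ B))`: pairs `⟨φ, H⟩` of a conic quantum space `H` and a
homogeneous linear map `φ : A → H ∘ B`. -/
abbrev LinearArrow (A B : ConicSpace k) : Type (u + 1) :=
  StructuredArrow ((forgetGraded k).obj A) (segreRight B ⋙ forgetGraded k)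

variable {A B : ConicSpace k}

/-- The component `Aₙ → (H ∘ B)ₙ` of `φ`. -/
def LinearArrow.comp (X : LinearArrow A B) (n : ℕ) :
    ↥(A.gen ^ n) →ₗ[k] ↥((segre X.right B).gen ^ n) :=
  (X.hom n).hom

/-- The component `A₁ → H₁ ⊗ B₁` of `φ`. -/
def LinearArrow.comp1 (X : LinearArrow A B) : A.gen →ₗ[k] X.right.gen ⊗[k] B.gen :=
  (segreGen X.right B).symm.toLinearMap ∘ₗ
    (LinearEquiv.ofEq _ _ (pow_one (segre X.right B).gen)).toLinearMap ∘ₗ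
    X.comp 1 ∘ₗ (LinearEquiv.ofEq _ _ (pow_one A.gen).symm).toLinearMap

/-- The map `B₁^* ⊗ A₁ → H₁`, `b ⊗ a ↦ (1 ⊗ b) (φ a)`; in bases `bʲ ⊗ aᵢ ↦ hᵢʲ`, where
`φ aᵢ = ∑ⱼ hᵢʲ ⊗ bⱼ`. -/
def LinearArrow.coeff (X : LinearArrow A B) : (Module.Dual k B.gen ⊗[k] A.gen) →ₗ[k] X.right.gen :=
  TensorProduct.lift (LinearMap.mk₂ k
    (fun b a => TensorProduct.rid k X.right.gen (b.lTensor X.right.gen (X.comp1 a)))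
    (fun b b' a => by simp [LinearMap.lTensor_add]) (fun c b a => by simp [LinearMap.lTensor_smul])
    (fun b a a' => by simp) (fun c b a => by simp))

/-- The space `H₁^φ` spanned by the coefficients `hᵢʲ`. -/
def LinearArrow.coeffSpace (X : LinearArrow A B) : Submodule k X.right.carrier :=
  (LinearMap.range X.coeff).map X.right.gen.subtype

theorem LinearArrow.coeffSpace_le (X : LinearArrow A B) : X.coeffSpace ≤ X.right.gen := by
  rintro _ ⟨x, _, rfl⟩
  exact x.2

instance (X : LinearArrow A B) : Module.Finite k X.coeffSpace :=
  inferInstanceAs (Module.Finite k ((LinearMap.range X.coeff).map X.right.gen.subtype))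

theorem LinearArrow.coeffSpace_indep (X : LinearArrow A B) :
    iSupIndep fun n : ℕ => X.coeffSpace ^ n :=
  X.right.indep.mono fun n => pow_le_pow_left' X.coeffSpace_le n

/-- The conic quantum space `𝔉⟨φ, H⟩ = H^φ`, the subalgebra of `H` generated by `H₁^φ`. -/
def LinearArrow.sub (X : LinearArrow A B) : ConicSpace k :=
  ofSubmodule X.right.carrier X.coeffSpace X.coeffSpace_indep

/-- The inclusion `H^φ ⟶ H`. -/
def LinearArrow.subIncl (X : LinearArrow A B) : X.sub ⟶ X.right where
  toAlgHom := (Algebra.adjoin k (X.coeffSpace : Set X.right.carrier)).val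
  map_gen _ hx := X.coeffSpace_le hx

/-- The surjection `π^φ : B₁^* ⊗ A₁ → H₁^φ`. -/
def LinearArrow.proj (X : LinearArrow A B) : (Module.Dual k B.gen ⊗[k] A.gen) →ₗ[k] X.sub.gen :=
  (ofSubmoduleGen X.right.carrier X.coeffSpace X.coeffSpace_indep).toLinearMap ∘ₗ
    (X.right.gen.subtype ∘ₗ X.coeff).codRestrict X.coeffSpace
      (fun x => ⟨X.coeff x, ⟨x, rfl⟩, rfl⟩)

/-- The surjection `π^φ ⊗ 1` of `B₁^* ⊗ A₁ ⊗ B₁` onto the generators `H₁^φ ⊗ B₁` of `H^φ ∘ B`. -/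
def LinearArrow.genProj (X : LinearArrow A B) :
    ((Module.Dual k B.gen ⊗[k] A.gen) ⊗[k] B.gen) →ₗ[k] (segre X.sub B).gen :=
  (segreGen X.sub B).toLinearMap ∘ₗ X.proj.rTensor B.gen

/-- `χ` is the translation of `ω` along a linear map `ρ : V → W`. -/
def IsTranslation {V W : Type u} [AddCommGroup V] [Module k V] [AddCommGroup W] [Module k W]
    (ρ : V →ₗ[k] W) (ω : TwoCochain k V) (χ : TwoCochain k W) : Prop :=
  ∀ r s : ℕ,
    TensorProduct.map (PiTensorProduct.map fun _ : Fin r => ρ)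
        (PiTensorProduct.map fun _ : Fin s => ρ) ∘ₗ (ω r s).toLinearMap =
      (χ r s).toLinearMap ∘ₗ TensorProduct.map (PiTensorProduct.map fun _ : Fin r => ρ)
        (PiTensorProduct.map fun _ : Fin s => ρ)

/-- The objects `⟨φ, H⟩` of `Ω^{A,B}`: the cochain `ω` of `B₁^* ⊗ A₁ ⊗ B₁` translates through `π^φ`
to an admissible counital `2`-cocycle `χ` for `H^φ ∘ B`, and `φ` is a morphism of quantum spaces
`A ⟶ (H^φ ∘ B)_χ`. -/
def IsOmega (ω : TwoCochain k ((Module.Dual k B.gen ⊗[k] A.gen) ⊗[k] B.gen)) :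
    ObjectProperty (LinearArrow A B) := fun X =>
  ∃ (χ : CounitalCocycle k (segre X.sub B).gen) (h : Admissible (segre X.sub B) χ.toFun),
    IsTranslation X.genProj ω χ.toFun ∧
    ∃ f : A ⟶ twist (segre X.sub B) χ h, ∀ (n : ℕ) (a : ↥(A.gen ^ n)),
      (segreMap X.subIncl B).toAlgHom
        ((toTwist (segre X.sub B) χ h).symm (f.toAlgHom (a : A.carrier))) = X.comp n a

/-- The category `Ω^{A,B}`. -/
abbrev OmegaCat (A B : ConicSpace k)
    (ω : TwoCochain k ((Module.Dual k B.gen ⊗[k] A.gen) ⊗[k] B.gen)) : Type (u + 1) :=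
  (IsOmega (A := A) (B := B) ω).FullSubcategory

/-- The comma category `(A ↓ CA ∘ B)`, whose initial object is the proper coHom object. -/
abbrev CoHomCat (A B : ConicSpace k) : Type (u + 1) :=
  StructuredArrow A (segreRight B)

/-- Gauge equivalence: `B` is isomorphic to a twist of `A` by an admissible counital `2`-cocycle. -/
def GaugeEquivalent (A B : ConicSpace k) : Prop :=
  ∃ (ψ : CounitalCocycle k A.gen) (h : Admissible A ψ.toFun), Nonempty (twist A ψ h ≅ B)

/-- The collection `ω` of counital `2`-cocycles is factorizable through the collection `ψ`:
`ω_{A,B} = 𝔧(ψ_B^!, ψ_A, 1)`. -/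
def IsFactorization
    (ω : ∀ A B : ConicSpace k, CounitalCocycle k ((Module.Dual k B.gen ⊗[k] A.gen) ⊗[k] B.gen))
    (ψ : ∀ A : ConicSpace k, CounitalCocycle k A.gen) : Prop :=
  ∀ A B : ConicSpace k, (ω A B).toFun =
    joint (joint (contragredient (ψ B).toFun) (ψ A).toFun) (idCochain k B.gen)

end CoHom


end
end QuantumSpace

open QuantumSpace

/-! Put `V = B₁^* ⊗ A₁`. In degree one a map `φ : A → H ∘ B` amounts to its coefficient map `V →
H₁`, through the coevaluation `A₁ → V ⊗ B₁`. For a word `x` in `A₁^{⊗n}` the image lies in `H ⊗ Bₙ`,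
and it vanishes exactly when its contractions with all forms on `B₁^{⊗n}` that kill the relations of
`B` vanish. Hence `φ` respects the relations of `A` iff the coefficient map kills `Rₙ`, the space
`(Iₙ^B)^⊥ ⊗ Iₙ^A` rearranged letterwise inside `V^{⊗n}` (`map_coHomRel_le_iff`). So the proper coHom
object is `T(V)/J`, with `J` the ideal generated by `R`.

In the category `Ω` the target is twisted. If `ω = ∂Θ`, a twisted product of letters is the ordinary
product of the word transformed by `Θ` (`evMap_toTwist`). Here `Θ = 𝔧(θ_B^!, θ_A, 1)` does nothing
to the `B₁`-letters, so the same argument gives the relations `θ Rₙ` with `θ = 𝔧(θ_B^!, θ_A)`. The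
initial object of `Ω` is therefore `T(V)` modulo the ideal generated by `θ R`.

Second admissibility relates the two ideals. Dualised on the `B`-side and combined with the
`A`-side, it says that `∂(θ⁻¹)` preserves `V^{⊗i} ⊗ Rⱼ ⊗ V^{⊗l}` next to any further letters
(`Stable.perp`, `Stable.joint`, `stableRel_coHomGauge`). Since `θ ∘ m ∘ ∂(θ⁻¹) = m ∘ (θ ⊗ θ)`, it
follows that `θ` maps `V^{⊗i} ⊗ Rⱼ ⊗ V^{⊗l}` onto `V^{⊗i} ⊗ θ Rⱼ ⊗ V^{⊗l}`
(`map_concSub_of_map_eq`). Thus `θ J` is an ideal, namely the one generated by `θ R`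
(`map_genIdeal_le`), and `∂θ` preserves it, so `∂θ` descends to an admissible cocycle of `T(V)/θJ`.
In the resulting twist a word `x` vanishes iff `θ x ∈ θ J`, that is, iff `x ∈ J`: the twist is
`T(V)/J` (`gaugeEquivalent_of_evMap`).

It remains to see that `T(V)/θJ` really is an object of `Ω`. Its coefficient map is injective, so
`ω` is transported along an isomorphism, and admissibility on the product with `B` reduces to the
`V`-letters (`map_ker_evMap_joint`). -/

namespace QuantumSpace

noncomputable section

/-! ### Evaluation of words in an algebra, homogeneous ideals and presentations `T(V)/J`. -/

section Evaluation

variable {k : Type u} [Field k] {V W R S : Type u} [AddCommGroup V] [Module k V]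
  [AddCommGroup W] [Module k W] [Ring R] [Algebra k R] [Ring S] [Algebra k S]

/-- The multiplicative extension `V^{⊗n} → R` of a linear map `q : V → R` into an algebra. -/
def evMap (q : V →ₗ[k] R) (n : ℕ) : (⨂[k]^n V) →ₗ[k] R :=
  PiTensorProduct.lift ((MultilinearMap.mkPiAlgebraFin k n R).compLinearMap fun _ => q)

theorem ev_eq_evMap (A : ConicSpace k) (n : ℕ) : ev A n = evMap A.gen.subtype n := rfl

theorem evMap_tprod (q : V →ₗ[k] R) (n : ℕ) (v : Fin n → V) :
    evMap q n (PiTensorProduct.tprod k v) = (List.ofFn fun i => q (v i)).prod := by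
  simp [evMap]

theorem conc_tprod (r s : ℕ) (a : Fin r → V) (b : Fin s → V) :
    conc (k := k) r s (PiTensorProduct.tprod k a ⊗ₜ PiTensorProduct.tprod k b) =
      PiTensorProduct.tprod k (Fin.append a b) := by
  have h := TensorPower.tprod_mul_tprod k a b
  rwa [TensorPower.gMul_def] at h

theorem comp_append {α β : Type*} (f : α → β) {r s : ℕ} (a : Fin r → α) (b : Fin s → α) :
    (fun i => f (Fin.append a b i)) = Fin.append (fun i => f (a i)) fun i => f (b i) := by
  funext i
  refine Fin.addCases (fun i => ?_) (fun i => ?_) i <;> simp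

theorem evMap_conc (q : V →ₗ[k] R) (r s : ℕ) (x : ⨂[k]^r V) (y : ⨂[k]^s V) :
    evMap q (r + s) (conc r s (x ⊗ₜ y)) = evMap q r x * evMap q s y := by
  suffices h : evMap q (r + s) ∘ₗ (conc r s).toLinearMap =
      LinearMap.mul' k R ∘ₗ TensorProduct.map (evMap q r) (evMap q s) from
    LinearMap.congr_fun h (x ⊗ₜ y)
  refine TensorProduct.ext ?_
  ext a b
  change evMap q (r + s) (conc r s (PiTensorProduct.tprod k a ⊗ₜ PiTensorProduct.tprod k b)) =
    evMap q r (PiTensorProduct.tprod k a) * evMap q s (PiTensorProduct.tprod k b)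
  rw [conc_tprod, evMap_tprod, evMap_tprod, evMap_tprod, comp_append, List.ofFn_fin_append,
    List.prod_append]

theorem evMap_conc' (q : V →ₗ[k] R) (r s : ℕ) (z : (⨂[k]^r V) ⊗[k] (⨂[k]^s V)) :
    evMap q (r + s) (conc r s z) =
      LinearMap.mul' k R (TensorProduct.map (evMap q r) (evMap q s) z) := by
  induction z using TensorProduct.induction_on with
  | zero => simp
  | tmul x y => simp [evMap_conc]
  | add x y hx hy => simp only [map_add, hx, hy]

theorem evMap_map (q : W →ₗ[k] R) (f : V →ₗ[k] W) (n : ℕ) (x : ⨂[k]^n V) :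
    evMap q n (PiTensorProduct.map (fun _ => f) x) = evMap (q ∘ₗ f) n x := by
  suffices h : evMap q n ∘ₗ PiTensorProduct.map (fun _ => f) = evMap (q ∘ₗ f) n from
    LinearMap.congr_fun h x
  ext a
  simp [evMap_tprod]

theorem map_evMap (F : R →ₐ[k] S) (q : V →ₗ[k] R) (n : ℕ) (x : ⨂[k]^n V) :
    F (evMap q n x) = evMap (F.toLinearMap ∘ₗ q) n x := by
  suffices h : F.toLinearMap ∘ₗ evMap q n = evMap (F.toLinearMap ∘ₗ q) n from
    LinearMap.congr_fun h x
  ext a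
  simp [evMap_tprod, map_list_prod, List.map_ofFn, Function.comp_def]

theorem evMap_one (q : V →ₗ[k] R) (v : V) :
    evMap q 1 (PiTensorProduct.tprod k fun _ => v) = q v := by
  simp [evMap_tprod]

theorem evMap_zero_tprod (q : V →ₗ[k] R) (v : Fin 0 → V) :
    evMap q 0 (PiTensorProduct.tprod k v) = 1 := by
  simp [evMap_tprod]

/-- Multiplication in `R ⊗ S` is componentwise, so a word of pure tensors evaluates separately on
its two kinds of letters. -/
theorem evMap_shuffle (q : V →ₗ[k] R) (q' : W →ₗ[k] S) (n : ℕ) (z : (⨂[k]^n V) ⊗[k] (⨂[k]^n W)) :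
    evMap (TensorProduct.map q q') n (shuffleEquiv k V W n z) =
      TensorProduct.map (evMap q n) (evMap q' n) z := by
  suffices h : evMap (TensorProduct.map q q') n ∘ₗ shuffle k V W n =
      TensorProduct.map (evMap q n) (evMap q' n) from LinearMap.congr_fun h z
  refine TensorProduct.ext ?_
  ext a b
  have : ∀ m (a : Fin m → V) (b : Fin m → W),
      (List.ofFn fun i => q (a i) ⊗ₜ[k] q' (b i)).prod =
      (List.ofFn fun i => q (a i)).prod ⊗ₜ[k] (List.ofFn fun i => q' (b i)).prod := by
    intro m
    induction m with
    | zero => intros; simp [Algebra.TensorProduct.one_def]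
    | succ m ih => intro a b; simp [List.ofFn_succ, ih, Algebra.TensorProduct.tmul_mul_tmul]
  simp [shuffle_tmul, evMap_tprod, this]

theorem evMap_mem_pow (q : V →ₗ[k] R) (P : Submodule k R) (hq : ∀ v, q v ∈ P) (n : ℕ)
    (x : ⨂[k]^n V) : evMap q n x ∈ P ^ n := by
  induction x using PiTensorProduct.induction_on with
  | smul_tprod c a =>
    rw [map_smul, evMap_tprod]
    refine Submodule.smul_mem _ _ ?_
    induction n with
    | zero =>
      rw [List.ofFn_zero, List.prod_nil, pow_zero]
      exact Submodule.one_le.1 le_rfl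
    | succ n ih =>
      rw [List.ofFn_succ, List.prod_cons, pow_succ']
      exact Submodule.mul_mem_mul (hq _) (ih fun i => a i.succ)
  | add x y hx hy => rw [map_add]; exact add_mem hx hy

/-- Evaluation at the universal map is the inclusion of the degree `n` component; this allows
elements of the tensor algebra to be handled one degree at a time. -/
theorem toDirectSum_evMap (n : ℕ) (x : ⨂[k]^n V) :
    TensorAlgebra.toDirectSum (evMap (TensorAlgebra.ι k) n x) = DirectSum.of _ n x := by
  rw [← DirectSum.lof_eq_of k]
  suffices h : TensorAlgebra.toDirectSum.toLinearMap ∘ₗ evMap (TensorAlgebra.ι k) n =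
      DirectSum.lof k ℕ (fun n => ⨂[k]^n V) n from LinearMap.congr_fun h x
  ext a : 2
  simp only [LinearMap.compMultilinearMap_apply, LinearMap.comp_apply, evMap_tprod,
    AlgHom.toLinearMap_apply, DirectSum.lof_eq_of]
  rw [← TensorAlgebra.toDirectSum_tensorPower_tprod, TensorAlgebra.tprod_apply]

open scoped Classical in
theorem TensorAlgebra.eq_sum_evMap (t : TensorAlgebra k V) :
    t = ∑ n ∈ (TensorAlgebra.toDirectSum t).support,
      evMap (TensorAlgebra.ι k) n (TensorAlgebra.toDirectSum t n) := by
  apply TensorAlgebra.equivDirectSum.injective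
  simp only [TensorAlgebra.equivDirectSum_apply, map_sum, toDirectSum_evMap]
  exact (DirectSum.sum_support_of _).symm

theorem lift_evMap (q : V →ₗ[k] R) (n : ℕ) (x : ⨂[k]^n V) :
    TensorAlgebra.lift k q (evMap (TensorAlgebra.ι k) n x) = evMap q n x := by
  rw [map_evMap]
  congr 1
  ext v
  simp

open scoped Classical in
theorem lift_eq_sum (q : V →ₗ[k] R) (t : TensorAlgebra k V) :
    TensorAlgebra.lift k q t = ∑ n ∈ (TensorAlgebra.toDirectSum t).support,
      evMap q n (TensorAlgebra.toDirectSum t n) := by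
  conv_lhs => rw [TensorAlgebra.eq_sum_evMap t]
  rw [map_sum]
  exact Finset.sum_congr rfl fun n _ => lift_evMap q n _

/-- The kernel of `T(V) → H` is homogeneous: the degree `n` projection of `H` isolates a single
summand, because letters of degree one evaluate words of length `n` into `H.gen ^ n`. -/
theorem evMap_eq_zero_of_lift_eq_zero (H : ConicSpace k) (q : V →ₗ[k] H.carrier)
    (hq : ∀ v, q v ∈ H.gen) (t : TensorAlgebra k V) (ht : TensorAlgebra.lift k q t = 0) (n : ℕ) :
    evMap q n (TensorAlgebra.toDirectSum t n) = 0 := by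
  classical
  obtain ⟨p, hp, hp'⟩ := H.exists_proj n
  have h := congrArg p ht
  rw [lift_eq_sum, map_sum, map_zero] at h
  by_cases hn : n ∈ (TensorAlgebra.toDirectSum t).support
  · rw [Finset.sum_eq_single_of_mem n hn fun m _ hm => hp' m hm _ (evMap_mem_pow q _ hq m _),
      hp _ (evMap_mem_pow q _ hq n _)] at h
    exact h
  · rw [DFinsupp.notMem_support_iff.1 hn, map_zero]

/-- Algebra morphisms out of a conic quantum space are given by linear maps on generators that
respect the relations. -/
theorem ConicSpace.exists_algHom (H : ConicSpace k) (q : V →ₗ[k] H.carrier)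
    (hq : LinearMap.range q = H.gen) (q' : V →ₗ[k] S)
    (h : ∀ n x, evMap q n x = 0 → evMap q' n x = 0) :
    ∃ F : H.carrier →ₐ[k] S, ∀ v, F (q v) = q' v := by
  have hsurj : Function.Surjective (TensorAlgebra.lift k q) := by
    rw [← AlgHom.range_eq_top, eq_top_iff, ← H.adjoin_gen]
    refine Algebra.adjoin_le fun x hx => ?_
    rw [SetLike.mem_coe, ← hq] at hx
    obtain ⟨v, rfl⟩ := hx
    exact ⟨TensorAlgebra.ι k v, by simp⟩
  -- The hypothesis only concerns single degrees; homogeneity of the first kernel makes this enough.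
  have hker : RingHom.ker (TensorAlgebra.lift k q) ≤ RingHom.ker (TensorAlgebra.lift k q') := by
    intro t ht
    rw [RingHom.mem_ker] at ht ⊢
    rw [lift_eq_sum]
    exact Finset.sum_eq_zero fun n _ => h n _
      (evMap_eq_zero_of_lift_eq_zero H q (fun v => hq ▸ ⟨v, rfl⟩) t ht n)
  let e := Ideal.quotientKerAlgEquivOfSurjective hsurj
  refine ⟨(Ideal.Quotient.liftₐ _ (TensorAlgebra.lift k q') hker).comp e.symm.toAlgHom,
    fun v => ?_⟩
  have : e.symm (q v) = Ideal.Quotient.mkₐ k _ (TensorAlgebra.ι k v) := by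
    rw [AlgEquiv.symm_apply_eq]
    exact (TensorAlgebra.lift_ι_apply q v).symm
  change Ideal.Quotient.liftₐ _ (TensorAlgebra.lift k q') hker (e.symm (q v)) = q' v
  rw [this]
  exact TensorAlgebra.lift_ι_apply q' v

theorem ConicSpace.algHom_ext (H : ConicSpace k) {F G : H.carrier →ₐ[k] S}
    (h : ∀ v ∈ H.gen, F v = G v) : F = G :=
  AlgHom.ext_of_adjoin_eq_top H.adjoin_gen h

/-- Homogeneous ideals of the tensor algebra. -/
def IsIdealFamily (J : ∀ n, Submodule k (⨂[k]^n V)) : Prop :=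
  ∀ r s x y, (x ∈ J r ∨ y ∈ J s) → conc r s (x ⊗ₜ y) ∈ J (r + s)

theorem of_mem {J : ∀ n, Submodule k (⨂[k]^n V)} {n : ℕ} {x : ⨂[k]^n V} (hx : x ∈ J n) (m : ℕ) :
    DirectSum.of (fun n => ⨂[k]^n V) n x m ∈ J m := by
  by_cases h : m = n
  · subst h
    rwa [DirectSum.of_eq_same]
  · rw [DirectSum.of_eq_of_ne _ _ _ h]
    exact zero_mem _

/-- The ideal of the tensor algebra with the homogeneous components `J n`. -/
def IsIdealFamily.toIdeal {J : ∀ n, Submodule k (⨂[k]^n V)} (hJ : IsIdealFamily J) :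
    Ideal (TensorAlgebra k V) where
  carrier := {t | ∀ n, TensorAlgebra.toDirectSum t n ∈ J n}
  add_mem' ha hb n := by
    rw [map_add]
    exact add_mem (ha n) (hb n)
  zero_mem' n := by
    rw [map_zero]
    exact zero_mem (J n)
  smul_mem' a t ht n := by
    classical
    rw [smul_eq_mul, map_mul, ← DirectSum.sum_support_of (TensorAlgebra.toDirectSum a),
      ← DirectSum.sum_support_of (TensorAlgebra.toDirectSum t), Finset.sum_mul_sum,
      DirectSum.sum_apply]
    refine sum_mem fun i _ => ?_
    rw [DirectSum.sum_apply]
    refine sum_mem fun j _ => ?_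
    rw [DirectSum.of_mul_of]
    exact of_mem (hJ i j _ _ (Or.inr (ht j))) n

instance {J : ∀ n, Submodule k (⨂[k]^n V)} (hJ : IsIdealFamily J) : hJ.toIdeal.IsTwoSided where
  mul_mem_of_left {t} a ht n := by
    classical
    rw [map_mul, ← DirectSum.sum_support_of (TensorAlgebra.toDirectSum a),
      ← DirectSum.sum_support_of (TensorAlgebra.toDirectSum t), Finset.sum_mul_sum,
      DirectSum.sum_apply]
    refine sum_mem fun i _ => ?_
    rw [DirectSum.sum_apply]
    refine sum_mem fun j _ => ?_
    rw [DirectSum.of_mul_of]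
    exact of_mem (hJ i j _ _ (Or.inl (ht i))) n

/-- The generating map `V → T(V) / J`. -/
def IsIdealFamily.incl {J : ∀ n, Submodule k (⨂[k]^n V)} (hJ : IsIdealFamily J) :
    V →ₗ[k] TensorAlgebra k V ⧸ hJ.toIdeal :=
  (Ideal.Quotient.mkₐ k hJ.toIdeal).toLinearMap ∘ₗ TensorAlgebra.ι k

theorem IsIdealFamily.evMap_incl {J : ∀ n, Submodule k (⨂[k]^n V)} (hJ : IsIdealFamily J) (n : ℕ)
    (x : ⨂[k]^n V) :
    evMap hJ.incl n x = Ideal.Quotient.mkₐ k hJ.toIdeal (evMap (TensorAlgebra.ι k) n x) :=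
  (map_evMap _ _ _ _).symm

theorem IsIdealFamily.evMap_incl_eq_zero {J : ∀ n, Submodule k (⨂[k]^n V)} (hJ : IsIdealFamily J)
    (n : ℕ) (x : ⨂[k]^n V) : evMap hJ.incl n x = 0 ↔ x ∈ J n := by
  rw [hJ.evMap_incl, Ideal.Quotient.mkₐ_eq_mk, Ideal.Quotient.eq_zero_iff_mem]
  refine ⟨fun h => ?_, fun h m => ?_⟩
  · have := h n
    rwa [toDirectSum_evMap, DirectSum.of_eq_same] at this
  · rw [toDirectSum_evMap]
    exact of_mem h m

/-- Over a field the factorisation through the range of `f` extends to all of `N`, so `f` need not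
be surjective. -/
theorem exists_factor {M N P : Type*} [AddCommGroup M] [Module k M] [AddCommGroup N] [Module k N]
    [AddCommGroup P] [Module k P] (f : M →ₗ[k] N) (g : M →ₗ[k] P) (h : ∀ x, f x = 0 → g x = 0) :
    ∃ l : N →ₗ[k] P, ∀ x, l (f x) = g x := by
  obtain ⟨l, hl⟩ := LinearMap.exists_extend
    ((LinearMap.ker f).liftQ g h ∘ₗ f.quotKerEquivRange.symm.toLinearMap)
  refine ⟨l, fun x => ?_⟩
  have h2 := LinearMap.congr_fun hl ⟨f x, x, rfl⟩
  simp only [LinearMap.comp_apply, Submodule.subtype_apply, LinearEquiv.coe_coe,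
    LinearMap.quotKerEquivRange_symm_apply_image f x ⟨x, rfl⟩] at h2
  exact h2.trans (Submodule.liftQ_apply _ _ _)

theorem range_evMap_le {q : V →ₗ[k] R} (n : ℕ) :
    LinearMap.range q ^ n ≤ LinearMap.range (evMap q n) := by
  induction n with
  | zero =>
    rw [pow_zero, Submodule.one_le]
    exact ⟨PiTensorProduct.tprod k Fin.elim0, evMap_zero_tprod q _⟩
  | succ n ih =>
    rw [pow_succ]
    refine (mul_le_mul_left ih _).trans (Submodule.mul_le.2 ?_)
    rintro _ ⟨x, rfl⟩ _ ⟨v, rfl⟩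
    exact ⟨conc n 1 (x ⊗ₜ PiTensorProduct.tprod k fun _ => v), by rw [evMap_conc, evMap_one]⟩

/-- The conic quantum space `T(V) / J`. -/
def IsIdealFamily.conic [Module.Finite k V] {J : ∀ n, Submodule k (⨂[k]^n V)}
    (hJ : IsIdealFamily J) (h0 : J 0 = ⊥) : ConicSpace k where
  carrier := TensorAlgebra k V ⧸ hJ.toIdeal
  nontrivial := by
    refine ⟨1, 0, fun h => ?_⟩
    rw [← evMap_zero_tprod hJ.incl Fin.elim0, hJ.evMap_incl_eq_zero, h0, Submodule.mem_bot] at h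
    -- The empty tensor is nonzero because evaluation in `k` sends it to `1`.
    have := evMap_zero_tprod (0 : V →ₗ[k] k) Fin.elim0
    rw [h, map_zero] at this
    exact zero_ne_one this
  gen := LinearMap.range hJ.incl
  adjoin_gen := by
    rw [eq_top_iff]
    rintro x -
    obtain ⟨t, rfl⟩ := Ideal.Quotient.mkₐ_surjective k hJ.toIdeal x
    induction t using TensorAlgebra.induction with
    | algebraMap r => rw [AlgHom.commutes]; exact Subalgebra.algebraMap_mem _ r
    | ι v => exact Algebra.subset_adjoin ⟨v, rfl⟩
    | mul a b ha hb => rw [map_mul]; exact mul_mem ha hb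
    | add a b ha hb => rw [map_add]; exact add_mem ha hb
  indep := by
    -- The degree projections of the tensor algebra descend to the quotient, since membership in the
    -- ideal is tested componentwise.
    have h : ∀ n, ∃ p : (TensorAlgebra k V ⧸ hJ.toIdeal) →ₗ[k] (TensorAlgebra k V ⧸ hJ.toIdeal),
        ∀ t, p (Ideal.Quotient.mkₐ k hJ.toIdeal t) =
          evMap hJ.incl n (TensorAlgebra.toDirectSum t n) := fun n => by
      refine exists_factor (Ideal.Quotient.mkₐ k hJ.toIdeal).toLinearMap (evMap hJ.incl n ∘ₗ
        DirectSum.component k ℕ (fun n => ⨂[k]^n V) n ∘ₗ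
        TensorAlgebra.toDirectSum.toLinearMap) fun t ht => ?_
      refine (hJ.evMap_incl_eq_zero n _).2 ?_
      rw [AlgHom.toLinearMap_apply, Ideal.Quotient.mkₐ_eq_mk,
        Ideal.Quotient.eq_zero_iff_mem] at ht
      exact ht n
    choose p hp using h
    have hp' : ∀ n m x, p n (evMap hJ.incl m x) =
        evMap hJ.incl n (DirectSum.of (fun n => ⨂[k]^n V) m x n) := fun n m x => by
      rw [hJ.evMap_incl m, hp, toDirectSum_evMap]
    refine indep_of_proj _ p ?_ ?_
    · intro n x hx
      obtain ⟨y, rfl⟩ := range_evMap_le n hx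
      rw [hp', DirectSum.of_eq_same]
    · intro n m hmn x hx
      obtain ⟨y, rfl⟩ := range_evMap_le m hx
      rw [hp', DirectSum.of_eq_of_ne _ _ _ hmn.symm, map_zero]

/-- The identification of `V` with the generators of `T(V) / J`. -/
def IsIdealFamily.genEquiv [Module.Finite k V] {J : ∀ n, Submodule k (⨂[k]^n V)}
    (hJ : IsIdealFamily J) (h0 : J 0 = ⊥) (h1 : J 1 = ⊥) : V ≃ₗ[k] (hJ.conic h0).gen :=
  LinearEquiv.ofInjective hJ.incl (by
    rw [injective_iff_map_eq_zero]
    intro v hv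
    rw [← evMap_one, hJ.evMap_incl_eq_zero, h1, Submodule.mem_bot] at hv
    have := congrArg (PiTensorProduct.subsingletonEquiv (R := k) (0 : Fin 1)) hv
    simpa using this)

theorem IsIdealFamily.evMap_genEquiv [Module.Finite k V] {J : ∀ n, Submodule k (⨂[k]^n V)}
    (hJ : IsIdealFamily J) (h0 : J 0 = ⊥) (h1 : J 1 = ⊥) (n : ℕ) (x : ⨂[k]^n V) :
    evMap ((hJ.conic h0).gen.subtype ∘ₗ (hJ.genEquiv h0 h1).toLinearMap) n x = 0 ↔ x ∈ J n :=
  hJ.evMap_incl_eq_zero n x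

end Evaluation
end
end QuantumSpace

namespace QuantumSpace

noncomputable section

/-! ### Coboundaries, primitives and evaluation in a twist. -/

section CochainCalculus

variable {k : Type u} [Field k] {V X Y : Type u} [AddCommGroup V] [Module k V]
  [AddCommGroup X] [Module k X] [AddCommGroup Y] [Module k Y]

theorem conc_assoc (r s t : ℕ) (x : ⨂[k]^r V) (y : ⨂[k]^s V) (z : ⨂[k]^t V) :
    TensorPower.cast k V (add_assoc r s t) (conc (r + s) t (conc r s (x ⊗ₜ y) ⊗ₜ z)) =
      conc r (s + t) (x ⊗ₜ conc s t (y ⊗ₜ z)) :=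
  TensorPower.mul_assoc x y z

/-- No cast is needed when the last factor has one letter: `r + s + 1` and `r + (s + 1)` are
definitionally equal. -/
theorem conc_assoc_succ (r s : ℕ) (x : ⨂[k]^r V) (y : ⨂[k]^s V) (z : ⨂[k]^1 V) :
    conc (r + s) 1 (conc r s (x ⊗ₜ y) ⊗ₜ z) = conc r (s + 1) (x ⊗ₜ conc s 1 (y ⊗ₜ z)) := by
  rw [← conc_assoc]
  exact (LinearEquiv.congr_fun (TensorPower.cast_refl (R := k) (M := V) rfl) _).symm

theorem one_conc (s : ℕ) (a : Fin 0 → V) (y : ⨂[k]^s V) :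
    conc 0 s (PiTensorProduct.tprod k a ⊗ₜ y) = TensorPower.cast k V (zero_add s).symm y := by
  rw [Subsingleton.elim a Fin.elim0, ← TensorPower.cast_symm, LinearEquiv.eq_symm_apply]
  exact TensorPower.one_mul y

theorem conc_one (r : ℕ) (a : Fin 0 → V) (y : ⨂[k]^r V) :
    conc r 0 (y ⊗ₜ PiTensorProduct.tprod k a) = y := by
  rw [Subsingleton.elim a Fin.elim0]
  refine Eq.trans ?_ (TensorPower.mul_one y)
  exact (LinearEquiv.congr_fun (TensorPower.cast_refl (R := k) (M := V) rfl) _).symm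

theorem exists_smul_tprod_zero (x : ⨂[k]^0 V) :
    ∃ c : k, x = c • PiTensorProduct.tprod k Fin.elim0 := by
  induction x using PiTensorProduct.induction_on with
  | smul_tprod c a => exact ⟨c, by rw [Subsingleton.elim a Fin.elim0]⟩
  | add x y hx hy =>
    obtain ⟨c, rfl⟩ := hx
    obtain ⟨d, rfl⟩ := hy
    exact ⟨c + d, (add_smul _ _ _).symm⟩

theorem exists_tprod_one (x : ⨂[k]^1 V) : ∃ v : V, x = PiTensorProduct.tprod k fun _ => v := by
  refine ⟨PiTensorProduct.subsingletonEquiv (0 : Fin 1) x, ?_⟩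
  apply (PiTensorProduct.subsingletonEquiv (R := k) (0 : Fin 1)).injective
  simp

theorem OneCochain.apply_cast (θ : OneCochain k V) {i j : ℕ} (h : i = j) (x : ⨂[k]^i V) :
    θ j (TensorPower.cast k V h x) = TensorPower.cast k V h (θ i x) := by
  subst h
  simp

theorem coboundary_congr_apply (θ : OneCochain k V) (r s : ℕ)
    (z : (⨂[k]^r V) ⊗[k] (⨂[k]^s V)) :
    coboundary θ r s (TensorProduct.congr (θ r) (θ s) z) =
      (conc r s).symm (θ (r + s) (conc r s z)) := by
  simp [coboundary]

/-- Since `θ` is bijective, arguments may be taken in the form `θ x ⊗ θ y`, on which the inverses in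
the coboundary cancel. Later computations with coboundaries use this normal form. -/
theorem coboundary_tmul (θ : OneCochain k V) (r s : ℕ) (x : ⨂[k]^r V) (y : ⨂[k]^s V) :
    coboundary θ r s (θ r x ⊗ₜ θ s y) = (conc r s).symm (θ (r + s) (conc r s (x ⊗ₜ y))) :=
  coboundary_congr_apply θ r s (x ⊗ₜ y)

theorem conc_coboundary (θ : OneCochain k V) (r s : ℕ) (x : ⨂[k]^r V) (y : ⨂[k]^s V) :
    conc r s (coboundary θ r s (θ r x ⊗ₜ θ s y)) = θ (r + s) (conc r s (x ⊗ₜ y)) := by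
  rw [coboundary_tmul, LinearEquiv.apply_symm_apply]

/-- The coboundary of a `1`-cochain that is the identity in degree `0`, as a counital cocycle. -/
def coboundaryCocycle (θ : OneCochain k V) (h0 : θ 0 = LinearEquiv.refl k _) :
    CounitalCocycle k V where
  toFun := coboundary θ
  counit_left s := by
    refine LinearEquiv.toLinearMap_injective (TensorProduct.ext' fun x y => ?_)
    obtain ⟨c, rfl⟩ := exists_smul_tprod_zero x
    obtain ⟨y, rfl⟩ := (θ s).surjective y
    have h := coboundary_tmul θ 0 s (c • PiTensorProduct.tprod k Fin.elim0) y
    rw [h0] at h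
    refine h.trans ?_
    rw [LinearEquiv.symm_apply_eq, ← TensorProduct.smul_tmul', map_smul, map_smul, one_conc,
      OneCochain.apply_cast]
    simp [one_conc, ← TensorProduct.smul_tmul']
  counit_right r := by
    refine LinearEquiv.toLinearMap_injective (TensorProduct.ext' fun y x => ?_)
    obtain ⟨c, rfl⟩ := exists_smul_tprod_zero x
    obtain ⟨y, rfl⟩ := (θ r).surjective y
    have h := coboundary_tmul θ r 0 y (c • PiTensorProduct.tprod k Fin.elim0)
    rw [h0] at h
    refine h.trans ?_
    rw [LinearEquiv.symm_apply_eq, TensorProduct.tmul_smul, map_smul, map_smul, conc_one]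
    simp [conc_one, TensorProduct.tmul_smul]
  cocycle r s t := by
    refine LinearEquiv.toLinearMap_injective (TensorProduct.ext_threefold fun x y z => ?_)
    obtain ⟨x, rfl⟩ := (θ r).surjective x
    obtain ⟨y, rfl⟩ := (θ s).surjective y
    obtain ⟨z, rfl⟩ := (θ t).surjective z
    -- Both sides are compared after merging the three factors into one word, where each becomes `θ`
    -- of the concatenation of `x`, `y`, `z`.
    apply (TensorProduct.congr (conc r s) (LinearEquiv.refl k _) ≪≫ₗ conc (r + s) t ≪≫ₗ
      TensorPower.cast k V (add_assoc r s t)).injective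
    have h1 : ∀ w : (⨂[k]^r V) ⊗[k] ((⨂[k]^s V) ⊗[k] (⨂[k]^t V)),
        (TensorProduct.congr (conc r s) (LinearEquiv.refl k _) ≪≫ₗ conc (r + s) t ≪≫ₗ
          TensorPower.cast k V (add_assoc r s t)) ((TensorProduct.assoc k _ _ _).symm w) =
        conc r (s + t) (TensorProduct.congr (LinearEquiv.refl k _) (conc s t) w) := by
      intro w
      suffices h : (TensorProduct.congr (conc r s) (LinearEquiv.refl k _) ≪≫ₗ conc (r + s) t ≪≫ₗ
          TensorPower.cast k V (add_assoc r s t)).toLinearMap ∘ₗ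
          (TensorProduct.assoc k (⨂[k]^r V) (⨂[k]^s V) (⨂[k]^t V)).symm.toLinearMap =
        (conc r (s + t)).toLinearMap ∘ₗ
          (TensorProduct.congr (LinearEquiv.refl k _) (conc s t)).toLinearMap from
        LinearMap.congr_fun h w
      refine TensorProduct.ext' fun x w => ?_
      induction w using TensorProduct.induction_on with
      | zero => simp
      | add a b ha hb => simp only [TensorProduct.tmul_add, map_add, ha, hb]
      | tmul y z =>
        simpa using conc_assoc r s t x y z
    simp only [face3, face1, face0, face2, LinearEquiv.coe_coe, LinearEquiv.trans_apply,
      TensorProduct.congr_tmul, LinearEquiv.refl_apply, coboundary_tmul, LinearEquiv.apply_symm_apply,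
      TensorProduct.assoc_tmul, LinearEquiv.trans_symm]
    have h2 := h1 ((TensorProduct.congr (LinearEquiv.refl k (⨂[k]^r V)) (conc s t)).symm
      ((conc r (s + t)).symm (θ (r + (s + t)) (conc r (s + t) (x ⊗ₜ conc s t (y ⊗ₜ z))))))
    simp only [LinearEquiv.trans_apply, LinearEquiv.apply_symm_apply] at h2
    rw [h2, ← conc_assoc, OneCochain.apply_cast]

theorem CounitalCocycle.primitive_succ_conc (ψ : CounitalCocycle k V) (n : ℕ) (x : ⨂[k]^n V)
    (y : ⨂[k]^1 V) : ψ.primitive (n + 1) (conc n 1 (x ⊗ₜ y)) =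
      conc n 1 (ψ.toFun n 1 (ψ.primitive n x ⊗ₜ y)) := by
  simp [CounitalCocycle.primitive]

theorem CounitalCocycle.primitive_zero (ψ : CounitalCocycle k V) :
    ψ.primitive 0 = LinearEquiv.refl k _ := rfl

theorem CounitalCocycle.primitive_one (ψ : CounitalCocycle k V) :
    ψ.primitive 1 = LinearEquiv.refl k _ := by
  refine LinearEquiv.ext fun x => ?_
  obtain ⟨z, rfl⟩ := (conc 0 1).surjective x
  induction z using TensorProduct.induction_on with
  | zero => simp
  | add a b ha hb => simpa only [map_add] using congrArg₂ (· + ·) ha hb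
  | tmul x y =>
    refine (ψ.primitive_succ_conc 0 x y).trans ?_
    rw [ψ.counit_left]
    rfl

/-- A counital cocycle is determined by its components `ψ_{n,1}`, from which the primitive is built.
The induction moves letters one at a time from the right factor, the cocycle identity at `(r, s, 1)`
providing the step and the counit the start. -/
theorem CounitalCocycle.conc_toFun (ψ : CounitalCocycle k V) (r s : ℕ) (x : ⨂[k]^r V)
    (y : ⨂[k]^s V) : conc r s (ψ.toFun r s (ψ.primitive r x ⊗ₜ ψ.primitive s y)) =
      ψ.primitive (r + s) (conc r s (x ⊗ₜ y)) := by
  induction s with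
  | zero =>
    obtain ⟨c, rfl⟩ := exists_smul_tprod_zero y
    rw [ψ.counit_right, TensorProduct.tmul_smul, map_smul, map_smul, conc_one, map_smul,
      primitive_zero, LinearEquiv.refl_apply, LinearEquiv.refl_apply, TensorProduct.tmul_smul,
      map_smul, conc_one]
    rfl
  | succ s ih =>
    obtain ⟨z, rfl⟩ := (conc s 1).surjective y
    induction z using TensorProduct.induction_on with
    | zero => simp
    | add a b ha hb => simp only [map_add, TensorProduct.tmul_add, ha, hb]
    | tmul y z =>
      have hc := LinearEquiv.congr_fun (ψ.cocycle r s 1)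
        ((ψ.primitive r x ⊗ₜ ψ.primitive s y) ⊗ₜ z)
      simp only [face3, face1, face0, face2, LinearEquiv.trans_apply,
        TensorProduct.congr_tmul, LinearEquiv.refl_apply, LinearEquiv.apply_symm_apply,
        TensorProduct.assoc_tmul, LinearEquiv.trans_symm, ih] at hc
      rw [← conc_assoc_succ, primitive_succ_conc]
      refine Eq.trans ?_ (primitive_succ_conc ψ (r + s) (conc r s (x ⊗ₜ y)) z).symm
      have h1 : ∀ w : (⨂[k]^r V) ⊗[k] ((⨂[k]^s V) ⊗[k] (⨂[k]^1 V)),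
          conc (r + s) 1 (TensorProduct.congr (conc r s) (LinearEquiv.refl k _)
            ((TensorProduct.assoc k _ _ _).symm w)) =
          conc r (s + 1) (TensorProduct.congr (LinearEquiv.refl k _) (conc s 1) w) := by
        intro w
        suffices h : (conc (r + s) 1).toLinearMap ∘ₗ
            (TensorProduct.congr (conc r s) (LinearEquiv.refl k _)).toLinearMap ∘ₗ
            (TensorProduct.assoc k (⨂[k]^r V) (⨂[k]^s V) (⨂[k]^1 V)).symm.toLinearMap =
          (conc r (s + 1)).toLinearMap ∘ₗ
            (TensorProduct.congr (LinearEquiv.refl k _) (conc s 1)).toLinearMap from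
          LinearMap.congr_fun h w
        refine TensorProduct.ext' fun x w => ?_
        induction w using TensorProduct.induction_on with
        | zero => simp
        | add a b ha hb => simp only [TensorProduct.tmul_add, map_add, ha, hb]
        | tmul y z => simpa using conc_assoc_succ r s x y z
      have h2 := congrArg (fun w => conc (r + s) 1 (TensorProduct.congr (conc r s)
        (LinearEquiv.refl k _) w)) hc
      simp only [LinearEquiv.apply_symm_apply, h1] at h2
      exact h2.symm

theorem CounitalCocycle.coboundary_primitive (ψ : CounitalCocycle k V) :
    coboundary ψ.primitive = ψ.toFun := by
  funext r s
  refine LinearEquiv.toLinearMap_injective (TensorProduct.ext' fun x y => ?_)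
  obtain ⟨x, rfl⟩ := (ψ.primitive r).surjective x
  obtain ⟨y, rfl⟩ := (ψ.primitive s).surjective y
  apply (conc r s).injective
  exact (conc_coboundary _ r s x y).trans (ψ.conc_toFun r s x y).symm

/-- Multiplicative extensions into a twisted algebra. -/
theorem evMap_toTwist (A : ConicSpace k) (ψ : CounitalCocycle k A.gen)
    (h : Admissible A ψ.toFun) (ρ : V →ₗ[k] A.gen) (θ : OneCochain k V)
    (h0 : θ 0 = LinearEquiv.refl k _) (h1 : θ 1 = LinearEquiv.refl k _)
    (hρ : IsTranslation ρ (coboundary θ) ψ.toFun) (n : ℕ) (x : ⨂[k]^n V) :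
    evMap ((toTwist A ψ h).toLinearMap ∘ₗ A.gen.subtype ∘ₗ ρ) n x =
      toTwist A ψ h (evMap (A.gen.subtype ∘ₗ ρ) n (θ n x)) := by
  induction n with
  | zero =>
    obtain ⟨c, rfl⟩ := exists_smul_tprod_zero x
    rw [h0, LinearEquiv.refl_apply, map_smul, map_smul, map_smul, evMap_zero_tprod,
      evMap_zero_tprod]
    rfl
  | succ n ih =>
    obtain ⟨z, rfl⟩ := (conc n 1).surjective x
    induction z using TensorProduct.induction_on with
    | zero => simp
    | add a b ha hb => simp only [map_add, ha, hb]
    | tmul y z =>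
      obtain ⟨v, rfl⟩ := exists_tprod_one z
      have hz : evMap ((toTwist A ψ h).toLinearMap ∘ₗ A.gen.subtype ∘ₗ ρ) 1
          (PiTensorProduct.tprod k fun _ => v) = toTwist A ψ h (ev A 1
            (PiTensorProduct.map (fun _ => ρ) (PiTensorProduct.tprod k fun _ => v))) := by
        rw [evMap_one, ev_eq_evMap, evMap_map, evMap_one]
        rfl
      rw [evMap_conc, ih, hz, ← evMap_map, ← ev_eq_evMap, toTwist_mul, twistMul_ev]
      congr 1
      -- The translation hypothesis moves `ψ_{n,1}` up to `V`, where it is `∂θ` applied to `θ y ⊗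
      -- v`; as `θ 1` is the identity, this concatenates to `θ` of the longer word.
      have h2 := LinearMap.congr_fun (hρ n 1) (θ n y ⊗ₜ (PiTensorProduct.tprod k fun _ => v))
      simp only [LinearMap.comp_apply, LinearEquiv.coe_coe, TensorProduct.map_tmul] at h2
      rw [← h2, ← conc_coboundary, h1, LinearEquiv.refl_apply, ev_eq_evMap, evMap_conc', evMap_conc']
      generalize (coboundary θ n 1) _ = w
      induction w using TensorProduct.induction_on with
      | zero => simp
      | add a b ha hb => simp only [map_add, ha, hb]
      | tmul a b => simp [evMap_map]

end CochainCalculus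
end
end QuantumSpace

namespace QuantumSpace

noncomputable section

/-! ### Primitives of joint and contragredient cochains. -/

section JointCochains

variable {k : Type u} [Field k] {V X Y : Type u} [AddCommGroup V] [Module k V]
  [AddCommGroup X] [Module k X] [AddCommGroup Y] [Module k Y]

theorem shuffleEquiv_tprod (n : ℕ) (x : Fin n → X) (y : Fin n → Y) :
    shuffleEquiv k X Y n (PiTensorProduct.tprod k x ⊗ₜ PiTensorProduct.tprod k y) =
      PiTensorProduct.tprod k fun i => x i ⊗ₜ[k] y i :=
  shuffle_tmul X Y n x y

theorem append_tmul {r s : ℕ} (x : Fin r → X) (x' : Fin s → X) (y : Fin r → Y) (y' : Fin s → Y) :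
    (fun i => Fin.append x x' i ⊗ₜ[k] Fin.append y y' i) =
      Fin.append (fun i => x i ⊗ₜ[k] y i) fun i => x' i ⊗ₜ[k] y' i := by
  funext i
  refine Fin.addCases (fun i => ?_) (fun i => ?_) i <;> simp

theorem conc_shuffle (r s : ℕ) (x : ⨂[k]^r X) (y : ⨂[k]^r Y) (x' : ⨂[k]^s X) (y' : ⨂[k]^s Y) :
    conc r s (shuffleEquiv k X Y r (x ⊗ₜ y) ⊗ₜ shuffleEquiv k X Y s (x' ⊗ₜ y')) =
      shuffleEquiv k X Y (r + s) (conc r s (x ⊗ₜ x') ⊗ₜ conc r s (y ⊗ₜ y')) := by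
  suffices h : (conc r s).toLinearMap ∘ₗ TensorProduct.map (shuffleEquiv k X Y r).toLinearMap
      (shuffleEquiv k X Y s).toLinearMap =
      (shuffleEquiv k X Y (r + s)).toLinearMap ∘ₗ TensorProduct.map (conc r s).toLinearMap
        (conc r s).toLinearMap ∘ₗ (TensorProduct.tensorTensorTensorComm k _ _ _ _).toLinearMap from
    LinearMap.congr_fun h ((x ⊗ₜ y) ⊗ₜ (x' ⊗ₜ y'))
  ext a b c d
  simp [conc_tprod, shuffleEquiv_tprod, append_tmul]

/-- The letterwise rearrangement `X^r ⊗ X^s ⊗ Y^r ⊗ Y^s ≃ (X ⊗ Y)^r ⊗ (X ⊗ Y)^s`. -/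
def jointEquiv (k X Y : Type u) [Field k] [AddCommGroup X] [Module k X] [AddCommGroup Y]
    [Module k Y] (r s : ℕ) : (((⨂[k]^r X) ⊗[k] (⨂[k]^s X)) ⊗[k] ((⨂[k]^r Y) ⊗[k] (⨂[k]^s Y))) ≃ₗ[k]
      ((⨂[k]^r (X ⊗[k] Y)) ⊗[k] (⨂[k]^s (X ⊗[k] Y))) :=
  TensorProduct.tensorTensorTensorComm k _ _ _ _ ≪≫ₗ
    TensorProduct.congr (shuffleEquiv k X Y r) (shuffleEquiv k X Y s)

theorem jointEquiv_tmul (r s : ℕ) (x : ⨂[k]^r X) (x' : ⨂[k]^s X) (y : ⨂[k]^r Y) (y' : ⨂[k]^s Y) :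
    jointEquiv k X Y r s ((x ⊗ₜ x') ⊗ₜ (y ⊗ₜ y')) =
      shuffleEquiv k X Y r (x ⊗ₜ y) ⊗ₜ shuffleEquiv k X Y s (x' ⊗ₜ y') := by
  simp [jointEquiv]

theorem joint_jointEquiv (ψ : TwoCochain k X) (χ : TwoCochain k Y) (r s : ℕ)
    (z : ((⨂[k]^r X) ⊗[k] (⨂[k]^s X)) ⊗[k] ((⨂[k]^r Y) ⊗[k] (⨂[k]^s Y))) :
    joint ψ χ r s (jointEquiv k X Y r s z) =
      jointEquiv k X Y r s (TensorProduct.congr (ψ r s) (χ r s) z) := by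
  change jointEquiv k X Y r s (TensorProduct.congr (ψ r s) (χ r s)
    ((jointEquiv k X Y r s).symm (jointEquiv k X Y r s z))) = _
  rw [LinearEquiv.symm_apply_apply]

theorem conc_jointEquiv (r s : ℕ)
    (z : ((⨂[k]^r X) ⊗[k] (⨂[k]^s X)) ⊗[k] ((⨂[k]^r Y) ⊗[k] (⨂[k]^s Y))) :
    conc r s (jointEquiv k X Y r s z) =
      shuffleEquiv k X Y (r + s) (TensorProduct.congr (conc r s) (conc r s) z) := by
  suffices h : (conc r s).toLinearMap ∘ₗ (jointEquiv k X Y r s).toLinearMap =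
      (shuffleEquiv k X Y (r + s)).toLinearMap ∘ₗ
        (TensorProduct.congr (conc r s) (conc r s)).toLinearMap from LinearMap.congr_fun h z
  refine TensorProduct.ext_fourfold' fun x x' y y' => ?_
  simpa [jointEquiv_tmul] using conc_shuffle r s x y x' y'

/-- The `1`-cochain of `X ⊗ Y` acting as `θ` on the `X`-letters and as `η` on the `Y`-letters. -/
def jointOne (θ : OneCochain k X) (η : OneCochain k Y) : OneCochain k (X ⊗[k] Y) := fun n =>
  (shuffleEquiv k X Y n).symm ≪≫ₗ TensorProduct.congr (θ n) (η n) ≪≫ₗ shuffleEquiv k X Y n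

theorem jointOne_shuffle (θ : OneCochain k X) (η : OneCochain k Y) (n : ℕ)
    (z : (⨂[k]^n X) ⊗[k] (⨂[k]^n Y)) :
    jointOne θ η n (shuffleEquiv k X Y n z) =
      shuffleEquiv k X Y n (TensorProduct.congr (θ n) (η n) z) := by
  simp [jointOne]

theorem jointOne_eq_refl (θ : OneCochain k X) (η : OneCochain k Y) (n : ℕ)
    (hθ : θ n = LinearEquiv.refl k _) (hη : η n = LinearEquiv.refl k _) :
    jointOne θ η n = LinearEquiv.refl k _ := by
  refine LinearEquiv.ext fun x => ?_
  simp [jointOne, hθ, hη]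

/-- The letterwise rearrangement intertwines concatenation of mixed words with separate
concatenation of the two kinds of letters, so the coboundary can be formed on each kind separately.
-/
theorem coboundary_jointOne (θ : OneCochain k X) (η : OneCochain k Y) :
    coboundary (jointOne θ η) = joint (coboundary θ) (coboundary η) := by
  funext r s
  refine LinearEquiv.ext fun w => ?_
  -- Writing the argument as a rearranged image under `θ` and `η` cancels every inverse on both
  -- sides.
  obtain ⟨z, rfl⟩ := (TensorProduct.congr (TensorProduct.congr (θ r) (θ s))
    (TensorProduct.congr (η r) (η s)) ≪≫ₗ jointEquiv k X Y r s).surjective w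
  have h1 : jointEquiv k X Y r s (TensorProduct.congr (TensorProduct.congr (θ r) (θ s))
      (TensorProduct.congr (η r) (η s)) z) =
      TensorProduct.congr (jointOne θ η r) (jointOne θ η s) (jointEquiv k X Y r s z) := by
    suffices h : (jointEquiv k X Y r s).toLinearMap ∘ₗ
        (TensorProduct.congr (TensorProduct.congr (θ r) (θ s))
          (TensorProduct.congr (η r) (η s))).toLinearMap =
        (TensorProduct.congr (jointOne θ η r) (jointOne θ η s)).toLinearMap ∘ₗ
          (jointEquiv k X Y r s).toLinearMap from LinearMap.congr_fun h z
    refine TensorProduct.ext_fourfold' fun x x' y y' => ?_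
    simp [jointEquiv_tmul, jointOne_shuffle]
  rw [LinearEquiv.trans_apply, joint_jointEquiv, h1, coboundary_congr_apply,
    LinearEquiv.symm_apply_eq, conc_jointEquiv, conc_jointEquiv, jointOne_shuffle]
  congr 1
  suffices h : (TensorProduct.congr (θ (r + s)) (η (r + s))).toLinearMap ∘ₗ
      (TensorProduct.congr (conc r s) (conc r s)).toLinearMap =
      (TensorProduct.congr (conc r s) (conc r s)).toLinearMap ∘ₗ
      (TensorProduct.congr (coboundary θ r s) (coboundary η r s)).toLinearMap ∘ₗ
      (TensorProduct.congr (TensorProduct.congr (θ r) (θ s))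
        (TensorProduct.congr (η r) (η s))).toLinearMap from LinearMap.congr_fun h z
  refine TensorProduct.ext_fourfold' fun x x' y y' => ?_
  simp [coboundary_tmul]

/-- The identity `1`-cochain. -/
def idOne (k V : Type u) [Field k] [AddCommGroup V] [Module k V] : OneCochain k V :=
  fun _ => LinearEquiv.refl k _

theorem coboundary_idOne : coboundary (idOne k V) = idCochain k V := by
  funext r s
  refine LinearEquiv.toLinearMap_injective (TensorProduct.ext' fun x y => ?_)
  refine (coboundary_tmul (idOne k V) r s x y).trans ?_
  simp [idOne, idCochain]

variable [Module.Finite k V]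

/-- The identification of `(V^*)^{⊗n}` with the dual of `V^{⊗n}`. -/
abbrev dualPow (k V : Type u) [Field k] [AddCommGroup V] [Module k V] [Module.Finite k V] (n : ℕ) :
    (⨂[k]^n (Module.Dual k V)) ≃ₗ[k] Module.Dual k (⨂[k]^n V) :=
  PiTensorProduct.dualDistribEquiv

/-- The identification of `(V^*)^{⊗r} ⊗ (V^*)^{⊗s}` with the dual of `V^{⊗r} ⊗ V^{⊗s}`. -/
def dualPow₂ (k V : Type u) [Field k] [AddCommGroup V] [Module k V] [Module.Finite k V] (r s : ℕ) :
    ((⨂[k]^r (Module.Dual k V)) ⊗[k] (⨂[k]^s (Module.Dual k V))) ≃ₗ[k]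
        Module.Dual k ((⨂[k]^r V) ⊗[k] (⨂[k]^s V)) :=
  TensorProduct.congr (dualPow k V r) (dualPow k V s) ≪≫ₗ TensorProduct.dualDistribEquiv k _ _

theorem dualPow_tprod (n : ℕ) (f : Fin n → Module.Dual k V) (v : Fin n → V) :
    dualPow k V n (PiTensorProduct.tprod k f) (PiTensorProduct.tprod k v) = ∏ i, f i (v i) :=
  PiTensorProduct.dualDistrib_apply f v

theorem dualPow₂_tmul (r s : ℕ) (f : ⨂[k]^r (Module.Dual k V)) (g : ⨂[k]^s (Module.Dual k V))
    (x : ⨂[k]^r V) (y : ⨂[k]^s V) :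
    dualPow₂ k V r s (f ⊗ₜ g) (x ⊗ₜ y) = dualPow k V r f x * dualPow k V s g y := rfl

theorem dualPow_conc (r s : ℕ) (t : (⨂[k]^r (Module.Dual k V)) ⊗[k] (⨂[k]^s (Module.Dual k V)))
    (z : (⨂[k]^r V) ⊗[k] (⨂[k]^s V)) :
    dualPow k V (r + s) (conc r s t) (conc r s z) = dualPow₂ k V r s t z := by
  suffices h : (conc r s).dualMap.toLinearMap ∘ₗ (dualPow k V (r + s)).toLinearMap ∘ₗ
      (conc r s).toLinearMap = (dualPow₂ k V r s).toLinearMap from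
    LinearMap.congr_fun (LinearMap.congr_fun h t) z
  ext a b c d
  change dualPow k V (r + s) (conc r s (PiTensorProduct.tprod k a ⊗ₜ PiTensorProduct.tprod k b))
    (conc r s (PiTensorProduct.tprod k c ⊗ₜ PiTensorProduct.tprod k d)) =
    dualPow k V r (PiTensorProduct.tprod k a) (PiTensorProduct.tprod k c) *
      dualPow k V s (PiTensorProduct.tprod k b) (PiTensorProduct.tprod k d)
  rw [conc_tprod, conc_tprod, dualPow_tprod, dualPow_tprod, dualPow_tprod, Fin.prod_univ_add]
  simp

theorem dualPow₂_contragredient (ψ : TwoCochain k V) (r s : ℕ)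
    (t : (⨂[k]^r (Module.Dual k V)) ⊗[k] (⨂[k]^s (Module.Dual k V)))
    (z : (⨂[k]^r V) ⊗[k] (⨂[k]^s V)) :
    dualPow₂ k V r s (contragredient ψ r s t) z = dualPow₂ k V r s t ((ψ r s).symm z) := by
  change dualPow₂ k V r s ((dualPow₂ k V r s).symm
    ((ψ r s).symm.dualMap (dualPow₂ k V r s t))) z = _
  rw [LinearEquiv.apply_symm_apply]
  rfl

/-- The contragredient `1`-cochain. -/
def contraOne (θ : OneCochain k V) : OneCochain k (Module.Dual k V) := fun n =>
  dualPow k V n ≪≫ₗ (θ n).symm.dualMap ≪≫ₗ (dualPow k V n).symm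

theorem dualPow_contraOne (θ : OneCochain k V) (n : ℕ) (t : ⨂[k]^n (Module.Dual k V))
    (x : ⨂[k]^n V) : dualPow k V n (contraOne θ n t) x = dualPow k V n t ((θ n).symm x) := by
  rw [contraOne, LinearEquiv.trans_apply, LinearEquiv.trans_apply, LinearEquiv.apply_symm_apply]
  rfl

theorem contraOne_eq_refl (θ : OneCochain k V) (n : ℕ) (hθ : θ n = LinearEquiv.refl k _) :
    contraOne θ n = LinearEquiv.refl k _ := by
  refine LinearEquiv.ext fun t => (dualPow k V n).injective (LinearMap.ext fun x => ?_)
  rw [dualPow_contraOne, hθ]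
  rfl

/-- Taking inverse transposes preserves the order of composition, and the pairing of words is
multiplicative for concatenation, so inverse transposition commutes with `∂`. -/
theorem coboundary_contraOne (θ : OneCochain k V) :
    coboundary (contraOne θ) = contragredient (coboundary θ) := by
  funext r s
  refine LinearEquiv.ext fun w => (dualPow₂ k V r s).injective (LinearMap.ext fun z => ?_)
  obtain ⟨t, rfl⟩ := (TensorProduct.congr (contraOne θ r) (contraOne θ s)).surjective w
  -- This form of the test vector cancels the inverse of `∂θ` that the contragredient introduces.
  obtain ⟨z, rfl⟩ := (TensorProduct.congr (θ r) (θ s) ≪≫ₗ coboundary θ r s).surjective z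
  rw [dualPow₂_contragredient, coboundary_congr_apply, ← dualPow_conc,
    LinearEquiv.apply_symm_apply, dualPow_contraOne, LinearEquiv.trans_apply,
    LinearEquiv.symm_apply_apply, coboundary_congr_apply, LinearEquiv.apply_symm_apply,
    LinearEquiv.symm_apply_apply, dualPow_conc]
  suffices h : (dualPow₂ k V r s).toLinearMap = (TensorProduct.congr (θ r) (θ s)).dualMap.toLinearMap ∘ₗ
      (dualPow₂ k V r s).toLinearMap ∘ₗ
        (TensorProduct.congr (contraOne θ r) (contraOne θ s)).toLinearMap from
    LinearMap.congr_fun (LinearMap.congr_fun h t) z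
  refine TensorProduct.ext' fun f g => TensorProduct.ext' fun x y => ?_
  change dualPow₂ k V r s (f ⊗ₜ g) (x ⊗ₜ y) =
    dualPow₂ k V r s (contraOne θ r f ⊗ₜ contraOne θ s g) (θ r x ⊗ₜ θ s y)
  simp only [dualPow₂_tmul, dualPow_contraOne, LinearEquiv.symm_apply_apply]

end JointCochains
end
end QuantumSpace

namespace QuantumSpace

noncomputable section

/-! ### Placed relations, the ideal they generate, and stability under cochains. -/

section Placement

variable {k : Type u} [Field k] {V X Y : Type u} [AddCommGroup V] [Module k V]
  [AddCommGroup X] [Module k X] [AddCommGroup Y] [Module k Y]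

theorem map₂_map₂_le {M M' N N' P Q T : Type*} [AddCommGroup M] [Module k M] [AddCommGroup M']
    [Module k M'] [AddCommGroup N] [Module k N] [AddCommGroup N'] [Module k N'] [AddCommGroup P]
    [Module k P] [AddCommGroup Q] [Module k Q] [AddCommGroup T] [Module k T]
    (f : P →ₗ[k] Q →ₗ[k] T) (g : M →ₗ[k] M' →ₗ[k] P) (g' : N →ₗ[k] N' →ₗ[k] Q)
    (m : Submodule k M) (m' : Submodule k M') (n : Submodule k N) (n' : Submodule k N')
    (t : Submodule k T)
    (h : ∀ a ∈ m, ∀ a' ∈ m', ∀ b ∈ n, ∀ b' ∈ n', f (g a a') (g' b b') ∈ t) :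
    Submodule.map₂ f (Submodule.map₂ g m m') (Submodule.map₂ g' n n') ≤ t := by
  refine Submodule.map₂_le.2 fun x hx y hy => ?_
  have h1 : Submodule.map₂ g m m' ≤ t.comap (f.flip y) := Submodule.map₂_le.2 fun a ha a' ha' => by
    have h2 : Submodule.map₂ g' n n' ≤ t.comap (f (g a a')) :=
      Submodule.map₂_le.2 fun b hb b' hb' => h a ha a' ha' b hb b' hb'
    exact h2 hy
  exact h1 hx

theorem map₂_mk_top_top {M N : Type*} [AddCommGroup M] [Module k M] [AddCommGroup N] [Module k N] :
    Submodule.map₂ (TensorProduct.mk k M N) ⊤ ⊤ = ⊤ :=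
  TensorProduct.map₂_mk_top_top_eq_top k M N

theorem map_congr_map₂_mk {M N M' N' : Type*} [AddCommGroup M] [Module k M] [AddCommGroup N]
    [Module k N] [AddCommGroup M'] [Module k M'] [AddCommGroup N'] [Module k N']
    (e : M ≃ₗ[k] M') (e' : N ≃ₗ[k] N') (P : Submodule k M) (Q : Submodule k N) :
    (Submodule.map₂ (TensorProduct.mk k M N) P Q).map (TensorProduct.congr e e').toLinearMap =
      Submodule.map₂ (TensorProduct.mk k M' N') (P.map e.toLinearMap) (Q.map e'.toLinearMap) := by
  rw [Submodule.map_map₂, Submodule.map₂_map_map]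
  congr 1

/-- The product `P ⊗ Q ⊆ V^{⊗(r+s)}` of subspaces of tensor powers. -/
def concSub {r s : ℕ} (P : Submodule k (⨂[k]^r V)) (Q : Submodule k (⨂[k]^s V)) :
    Submodule k (⨂[k]^(r + s) V) :=
  Submodule.map₂ (TensorProduct.curry (conc r s).toLinearMap) P Q

theorem concSub_eq_map {r s : ℕ} (P : Submodule k (⨂[k]^r V)) (Q : Submodule k (⨂[k]^s V)) :
    concSub P Q = (Submodule.map₂ (TensorProduct.mk k _ _) P Q).map (conc r s).toLinearMap := by
  rw [Submodule.map_map₂]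
  rfl

theorem conc_mem_concSub {r s : ℕ} {P : Submodule k (⨂[k]^r V)} {Q : Submodule k (⨂[k]^s V)}
    {x : ⨂[k]^r V} {y : ⨂[k]^s V} (hx : x ∈ P) (hy : y ∈ Q) :
    conc r s (x ⊗ₜ y) ∈ concSub P Q :=
  Submodule.apply_mem_map₂ _ hx hy

theorem concSub_le {r s : ℕ} {P : Submodule k (⨂[k]^r V)} {Q : Submodule k (⨂[k]^s V)}
    {T : Submodule k (⨂[k]^(r + s) V)} :
    concSub P Q ≤ T ↔ ∀ x ∈ P, ∀ y ∈ Q, conc r s (x ⊗ₜ y) ∈ T :=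
  Submodule.map₂_le

theorem concSub_top_top (r s : ℕ) :
    concSub (⊤ : Submodule k (⨂[k]^r V)) (⊤ : Submodule k (⨂[k]^s V)) = ⊤ := by
  rw [concSub_eq_map, map₂_mk_top_top, Submodule.map_top, LinearEquiv.range]

/-- Both inclusions are checked on pure products, where they are associativity of concatenation. -/
theorem map_cast_concSub_assoc {r s t : ℕ} (P : Submodule k (⨂[k]^r V))
    (Q : Submodule k (⨂[k]^s V)) (T : Submodule k (⨂[k]^t V)) :
    (concSub (concSub P Q) T).map (TensorPower.cast k V (add_assoc r s t)).toLinearMap =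
      concSub P (concSub Q T) := by
  refine le_antisymm ?_ ?_
  · rw [Submodule.map_le_iff_le_comap, concSub_le]
    intro x hx z hz
    have h : concSub P Q ≤ (concSub P (concSub Q T)).comap
        ((TensorPower.cast k V (add_assoc r s t)).toLinearMap ∘ₗ
          (TensorProduct.curry (conc (r + s) t).toLinearMap).flip z) := by
      refine concSub_le.2 fun x hx y hy => ?_
      change TensorPower.cast k V (add_assoc r s t)
        (conc (r + s) t (conc r s (x ⊗ₜ y) ⊗ₜ z)) ∈ concSub P (concSub Q T)
      rw [conc_assoc]
      exact conc_mem_concSub hx (conc_mem_concSub hy hz)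
    exact h hx
  · rw [concSub_le]
    intro x hx z hz
    have h : concSub Q T ≤ ((concSub (concSub P Q) T).map
        (TensorPower.cast k V (add_assoc r s t)).toLinearMap).comap
          (TensorProduct.curry (conc r (s + t)).toLinearMap x) := by
      refine concSub_le.2 fun y hy z hz => ?_
      change conc r (s + t) (x ⊗ₜ conc s t (y ⊗ₜ z)) ∈ (concSub (concSub P Q) T).map
        (TensorPower.cast k V (add_assoc r s t)).toLinearMap
      rw [← conc_assoc]
      exact Submodule.mem_map_of_mem (f := (TensorPower.cast k V (add_assoc r s t)).toLinearMap)
        (conc_mem_concSub (conc_mem_concSub hx hy) hz)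
    exact h hz

theorem concSub_top_zero {r : ℕ} (P : Submodule k (⨂[k]^r V)) :
    concSub P (⊤ : Submodule k (⨂[k]^0 V)) = P := by
  refine le_antisymm (concSub_le.2 fun x hx y _ => ?_) fun x hx => ?_
  · obtain ⟨c, rfl⟩ := exists_smul_tprod_zero y
    rw [TensorProduct.tmul_smul, map_smul, conc_one]
    exact P.smul_mem c hx
  · rw [← conc_one r Fin.elim0 x]
    exact conc_mem_concSub hx trivial

theorem concSub_zero_top {s : ℕ} (P : Submodule k (⨂[k]^s V)) :
    concSub (⊤ : Submodule k (⨂[k]^0 V)) P =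
      P.map (TensorPower.cast k V (zero_add s).symm).toLinearMap := by
  refine le_antisymm (concSub_le.2 fun y _ x hx => ?_) ?_
  · obtain ⟨c, rfl⟩ := exists_smul_tprod_zero y
    rw [← TensorProduct.smul_tmul', map_smul, one_conc]
    exact Submodule.smul_mem _ c
      (Submodule.mem_map_of_mem (f := (TensorPower.cast k V (zero_add s).symm).toLinearMap) hx)
  · rintro _ ⟨x, hx, rfl⟩
    change TensorPower.cast k V (zero_add s).symm x ∈ _
    rw [← one_conc s Fin.elim0 x]
    exact conc_mem_concSub trivial hx

theorem concSub_map_cast_left {r r' s : ℕ} (h : r = r') (P : Submodule k (⨂[k]^r V))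
    (Q : Submodule k (⨂[k]^s V)) :
    concSub (P.map (TensorPower.cast k V h).toLinearMap) Q =
      (concSub P Q).map (TensorPower.cast k V (congrArg (· + s) h)).toLinearMap := by
  subst h
  simp

theorem concSub_iSup_left {ι : Sort*} {r s : ℕ} (P : ι → Submodule k (⨂[k]^r V))
    (Q : Submodule k (⨂[k]^s V)) : concSub (⨆ i, P i) Q = ⨆ i, concSub (P i) Q :=
  Submodule.map₂_iSup_left _ _ _

theorem concSub_iSup_right {ι : Sort*} {r s : ℕ} (P : Submodule k (⨂[k]^r V))
    (Q : ι → Submodule k (⨂[k]^s V)) : concSub P (⨆ i, Q i) = ⨆ i, concSub P (Q i) :=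
  Submodule.map₂_iSup_right _ _ _

/-- The subspace `V^{⊗i} ⊗ Rⱼ ⊗ V^{⊗l}` of `V^{⊗(i+j+l)}`. -/
def placed (R : ∀ n, Submodule k (⨂[k]^n V)) (i j l : ℕ) : Submodule k (⨂[k]^(i + j + l) V) :=
  concSub (concSub (⊤ : Submodule k (⨂[k]^i V)) (R j)) ⊤

/-- The homogeneous ideal generated by the relations `R`. -/
def genIdeal (R : ∀ n, Submodule k (⨂[k]^n V)) (n : ℕ) : Submodule k (⨂[k]^n V) :=
  ⨆ (i : ℕ) (j : ℕ) (l : ℕ) (h : i + j + l = n),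
    (placed R i j l).map (TensorPower.cast k V h).toLinearMap

theorem map_cast_placed_le (R : ∀ n, Submodule k (⨂[k]^n V)) {i j l n : ℕ} (h : i + j + l = n) :
    (placed R i j l).map (TensorPower.cast k V h).toLinearMap ≤ genIdeal R n :=
  le_iSup_of_le i <| le_iSup_of_le j <| le_iSup_of_le l <| le_iSup_of_le h le_rfl

theorem map_cast_map_cast {i j l : ℕ} (h : i = j) (h' : j = l) (P : Submodule k (⨂[k]^i V)) :
    (P.map (TensorPower.cast k V h).toLinearMap).map (TensorPower.cast k V h').toLinearMap =
      P.map (TensorPower.cast k V (h.trans h')).toLinearMap := by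
  subst h h'
  simp

theorem map_cast_eq_iff {i j : ℕ} (h : i = j) (P : Submodule k (⨂[k]^i V))
    (Q : Submodule k (⨂[k]^j V)) : P.map (TensorPower.cast k V h).toLinearMap = Q ↔
      P = Q.map (TensorPower.cast k V h.symm).toLinearMap := by
  subst h
  simp

theorem isIdealFamily_iff (J : ∀ n, Submodule k (⨂[k]^n V)) : IsIdealFamily J ↔
    ∀ r s, concSub (J r) (⊤ : Submodule k (⨂[k]^s V)) ≤ J (r + s) ∧
      concSub (⊤ : Submodule k (⨂[k]^r V)) (J s) ≤ J (r + s) := by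
  refine ⟨fun h r s => ⟨concSub_le.2 fun x hx y _ => h r s x y (Or.inl hx),
    concSub_le.2 fun x _ y hy => h r s x y (Or.inr hy)⟩, fun h r s x y hxy => ?_⟩
  rcases hxy with hx | hy
  · exact concSub_le.1 (h r s).1 x hx y trivial
  · exact concSub_le.1 (h r s).2 x trivial y hy

/-- Multiplying a placed relation by further letters on the right only enlarges `l`, and on the left
only enlarges `i`. -/
theorem isIdealFamily_genIdeal (R : ∀ n, Submodule k (⨂[k]^n V)) : IsIdealFamily (genIdeal R) := by
  refine (isIdealFamily_iff _).2 fun r s => ⟨?_, ?_⟩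
  · simp only [genIdeal, concSub_iSup_left]
    refine iSup_le fun i => iSup_le fun j => iSup_le fun l => iSup_le fun h => ?_
    subst h
    simp only [TensorPower.cast_refl, LinearEquiv.refl_toLinearMap, Submodule.map_id]
    have h1 := map_cast_concSub_assoc (concSub (⊤ : Submodule k (⨂[k]^i V)) (R j))
      (⊤ : Submodule k (⨂[k]^l V)) (⊤ : Submodule k (⨂[k]^s V))
    rw [map_cast_eq_iff, concSub_top_top] at h1
    exact h1.trans_le (map_cast_placed_le R _)
  · simp only [genIdeal, concSub_iSup_right]
    refine iSup_le fun i => iSup_le fun j => iSup_le fun l => iSup_le fun h => ?_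
    subst h
    simp only [TensorPower.cast_refl, LinearEquiv.refl_toLinearMap, Submodule.map_id]
    have h1 := map_cast_concSub_assoc (⊤ : Submodule k (⨂[k]^r V))
      (⊤ : Submodule k (⨂[k]^i V)) (R j)
    rw [concSub_top_top] at h1
    rw [placed, ← map_cast_concSub_assoc, ← h1, concSub_map_cast_left, map_cast_map_cast]
    exact map_cast_placed_le R _

theorem isIdealFamily_ker_evMap {S : Type u} [Ring S] [Algebra k S] (q : V →ₗ[k] S) :
    IsIdealFamily fun n => LinearMap.ker (evMap q n) := by
  intro r s x y h
  rw [LinearMap.mem_ker, evMap_conc]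
  rcases h with h | h
  · rw [LinearMap.mem_ker.1 h, zero_mul]
  · rw [LinearMap.mem_ker.1 h, mul_zero]

theorem genIdeal_eq_bot (R : ∀ n, Submodule k (⨂[k]^n V)) (n : ℕ) (h : ∀ j ≤ n, R j = ⊥) :
    genIdeal R n = ⊥ := by
  simp only [genIdeal, iSup_eq_bot]
  intro i j l hn
  rw [placed, h j (by omega)]
  simp [concSub]

/-- A subspace of a tensor power is stable under a `2`-cochain if the latter preserves it when
placed in either of the two tensor factors. -/
def Stable (D : TwoCochain k V) {n : ℕ} (U : Submodule k (⨂[k]^n V)) : Prop :=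
  ∀ s, (Submodule.map₂ (TensorProduct.mk k _ (⨂[k]^s V)) U ⊤).map (D n s).toLinearMap =
      Submodule.map₂ (TensorProduct.mk k _ _) U ⊤ ∧
    (Submodule.map₂ (TensorProduct.mk k (⨂[k]^s V) _) ⊤ U).map (D s n).toLinearMap =
      Submodule.map₂ (TensorProduct.mk k _ _) ⊤ U

theorem SecondAdmissible.stable {A : ConicSpace k} {D : TwoCochain k A.gen}
    (h : SecondAdmissible A D) (i j l : ℕ) :
    Stable D (placed (fun n => LinearMap.ker (ev A n)) i j l) := fun s => h i j l s

theorem Stable.map_cast {D : TwoCochain k V} {m n : ℕ} (h : m = n) {U : Submodule k (⨂[k]^m V)} :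
    Stable D (U.map (TensorPower.cast k V h).toLinearMap) ↔ Stable D U := by
  subst h
  simp

theorem Stable.iSup {D : TwoCochain k V} {ι : Sort*} {n : ℕ} {U : ι → Submodule k (⨂[k]^n V)}
    (h : ∀ i, Stable D (U i)) : Stable D (⨆ i, U i) := by
  intro s
  rw [Submodule.map₂_iSup_left, Submodule.map₂_iSup_right, Submodule.map_iSup, Submodule.map_iSup]
  exact ⟨iSup_congr fun i => (h i s).1, iSup_congr fun i => (h i s).2⟩

/-! ### Images of ideals under a `1`-cochain `θ` whose inverse has a stabilising coboundary. -/

section Twisting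

variable {θ : OneCochain k V}

/-- The source is the identity `θ_{r+s} ∘ m ∘ ∂(θ⁻¹) = m ∘ (θ_r ⊗ θ_s)`: on a product preserved by
`∂(θ⁻¹)`, the map `θ` behaves as if it were multiplicative. This is where the admissibility
hypothesis enters the comparison of ideals. -/
theorem map_concSub_of_map_eq (θ : OneCochain k V) {r s : ℕ} {P : Submodule k (⨂[k]^r V)}
    {Q : Submodule k (⨂[k]^s V)}
    (h : (Submodule.map₂ (TensorProduct.mk k _ _) P Q).map
      (coboundary (fun n => (θ n).symm) r s).toLinearMap =
        Submodule.map₂ (TensorProduct.mk k _ _) P Q) :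
    (concSub P Q).map (θ (r + s)).toLinearMap =
      concSub (P.map (θ r).toLinearMap) (Q.map (θ s).toLinearMap) := by
  have h1 : (θ (r + s)).toLinearMap ∘ₗ (conc r s).toLinearMap ∘ₗ
      (coboundary (fun n => (θ n).symm) r s).toLinearMap =
      (conc r s).toLinearMap ∘ₗ (TensorProduct.congr (θ r) (θ s)).toLinearMap := by
    refine TensorProduct.ext' fun x y => ?_
    have := conc_coboundary (fun n => (θ n).symm) r s (θ r x) (θ s y)
    simp only [LinearEquiv.symm_apply_apply] at this
    simp [this]
  rw [concSub_eq_map, ← h, ← Submodule.map_comp, ← Submodule.map_comp, LinearMap.comp_assoc, h1, Submodule.map_comp,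
    map_congr_map₂_mk, ← concSub_eq_map]

theorem map_equiv_top {M N : Type*} [AddCommGroup M] [Module k M] [AddCommGroup N] [Module k N]
    (e : M ≃ₗ[k] N) : (⊤ : Submodule k M).map e.toLinearMap = ⊤ := by
  rw [Submodule.map_top, LinearEquiv.range]

theorem Stable.map_concSub_left {n s : ℕ} {U : Submodule k (⨂[k]^n V)}
    (h : Stable (coboundary fun n => (θ n).symm) U) :
    (concSub U (⊤ : Submodule k (⨂[k]^s V))).map (θ (n + s)).toLinearMap =
      concSub (U.map (θ n).toLinearMap) ⊤ := by
  rw [map_concSub_of_map_eq θ (h s).1, map_equiv_top]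

theorem Stable.map_concSub_right {n s : ℕ} {U : Submodule k (⨂[k]^n V)}
    (h : Stable (coboundary fun n => (θ n).symm) U) :
    (concSub (⊤ : Submodule k (⨂[k]^s V)) U).map (θ (s + n)).toLinearMap =
      concSub ⊤ (U.map (θ n).toLinearMap) := by
  rw [map_concSub_of_map_eq θ (h s).2, map_equiv_top]

/-- Concatenation is injective on subspaces, and `m ∘ ∂θ ∘ (θ ⊗ θ) = θ ∘ m`; hence invariance under
`∂(θ⁻¹)` before applying `θ` becomes invariance under `∂θ` afterwards. It makes `∂θ` admissible for
the quotient by `θ J`. -/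
theorem map_coboundary_of_map_eq (θ : OneCochain k V) {r s : ℕ} {P : Submodule k (⨂[k]^r V)}
    {Q : Submodule k (⨂[k]^s V)}
    (h : (Submodule.map₂ (TensorProduct.mk k _ _) P Q).map
      (coboundary (fun n => (θ n).symm) r s).toLinearMap =
        Submodule.map₂ (TensorProduct.mk k _ _) P Q) :
    (Submodule.map₂ (TensorProduct.mk k _ _) (P.map (θ r).toLinearMap)
      (Q.map (θ s).toLinearMap)).map (coboundary θ r s).toLinearMap =
    Submodule.map₂ (TensorProduct.mk k _ _) (P.map (θ r).toLinearMap) (Q.map (θ s).toLinearMap) := by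
  apply Submodule.map_injective_of_injective (f := (conc r s).toLinearMap) (conc r s).injective
  rw [← concSub_eq_map, ← map_concSub_of_map_eq θ h, ← map_congr_map₂_mk, ← Submodule.map_comp,
    ← Submodule.map_comp, concSub_eq_map, ← Submodule.map_comp]
  congr 1
  refine TensorProduct.ext' fun x y => ?_
  exact conc_coboundary θ r s x y

theorem Stable.map_primitive {n : ℕ} {U : Submodule k (⨂[k]^n V)}
    (h : Stable (coboundary fun n => (θ n).symm) U) :
    Stable (coboundary θ) (U.map (θ n).toLinearMap) := fun s => by
  have h1 := map_coboundary_of_map_eq θ (h s).1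
  have h2 := map_coboundary_of_map_eq θ (h s).2
  rw [map_equiv_top] at h1 h2
  exact ⟨h1, h2⟩

variable {R : ∀ n, Submodule k (⨂[k]^n V)}

theorem stable_genIdeal
    (hR : ∀ i j l, Stable (coboundary fun n => (θ n).symm) (placed R i j l))
    (n : ℕ) : Stable (coboundary fun n => (θ n).symm) (genIdeal R n) :=
  Stable.iSup fun i => Stable.iSup fun j => Stable.iSup fun l => Stable.iSup fun h =>
    (Stable.map_cast h).2 (hR i j l)

/-- Stability lets `θ` be pulled out of a product with a full tensor power, which reduces the claim
to the ideal property of `genIdeal R`. -/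
theorem isIdealFamily_map_genIdeal
    (hR : ∀ i j l, Stable (coboundary fun n => (θ n).symm) (placed R i j l)) :
    IsIdealFamily fun n => (genIdeal R n).map (θ n).toLinearMap := by
  refine (isIdealFamily_iff _).2 fun r s => ⟨?_, ?_⟩
  · rw [← (stable_genIdeal hR r).map_concSub_left]
    exact Submodule.map_mono ((isIdealFamily_iff _).1 (isIdealFamily_genIdeal R) r s).1
  · rw [← (stable_genIdeal hR s).map_concSub_right]
    exact Submodule.map_mono ((isIdealFamily_iff _).1 (isIdealFamily_genIdeal R) r s).2

/-- With the previous lemma this identifies `θ J` as the smallest ideal containing `θ R`: each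
placed relation satisfies `θ(V^{⊗i} ⊗ Rⱼ ⊗ V^{⊗l}) = V^{⊗i} ⊗ θ Rⱼ ⊗ V^{⊗l}`. -/
theorem map_genIdeal_le
    (hR : ∀ i j l, Stable (coboundary fun n => (θ n).symm) (placed R i j l))
    {K : ∀ n, Submodule k (⨂[k]^n V)} (hK : IsIdealFamily K)
    (hRK : ∀ n, (R n).map (θ n).toLinearMap ≤ K n) (n : ℕ) :
    (genIdeal R n).map (θ n).toLinearMap ≤ K n := by
  rw [isIdealFamily_iff] at hK
  simp only [genIdeal, Submodule.map_iSup]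
  refine iSup_le fun i => iSup_le fun j => iSup_le fun l => iSup_le fun h => ?_
  subst h
  simp only [TensorPower.cast_refl, LinearEquiv.refl_toLinearMap, Submodule.map_id]
  -- The hypothesis at `l = 0`, and then at `i = 0`, gives stability of the intermediate spaces
  -- needed to strip the outer letters one side at a time.
  have hij : ∀ i, Stable (coboundary fun n => (θ n).symm)
      (concSub (⊤ : Submodule k (⨂[k]^i V)) (R j)) := fun i => by
    have := hR i j 0
    rw [placed, concSub_top_zero] at this
    exact this
  have hj : Stable (coboundary fun n => (θ n).symm) (R j) := by
    have := hij 0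
    rwa [concSub_zero_top, Stable.map_cast] at this
  rw [placed, (hij i).map_concSub_left, hj.map_concSub_right]
  refine (Submodule.map₂_le_map₂_left ?_).trans (hK (i + j) l).1
  exact (Submodule.map₂_le_map₂_right (hRK j)).trans (hK i j).2

end Twisting

end Placement
end
end QuantumSpace

namespace QuantumSpace

noncomputable section

/-! ### Contractions and annihilators in tensor powers of the dual. -/

section Duality

variable {k : Type u} [Field k]

/-- Contraction with a linear form on the second factor. -/
def contract {X : Type u} [AddCommGroup X] [Module k X] (M : Type u) [AddCommGroup M] [Module k M]
    (f : Module.Dual k X) : M ⊗[k] X →ₗ[k] M :=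
  (TensorProduct.rid k M).toLinearMap ∘ₗ f.lTensor M

@[simp]
theorem contract_tmul {X M : Type u} [AddCommGroup X] [Module k X] [AddCommGroup M] [Module k M]
    (f : Module.Dual k X) (m : M) (x : X) : contract M f (m ⊗ₜ x) = f x • m := by
  simp [contract]

theorem contract_map {X M N L : Type u} [AddCommGroup X] [Module k X] [AddCommGroup M] [Module k M]
    [AddCommGroup N] [Module k N] [AddCommGroup L] [Module k L] (f : M →ₗ[k] L) (g : X →ₗ[k] N)
    (β : Module.Dual k N) (t : M ⊗[k] X) :
    contract L β (TensorProduct.map f g t) = f (contract M (β ∘ₗ g) t) := by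
  suffices h : contract L β ∘ₗ TensorProduct.map f g = f ∘ₗ contract M (β ∘ₗ g) from
    LinearMap.congr_fun h t
  exact TensorProduct.ext' fun m x => by simp

/-- Coordinates with respect to a basis of `X` are contractions with coordinate forms. -/
theorem eq_zero_of_contract {X M : Type u} [AddCommGroup X] [Module k X] [AddCommGroup M]
    [Module k M] (t : M ⊗[k] X) (h : ∀ f : Module.Dual k X, contract M f t = 0) : t = 0 := by
  classical
  let b := Module.Free.chooseBasis k X
  apply (TensorProduct.equivFinsuppOfBasisRight b).injective
  rw [map_zero]
  ext i
  rw [TensorProduct.equivFinsuppOfBasisRight_apply]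
  exact h (b.coord i)

theorem sum_contract_tmul {X M ι : Type u} [AddCommGroup X] [Module k X] [AddCommGroup M]
    [Module k M] [Fintype ι] (b : Module.Basis ι k X) (t : M ⊗[k] X) :
    ∑ i, contract M (b.coord i) t ⊗ₜ[k] b i = t := by
  induction t using TensorProduct.induction_on with
  | zero => simp
  | add x y hx hy => simp only [map_add, TensorProduct.add_tmul, Finset.sum_add_distrib, hx, hy]
  | tmul m x =>
    simp only [contract_tmul, TensorProduct.smul_tmul, ← TensorProduct.tmul_sum]
    congr 1
    exact b.sum_repr x

/-- This is `(U ⊗ N)^⊥ = U^⊥ ⊗ N^*` for finite-dimensional `N`: expanding `t` along a dual basis,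
its coefficients are the forms `x ↦ t(x ⊗ bⱼ)`, and all of them must kill `U`. -/
theorem mem_map₂_annihilator_top {M M' N N' : Type u} [AddCommGroup M] [Module k M]
    [AddCommGroup M'] [Module k M'] [AddCommGroup N] [Module k N] [AddCommGroup N'] [Module k N']
    [Module.Finite k N] (D : M' ≃ₗ[k] Module.Dual k M) (E : N' ≃ₗ[k] Module.Dual k N)
    (U : Submodule k M) (t : M' ⊗[k] N') :
    t ∈ Submodule.map₂ (TensorProduct.mk k M' N') (U.dualAnnihilator.comap D.toLinearMap) ⊤ ↔
      ∀ x ∈ U, ∀ y, TensorProduct.dualDistrib k M N (TensorProduct.congr D E t) (x ⊗ₜ y) = 0 := by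
  classical
  constructor
  · intro h x hx y
    have : Submodule.map₂ (TensorProduct.mk k M' N') (U.dualAnnihilator.comap D.toLinearMap) ⊤ ≤
        LinearMap.ker (LinearMap.applyₗ (x ⊗ₜ[k] y) ∘ₗ TensorProduct.dualDistrib k M N ∘ₗ
          (TensorProduct.congr D E).toLinearMap) := by
      refine Submodule.map₂_le.2 fun f hf g _ => ?_
      have hf' : D f x = 0 := (Submodule.mem_dualAnnihilator _).1 hf x hx
      simp [hf']
    exact this h
  · intro h
    let b := Module.Free.chooseBasis k N
    -- The dual basis carried to `N'`, so that `E (c i)` is the `i`-th coordinate form of `b`.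
    let c := b.dualBasis.map E.symm
    have hc : ∀ i j, E (c i) (b j) = if j = i then 1 else 0 := fun i j => by
      simp [c, Finsupp.single_apply]
    have key : ∀ (t : M' ⊗[k] N') x j, TensorProduct.dualDistrib k M N (TensorProduct.congr D E t)
        (x ⊗ₜ b j) = D (contract M' (c.coord j) t) x := by
      intro t x j
      induction t using TensorProduct.induction_on with
      | zero => simp
      | add x y hx hy => simp only [map_add, LinearMap.add_apply, hx, hy]
      | tmul m n =>
        rw [← c.sum_repr n, TensorProduct.tmul_sum]
        simp only [map_sum, LinearMap.sum_apply]
        refine Finset.sum_congr rfl fun i _ => ?_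
        simp only [TensorProduct.tmul_smul, map_smul, TensorProduct.congr_tmul,
          LinearMap.smul_apply, TensorProduct.dualDistrib_apply, hc, contract_tmul,
          Module.Basis.coord_apply, Module.Basis.repr_self, Finsupp.single_apply, smul_eq_mul]
        by_cases hij : i = j
        · simp [hij]
        · simp [hij, Ne.symm hij]
    rw [← sum_contract_tmul c t]
    refine sum_mem fun i _ => Submodule.apply_mem_map₂ _ ?_ trivial
    rw [Submodule.mem_comap, Submodule.mem_dualAnnihilator]
    intro x hx
    exact (key t x i).symm.trans (h x hx _)

theorem mem_map₂_top_annihilator {M M' N N' : Type u} [AddCommGroup M] [Module k M]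
    [AddCommGroup M'] [Module k M'] [AddCommGroup N] [Module k N] [AddCommGroup N'] [Module k N']
    [Module.Finite k N] (D : M' ≃ₗ[k] Module.Dual k M) (E : N' ≃ₗ[k] Module.Dual k N)
    (U : Submodule k M) (t : N' ⊗[k] M') :
    t ∈ Submodule.map₂ (TensorProduct.mk k N' M') ⊤ (U.dualAnnihilator.comap D.toLinearMap) ↔
      ∀ x ∈ U, ∀ y, TensorProduct.dualDistrib k N M (TensorProduct.congr E D t) (y ⊗ₜ x) = 0 := by
  have h1 : Submodule.map₂ (TensorProduct.mk k N' M') ⊤ (U.dualAnnihilator.comap D.toLinearMap) =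
      (Submodule.map₂ (TensorProduct.mk k M' N') (U.dualAnnihilator.comap D.toLinearMap) ⊤).map
        (TensorProduct.comm k M' N').toLinearMap := by
    rw [Submodule.map_map₂, ← Submodule.map₂_flip]
    rfl
  rw [h1, Submodule.mem_map_equiv, TensorProduct.comm_symm, mem_map₂_annihilator_top D E U]
  refine forall₂_congr fun x _ => forall_congr' fun y => ?_
  have h2 : TensorProduct.dualDistrib k M N (TensorProduct.congr D E (TensorProduct.comm k N' M' t))
      (x ⊗ₜ y) = TensorProduct.dualDistrib k N M (TensorProduct.congr E D t) (y ⊗ₜ x) := by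
    induction t using TensorProduct.induction_on with
    | zero => simp
    | add x y hx hy => simp only [map_add, LinearMap.add_apply, hx, hy]
    | tmul m n => simp [mul_comm]
  rw [h2]

variable {V : Type u} [AddCommGroup V] [Module k V] [Module.Finite k V]

/-- The annihilator of a subspace of `V^{⊗n}` in `(V^*)^{⊗n}`. -/
def perp {n : ℕ} (U : Submodule k (⨂[k]^n V)) : Submodule k (⨂[k]^n (Module.Dual k V)) :=
  U.dualAnnihilator.comap (dualPow k V n).toLinearMap

theorem mem_perp {n : ℕ} {U : Submodule k (⨂[k]^n V)} {f : ⨂[k]^n (Module.Dual k V)} :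
    f ∈ perp U ↔ ∀ x ∈ U, dualPow k V n f x = 0 := by
  rw [perp, Submodule.mem_comap, Submodule.mem_dualAnnihilator]
  rfl

theorem forall_mem_map₂_mk {M N : Type u} [AddCommGroup M] [Module k M] [AddCommGroup N]
    [Module k N] (P : Submodule k M) (Q : Submodule k N) (F : Module.Dual k (M ⊗[k] N)) :
    (∀ z ∈ Submodule.map₂ (TensorProduct.mk k M N) P Q, F z = 0) ↔
      ∀ x ∈ P, ∀ y ∈ Q, F (x ⊗ₜ y) = 0 :=
  (Submodule.map₂_le (q := Q) (r := LinearMap.ker F))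

theorem mem_map₂_perp_top {r s : ℕ} {U : Submodule k (⨂[k]^r V)}
    {t : (⨂[k]^r (Module.Dual k V)) ⊗[k] (⨂[k]^s (Module.Dual k V))} :
    t ∈ Submodule.map₂ (TensorProduct.mk k _ _) (perp U) ⊤ ↔
      ∀ z ∈ Submodule.map₂ (TensorProduct.mk k _ _) U ⊤, dualPow₂ k V r s t z = 0 := by
  rw [forall_mem_map₂_mk]
  refine (mem_map₂_annihilator_top (dualPow k V r) (dualPow k V s) U t).trans ?_
  exact forall₂_congr fun x _ => ⟨fun h y _ => h y, fun h y => h y trivial⟩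

theorem mem_map₂_top_perp {r s : ℕ} {U : Submodule k (⨂[k]^s V)}
    {t : (⨂[k]^r (Module.Dual k V)) ⊗[k] (⨂[k]^s (Module.Dual k V))} :
    t ∈ Submodule.map₂ (TensorProduct.mk k _ _) ⊤ (perp U) ↔
      ∀ z ∈ Submodule.map₂ (TensorProduct.mk k _ _) ⊤ U, dualPow₂ k V r s t z = 0 := by
  rw [forall_mem_map₂_mk]
  refine (mem_map₂_top_annihilator (dualPow k V s) (dualPow k V r) U t).trans ?_
  exact ⟨fun h y _ x hx => h x hx y, fun h x hx y => h y trivial x hx⟩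

theorem map_eq_of_mem_iff {M : Type*} [AddCommGroup M] [Module k M] (e : M ≃ₗ[k] M)
    (P : Submodule k M) (h : ∀ x, e x ∈ P ↔ x ∈ P) : P.map e.toLinearMap = P := by
  ext x
  obtain ⟨x, rfl⟩ := e.surjective x
  rw [h, Submodule.mem_map_equiv, LinearEquiv.symm_apply_apply]

theorem mem_iff_of_map_eq {M : Type*} [AddCommGroup M] [Module k M] {e : M ≃ₗ[k] M}
    {P : Submodule k M} (h : P.map e.toLinearMap = P) (x : M) : e.symm x ∈ P ↔ x ∈ P := by
  conv_rhs => rw [← h, Submodule.mem_map_equiv]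

/-- The contragredient composes a form with the inverse cochain, so it preserves the annihilator of
every preserved subspace; the annihilators of `U ⊗ V^{⊗s}` and `V^{⊗s} ⊗ U` have `perp U` in the
corresponding place. -/
theorem Stable.perp {D : TwoCochain k V} {n : ℕ} {U : Submodule k (⨂[k]^n V)} (h : Stable D U) :
    Stable (contragredient D) (perp U) := by
  have key : ∀ {r s : ℕ} {W : Submodule k ((⨂[k]^r V) ⊗[k] (⨂[k]^s V))},
      W.map (D r s).toLinearMap = W → ∀ t, (∀ z ∈ W, dualPow₂ k V r s (contragredient D r s t) z = 0) ↔
        ∀ z ∈ W, dualPow₂ k V r s t z = 0 := by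
    intro r s W hW t
    simp only [dualPow₂_contragredient]
    refine ⟨fun H z hz => ?_, fun H z hz => H _ ((mem_iff_of_map_eq hW z).2 hz)⟩
    have := H (D r s z) ((mem_iff_of_map_eq hW _).1 (by simpa using hz))
    simpa using this
  intro s
  refine ⟨map_eq_of_mem_iff _ _ fun t => ?_, map_eq_of_mem_iff _ _ fun t => ?_⟩
  · rw [mem_map₂_perp_top, mem_map₂_perp_top, key (h s).1]
  · rw [mem_map₂_top_perp, mem_map₂_top_perp, key (h s).2]

theorem perp_concSub_top {r s : ℕ} (U : Submodule k (⨂[k]^r V)) :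
    perp (concSub U (⊤ : Submodule k (⨂[k]^s V))) = concSub (perp U) ⊤ := by
  ext f
  obtain ⟨t, rfl⟩ := (conc r s).surjective f
  rw [mem_perp, concSub_eq_map, concSub_eq_map, Submodule.mem_map_equiv,
    LinearEquiv.symm_apply_apply, mem_map₂_perp_top]
  simp only [Submodule.mem_map, forall_exists_index, and_imp, forall_apply_eq_imp_iff₂,
    LinearEquiv.coe_coe, dualPow_conc]

theorem perp_top_concSub {r s : ℕ} (U : Submodule k (⨂[k]^s V)) :
    perp (concSub (⊤ : Submodule k (⨂[k]^r V)) U) = concSub ⊤ (perp U) := by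
  ext f
  obtain ⟨t, rfl⟩ := (conc r s).surjective f
  rw [mem_perp, concSub_eq_map, concSub_eq_map, Submodule.mem_map_equiv,
    LinearEquiv.symm_apply_apply, mem_map₂_top_perp]
  simp only [Submodule.mem_map, forall_exists_index, and_imp, forall_apply_eq_imp_iff₂,
    LinearEquiv.coe_coe, dualPow_conc]

/-- Transfers second admissibility of the cochain of `B` to the dual relations, placed at the same
positions. -/
theorem perp_placed (R : ∀ n, Submodule k (⨂[k]^n V)) (i j l : ℕ) :
    perp (placed R i j l) = placed (fun n => perp (R n)) i j l := by
  rw [placed, perp_concSub_top, perp_top_concSub]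
  rfl

end Duality

/-! ### Subspaces of `(X ⊗ Y)^{⊗n}` coming from the two kinds of letters. -/

section Shuffled

variable {k : Type u} [Field k] {X Y : Type u} [AddCommGroup X] [Module k X] [AddCommGroup Y]
  [Module k Y]

/-- The image of `P ⊗ Q` in `(X ⊗ Y)^{⊗n}`. -/
def shuffleSub {n : ℕ} (P : Submodule k (⨂[k]^n X)) (Q : Submodule k (⨂[k]^n Y)) :
    Submodule k (⨂[k]^n (X ⊗[k] Y)) :=
  Submodule.map₂ (TensorProduct.curry (shuffleEquiv k X Y n).toLinearMap) P Q

theorem shuffleSub_eq_map {n : ℕ} (P : Submodule k (⨂[k]^n X)) (Q : Submodule k (⨂[k]^n Y)) :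
    shuffleSub P Q =
      (Submodule.map₂ (TensorProduct.mk k _ _) P Q).map (shuffleEquiv k X Y n).toLinearMap := by
  rw [Submodule.map_map₂]
  rfl

theorem shuffle_mem_shuffleSub {n : ℕ} {P : Submodule k (⨂[k]^n X)} {Q : Submodule k (⨂[k]^n Y)}
    {x : ⨂[k]^n X} {y : ⨂[k]^n Y} (hx : x ∈ P) (hy : y ∈ Q) :
    shuffleEquiv k X Y n (x ⊗ₜ y) ∈ shuffleSub P Q :=
  Submodule.apply_mem_map₂ _ hx hy

theorem shuffleSub_top_top (n : ℕ) :
    shuffleSub (⊤ : Submodule k (⨂[k]^n X)) (⊤ : Submodule k (⨂[k]^n Y)) = ⊤ := by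
  rw [shuffleSub_eq_map, map₂_mk_top_top, map_equiv_top]

theorem map₂_mk_shuffleSub {r s : ℕ} (P : Submodule k (⨂[k]^r X)) (Q : Submodule k (⨂[k]^r Y))
    (P' : Submodule k (⨂[k]^s X)) (Q' : Submodule k (⨂[k]^s Y)) :
    Submodule.map₂ (TensorProduct.mk k _ _) (shuffleSub P Q) (shuffleSub P' Q') =
      (Submodule.map₂ (TensorProduct.mk k _ _) (Submodule.map₂ (TensorProduct.mk k _ _) P P')
        (Submodule.map₂ (TensorProduct.mk k _ _) Q Q')).map (jointEquiv k X Y r s).toLinearMap := by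
  refine le_antisymm ?_ ?_
  · refine map₂_map₂_le _ _ _ _ _ _ _ _ fun p hp q hq p' hp' q' hq' => ?_
    exact ⟨(p ⊗ₜ p') ⊗ₜ (q ⊗ₜ q'), Submodule.apply_mem_map₂ _ (Submodule.apply_mem_map₂ _ hp hp')
      (Submodule.apply_mem_map₂ _ hq hq'), jointEquiv_tmul r s p p' q q'⟩
  · rw [Submodule.map_le_iff_le_comap]
    refine map₂_map₂_le _ _ _ _ _ _ _ _ fun p hp p' hp' q hq q' hq' => ?_
    change jointEquiv k X Y r s ((p ⊗ₜ p') ⊗ₜ (q ⊗ₜ q')) ∈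
      Submodule.map₂ (TensorProduct.mk k _ _) (shuffleSub P Q) (shuffleSub P' Q')
    rw [jointEquiv_tmul]
    exact Submodule.apply_mem_map₂ _ (shuffle_mem_shuffleSub hp hq) (shuffle_mem_shuffleSub hp' hq')

theorem concSub_shuffleSub {r s : ℕ} (P : Submodule k (⨂[k]^r X)) (Q : Submodule k (⨂[k]^r Y))
    (P' : Submodule k (⨂[k]^s X)) (Q' : Submodule k (⨂[k]^s Y)) :
    concSub (shuffleSub P Q) (shuffleSub P' Q') = shuffleSub (concSub P P') (concSub Q Q') := by
  rw [concSub_eq_map, map₂_mk_shuffleSub, shuffleSub_eq_map, concSub_eq_map P, concSub_eq_map Q,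
    ← map_congr_map₂_mk, ← Submodule.map_comp, ← Submodule.map_comp]
  congr 1
  exact LinearMap.ext (conc_jointEquiv r s)

/-- The full tensor power of `X ⊗ Y` is itself the shuffle of two full tensor powers, so surrounding
a relation by letters takes place on both kinds simultaneously. -/
theorem placed_shuffleSub (P : ∀ n, Submodule k (⨂[k]^n X)) (Q : ∀ n, Submodule k (⨂[k]^n Y))
    (i j l : ℕ) : placed (fun n => shuffleSub (P n) (Q n)) i j l =
      shuffleSub (placed P i j l) (placed Q i j l) := by
  rw [placed, ← shuffleSub_top_top i, ← shuffleSub_top_top l, concSub_shuffleSub,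
    concSub_shuffleSub]
  rfl

theorem map_joint_map {D : TwoCochain k X} {E : TwoCochain k Y} {r s : ℕ}
    {P : Submodule k ((⨂[k]^r X) ⊗[k] (⨂[k]^s X))} {Q : Submodule k ((⨂[k]^r Y) ⊗[k] (⨂[k]^s Y))}
    (hP : P.map (D r s).toLinearMap = P) (hQ : Q.map (E r s).toLinearMap = Q) :
    ((Submodule.map₂ (TensorProduct.mk k _ _) P Q).map (jointEquiv k X Y r s).toLinearMap).map
      (joint D E r s).toLinearMap =
    (Submodule.map₂ (TensorProduct.mk k _ _) P Q).map (jointEquiv k X Y r s).toLinearMap := by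
  conv_rhs => rw [← hP, ← hQ, ← map_congr_map₂_mk]
  rw [← Submodule.map_comp, ← Submodule.map_comp]
  congr 1
  exact LinearMap.ext (joint_jointEquiv D E r s)

theorem Stable.joint {D : TwoCochain k X} {E : TwoCochain k Y} {n : ℕ}
    {P : Submodule k (⨂[k]^n X)} {Q : Submodule k (⨂[k]^n Y)} (hP : Stable D P)
    (hQ : Stable E Q) : Stable (joint D E) (shuffleSub P Q) := by
  intro s
  rw [← shuffleSub_top_top s, map₂_mk_shuffleSub, map₂_mk_shuffleSub]
  exact ⟨map_joint_map (hP s).1 (hQ s).1, map_joint_map (hP s).2 (hQ s).2⟩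

end Shuffled

/-! ### Coefficients of linear maps into `G ⊗ X`, in all degrees. -/

section Coevaluation

variable (k X Y : Type u) [Field k] [AddCommGroup X] [Module k X] [Module.Finite k X]
  [AddCommGroup Y] [Module k Y]

/-- The coevaluation `Y → (X^* ⊗ Y) ⊗ X`. -/
def coev : Y →ₗ[k] (Module.Dual k X ⊗[k] Y) ⊗[k] X :=
  ∑ i, (TensorProduct.mk k _ X).flip (Module.Free.chooseBasis k X i) ∘ₗ
    TensorProduct.mk k _ Y ((Module.Free.chooseBasis k X).coord i)

variable {k X Y}

theorem coev_apply (y : Y) : coev k X Y y = ∑ i, ((Module.Free.chooseBasis k X).coord i ⊗ₜ[k] y) ⊗ₜ[k]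
    (Module.Free.chooseBasis k X i) := by
  simp [coev]

theorem contract_coev (f : Module.Dual k X) (y : Y) :
    contract _ f (coev k X Y y) = f ⊗ₜ[k] y := by
  rw [coev_apply, map_sum]
  simp only [contract_tmul, TensorProduct.smul_tmul']
  rw [← TensorProduct.sum_tmul]
  congr 1
  conv_rhs => rw [← (Module.Free.chooseBasis k X).sum_dual_apply_smul_coord f]

/-- With `apply_eq_contract_map_coev` it gives the correspondence between maps `Y → G ⊗ X` and their
coefficient maps `X^* ⊗ Y → G`. -/
theorem map_coev {G : Type u} [AddCommGroup G] [Module k G]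
    (q : Module.Dual k X ⊗[k] Y →ₗ[k] G) (c : Y →ₗ[k] G ⊗[k] X)
    (h : ∀ f y, q (f ⊗ₜ y) = contract G f (c y)) (y : Y) :
    TensorProduct.map q LinearMap.id (coev k X Y y) = c y := by
  classical
  rw [coev_apply, map_sum]
  conv_rhs => rw [← sum_contract_tmul (Module.Free.chooseBasis k X) (c y)]
  simp [h]

theorem apply_eq_contract_map_coev {G : Type u} [AddCommGroup G] [Module k G]
    (q : Module.Dual k X ⊗[k] Y →ₗ[k] G) (f : Module.Dual k X) (y : Y) :
    q (f ⊗ₜ y) = contract G f (TensorProduct.map q LinearMap.id (coev k X Y y)) := by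
  rw [contract_map, LinearMap.comp_id, contract_coev]

/-- The map `Y^{⊗n} → (X^* ⊗ Y)^{⊗n} ⊗ X^{⊗n}` induced by the coevaluation. -/
def coevPow (k X Y : Type u) [Field k] [AddCommGroup X] [Module k X] [Module.Finite k X]
    [AddCommGroup Y] [Module k Y] (n : ℕ) :
    (⨂[k]^n Y) →ₗ[k] (⨂[k]^n (Module.Dual k X ⊗[k] Y)) ⊗[k] (⨂[k]^n X) :=
  (shuffleEquiv k _ X n).symm.toLinearMap ∘ₗ PiTensorProduct.map fun _ => coev k X Y

theorem shuffle_coevPow (n : ℕ) (y : ⨂[k]^n Y) : shuffleEquiv k _ X n (coevPow k X Y n y) =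
    PiTensorProduct.map (fun _ => coev k X Y) y := by
  simp [coevPow]

theorem contract_dualPow_tprod {V : Type u} [AddCommGroup V] [Module k V] (n : ℕ)
    (f : Fin n → Module.Dual k X) (z : (⨂[k]^n V) ⊗[k] (⨂[k]^n X)) :
    contract _ (dualPow k X n (PiTensorProduct.tprod k f)) z =
      PiTensorProduct.map (fun i => contract V (f i)) (shuffleEquiv k V X n z) := by
  suffices h : contract _ (dualPow k X n (PiTensorProduct.tprod k f)) =
      PiTensorProduct.map (fun i => contract V (f i)) ∘ₗ (shuffleEquiv k V X n).toLinearMap from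
    LinearMap.congr_fun h z
  refine TensorProduct.ext ?_
  ext v x
  change contract _ (dualPow k X n (PiTensorProduct.tprod k f))
    (PiTensorProduct.tprod k v ⊗ₜ PiTensorProduct.tprod k x) =
    PiTensorProduct.map (fun i => contract V (f i))
      (shuffleEquiv k V X n (PiTensorProduct.tprod k v ⊗ₜ PiTensorProduct.tprod k x))
  rw [contract_tmul, dualPow_tprod, shuffleEquiv_tprod, PiTensorProduct.map_tprod]
  simp only [contract_tmul]
  exact ((PiTensorProduct.tprod k).map_smul_univ _ _).symm

/-- Pure products of forms contract a shuffled word letter by letter, which reduces the claim to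
`contract_coev`; the rest is linearity in `f`. -/
theorem contract_coevPow (n : ℕ) (f : ⨂[k]^n (Module.Dual k X)) (y : ⨂[k]^n Y) :
    contract _ (dualPow k X n f) (coevPow k X Y n y) =
      shuffleEquiv k (Module.Dual k X) Y n (f ⊗ₜ y) := by
  induction f using PiTensorProduct.induction_on with
  | add f g hf hg =>
    rw [TensorProduct.add_tmul, map_add, map_add, ← hf, ← hg]
    simp [contract, LinearMap.lTensor_add]
  | smul_tprod c f =>
    rw [← TensorProduct.smul_tmul', map_smul, map_smul]
    have h1 : contract _ (dualPow k X n (PiTensorProduct.tprod k f)) (coevPow k X Y n y) =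
        shuffleEquiv k (Module.Dual k X) Y n (PiTensorProduct.tprod k f ⊗ₜ y) := by
      rw [contract_dualPow_tprod, shuffle_coevPow]
      suffices h : PiTensorProduct.map (fun i => contract (Module.Dual k X ⊗[k] Y) (f i)) ∘ₗ
          PiTensorProduct.map (fun _ => coev k X Y) =
          (shuffleEquiv k (Module.Dual k X) Y n).toLinearMap ∘ₗ
            TensorProduct.mk k _ _ (PiTensorProduct.tprod k f) from LinearMap.congr_fun h y
      ext y
      simp [contract_coev, shuffleEquiv_tprod]
    rw [← h1]
    simp [contract, LinearMap.lTensor_smul]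

/-- A tensor in `M ⊗ N` is zero iff all its contractions with forms on `N` are. Pulled back along
`g`, these forms are exactly the forms on `X^{⊗n}` that annihilate `ker g`, and contraction of the
coevaluation returns `β ⊗ y`. -/
theorem map_coevPow_eq_zero_iff {M N : Type u} [AddCommGroup M] [Module k M] [AddCommGroup N]
    [Module k N] (n : ℕ) (f : (⨂[k]^n (Module.Dual k X ⊗[k] Y)) →ₗ[k] M)
    (g : (⨂[k]^n X) →ₗ[k] N) (y : ⨂[k]^n Y) :
    TensorProduct.map f g (coevPow k X Y n y) = 0 ↔
      ∀ β ∈ perp (LinearMap.ker g), f (shuffleEquiv k (Module.Dual k X) Y n (β ⊗ₜ y)) = 0 := by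
  constructor
  · intro h β hβ
    rw [mem_perp] at hβ
    -- A form killing `ker g` factors through `g`, so the vanishing tensor can be contracted with
    -- it.
    obtain ⟨l, hl⟩ := exists_factor g (dualPow k X n β) hβ
    have hl' : l ∘ₗ g = dualPow k X n β := LinearMap.ext hl
    rw [← contract_coevPow, ← hl', ← contract_map, h, map_zero]
  · intro h
    refine eq_zero_of_contract _ fun l => ?_
    rw [contract_map]
    have := h ((dualPow k X n).symm (l ∘ₗ g)) (mem_perp.2 fun x hx => by
      rw [LinearEquiv.apply_symm_apply, LinearMap.comp_apply, LinearMap.mem_ker.1 hx, map_zero])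
    rwa [← contract_coevPow, LinearEquiv.apply_symm_apply] at this

theorem shuffleSub_perp_le_ker_iff {M N : Type u} [AddCommGroup M] [Module k M] [AddCommGroup N]
    [Module k N] (n : ℕ) (f : (⨂[k]^n (Module.Dual k X ⊗[k] Y)) →ₗ[k] M)
    (g : (⨂[k]^n X) →ₗ[k] N) (Q : Submodule k (⨂[k]^n Y)) :
    shuffleSub (perp (LinearMap.ker g)) Q ≤ LinearMap.ker f ↔
      ∀ y ∈ Q, TensorProduct.map f g (coevPow k X Y n y) = 0 := by
  simp only [map_coevPow_eq_zero_iff]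
  exact Submodule.map₂_le.trans ⟨fun h y hy β hβ => h β hβ y hy, fun h β hβ y hy => h y hy β hβ⟩

end Coevaluation
end
end QuantumSpace

namespace QuantumSpace

noncomputable section

/-! ### Kernels of tensor products of maps, descent of cochains, and recognition of twists. -/

section Kernels

variable {k : Type u} [Field k]

/-- Right exactness computes the kernel for surjections. Corestricting to the ranges gives
surjections, and over a field the tensor product of the inclusions of the ranges stays injective. -/
theorem ker_tensorMap {M N P Q : Type u} [AddCommGroup M] [Module k M] [AddCommGroup N]
    [Module k N] [AddCommGroup P] [Module k P] [AddCommGroup Q] [Module k Q] (f : M →ₗ[k] P)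
    (g : N →ₗ[k] Q) : LinearMap.ker (TensorProduct.map f g) =
      Submodule.map₂ (TensorProduct.mk k M N) ⊤ (LinearMap.ker g) ⊔
        Submodule.map₂ (TensorProduct.mk k M N) (LinearMap.ker f) ⊤ := by
  have h1 : TensorProduct.map f g =
      TensorProduct.map (LinearMap.range f).subtype (LinearMap.range g).subtype ∘ₗ
        TensorProduct.map f.rangeRestrict g.rangeRestrict := by
    rw [← TensorProduct.map_comp]
    rfl
  have h2 : Function.Injective
      (TensorProduct.map (LinearMap.range f).subtype (LinearMap.range g).subtype) :=
    TensorProduct.map_injective_of_flat_flat _ _ Subtype.val_injective Subtype.val_injective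
  rw [h1, LinearMap.ker_comp_of_ker_eq_bot _ (LinearMap.ker_eq_bot.2 h2),
    TensorProduct.map_ker (f := (LinearMap.ker f).subtype) (f' := (LinearMap.ker g).subtype)]
  · congr 1
    · rw [LinearMap.lTensor, TensorProduct.range_map, LinearMap.range_id, Submodule.range_subtype]
    · rw [LinearMap.rTensor, TensorProduct.range_map, LinearMap.range_id, Submodule.range_subtype]
  · rw [LinearMap.exact_iff, LinearMap.ker_rangeRestrict, Submodule.range_subtype]
  · exact f.surjective_rangeRestrict
  · rw [LinearMap.exact_iff, LinearMap.ker_rangeRestrict, Submodule.range_subtype]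
  · exact g.surjective_rangeRestrict

theorem map_ker_tensorMap_congr_refl {M N P Q : Type u} [AddCommGroup M] [Module k M]
    [AddCommGroup N] [Module k N] [AddCommGroup P] [Module k P] [AddCommGroup Q] [Module k Q]
    (f : M →ₗ[k] P) (g : N →ₗ[k] Q) (e : M ≃ₗ[k] M)
    (he : (LinearMap.ker f).map e.toLinearMap = LinearMap.ker f) :
    (LinearMap.ker (TensorProduct.map f g)).map
      (TensorProduct.congr e (LinearEquiv.refl k N)).toLinearMap =
        LinearMap.ker (TensorProduct.map f g) := by
  rw [ker_tensorMap, Submodule.map_sup, map_congr_map₂_mk, map_congr_map₂_mk, map_equiv_top, he,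
    LinearEquiv.refl_toLinearMap, Submodule.map_id, Submodule.map_id]

variable {V : Type u} [AddCommGroup V] [Module k V] {W : Type u} [AddCommGroup W] [Module k W]

theorem map_ker_tensorMap_of_stable {P : Type u} [AddCommGroup P] [Module k P] {r s : ℕ}
    (D : TwoCochain k V) (f : (⨂[k]^r V) →ₗ[k] P) (g : (⨂[k]^s V) →ₗ[k] P)
    (hf : Stable D (LinearMap.ker f)) (hg : Stable D (LinearMap.ker g)) :
    (LinearMap.ker (TensorProduct.map f g)).map (D r s).toLinearMap =
      LinearMap.ker (TensorProduct.map f g) := by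
  rw [ker_tensorMap, Submodule.map_sup, (hf s).1, (hg r).2]

/-- Transport of a `1`-cochain along an isomorphism. -/
def conjOne (e : V ≃ₗ[k] W) (θ : OneCochain k V) : OneCochain k W := fun n =>
  (PiTensorProduct.congr fun _ => e).symm ≪≫ₗ θ n ≪≫ₗ PiTensorProduct.congr fun _ => e

theorem conjOne_map (e : V ≃ₗ[k] W) (θ : OneCochain k V) (n : ℕ) (x : ⨂[k]^n V) :
    conjOne e θ n (PiTensorProduct.map (fun _ => e.toLinearMap) x) =
      PiTensorProduct.map (fun _ => e.toLinearMap) (θ n x) := by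
  change PiTensorProduct.congr (fun _ => e) (θ n ((PiTensorProduct.congr fun _ => e).symm
    (PiTensorProduct.congr (fun _ => e) x))) = _
  rw [LinearEquiv.symm_apply_apply]
  rfl

theorem conjOne_eq_refl (e : V ≃ₗ[k] W) (θ : OneCochain k V) (n : ℕ)
    (h : θ n = LinearEquiv.refl k _) : conjOne e θ n = LinearEquiv.refl k _ := by
  refine LinearEquiv.ext fun x => ?_
  simp [conjOne, h]

theorem conc_map (f : V →ₗ[k] W) (r s : ℕ) (z : (⨂[k]^r V) ⊗[k] (⨂[k]^s V)) :
    conc r s (TensorProduct.map (PiTensorProduct.map fun _ => f) (PiTensorProduct.map fun _ => f) z) =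
      PiTensorProduct.map (fun _ => f) (conc r s z) := by
  suffices h : (conc r s).toLinearMap ∘ₗ
      TensorProduct.map (PiTensorProduct.map fun _ => f) (PiTensorProduct.map fun _ => f) =
      PiTensorProduct.map (fun _ => f) ∘ₗ (conc r s).toLinearMap from LinearMap.congr_fun h z
  refine TensorProduct.ext ?_
  ext a b
  change conc r s (PiTensorProduct.map (fun _ => f) (PiTensorProduct.tprod k a) ⊗ₜ
    PiTensorProduct.map (fun _ => f) (PiTensorProduct.tprod k b)) =
    PiTensorProduct.map (fun _ => f) (conc r s (PiTensorProduct.tprod k a ⊗ₜ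
      PiTensorProduct.tprod k b))
  rw [conc_tprod, PiTensorProduct.map_tprod, PiTensorProduct.map_tprod, conc_tprod,
    PiTensorProduct.map_tprod, comp_append]

theorem isTranslation_conjOne (e : V ≃ₗ[k] W) (θ : OneCochain k V) :
    IsTranslation e.toLinearMap (coboundary θ) (coboundary (conjOne e θ)) := by
  intro r s
  refine TensorProduct.ext' fun x y => ?_
  obtain ⟨x, rfl⟩ := (θ r).surjective x
  obtain ⟨y, rfl⟩ := (θ s).surjective y
  apply (conc r s).injective
  simp only [LinearMap.comp_apply, LinearEquiv.coe_coe, TensorProduct.map_tmul, conc_map,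
    conc_coboundary, ← conjOne_map]
  rw [← conc_map, TensorProduct.map_tmul]

/-- Admissibility can be tested upstairs: `ρ` induces surjections of tensor powers, and the kernel
for `A` is the image of the kernel of the composite evaluations. -/
theorem admissible_of_isTranslation (A : ConicSpace k) (ρ : V →ₗ[k] A.gen)
    (hρ : Function.Surjective ρ) (D : TwoCochain k V) (χ : TwoCochain k A.gen)
    (h : IsTranslation ρ D χ)
    (hD : ∀ r s, (LinearMap.ker (TensorProduct.map (evMap (A.gen.subtype ∘ₗ ρ) r)
      (evMap (A.gen.subtype ∘ₗ ρ) s))).map (D r s).toLinearMap =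
      LinearMap.ker (TensorProduct.map (evMap (A.gen.subtype ∘ₗ ρ) r)
        (evMap (A.gen.subtype ∘ₗ ρ) s))) : Admissible A χ := by
  intro r s
  let P : ∀ n : ℕ, (⨂[k]^n V) →ₗ[k] (⨂[k]^n A.gen) := fun n => PiTensorProduct.map fun _ => ρ
  have hP : Function.Surjective (TensorProduct.map (P r) (P s)) := by
    have : ∀ n, Function.Surjective (P n) := fun n => by
      obtain ⟨g, hg⟩ := ρ.exists_rightInverse_of_surjective (LinearMap.range_eq_top.2 hρ)
      refine fun x => ⟨PiTensorProduct.map (fun _ => g) x, ?_⟩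
      have h1 : P n ∘ₗ PiTensorProduct.map (fun _ => g) = LinearMap.id := by
        rw [← PiTensorProduct.map_comp, hg, PiTensorProduct.map_id]
      exact LinearMap.congr_fun h1 x
    exact TensorProduct.map_surjective (this r) (this s)
  have hev : ∀ n, ev A n ∘ₗ P n = evMap (A.gen.subtype ∘ₗ ρ) n := fun n =>
    LinearMap.ext fun x => evMap_map _ _ _ _
  have hK : LinearMap.ker (TensorProduct.map (ev A r) (ev A s)) =
      (LinearMap.ker (TensorProduct.map (evMap (A.gen.subtype ∘ₗ ρ) r)
        (evMap (A.gen.subtype ∘ₗ ρ) s))).map (TensorProduct.map (P r) (P s)) := by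
    rw [← hev, ← hev, TensorProduct.map_comp, LinearMap.ker_comp,
      Submodule.map_comap_eq_of_surjective hP]
  rw [hK, ← Submodule.map_comp, ← h r s, Submodule.map_comp, hD]

theorem exists_iso_of_evMap {H G : ConicSpace k} (q : V →ₗ[k] H.carrier)
    (hq : LinearMap.range q = H.gen) (q' : V →ₗ[k] G.carrier) (hq' : LinearMap.range q' = G.gen)
    (h : ∀ n x, evMap q n x = 0 ↔ evMap q' n x = 0) : Nonempty (H ≅ G) := by
  obtain ⟨F, hF⟩ := H.exists_algHom q hq q' fun n x => (h n x).1
  obtain ⟨F', hF'⟩ := G.exists_algHom q' hq' q fun n x => (h n x).2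
  refine ⟨⟨⟨F, fun x hx => ?_⟩, ⟨F', fun x hx => ?_⟩, ?_, ?_⟩⟩
  · rw [← hq] at hx
    obtain ⟨v, rfl⟩ := hx
    rw [hF, ← hq']
    exact ⟨v, rfl⟩
  · rw [← hq'] at hx
    obtain ⟨v, rfl⟩ := hx
    rw [hF', ← hq]
    exact ⟨v, rfl⟩
  · refine ConicSpace.hom_ext (H.algHom_ext fun x hx => ?_)
    rw [← hq] at hx
    obtain ⟨v, rfl⟩ := hx
    change F' (F (q v)) = q v
    rw [hF, hF']
  · refine ConicSpace.hom_ext (G.algHom_ext fun x hx => ?_)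
    rw [← hq'] at hx
    obtain ⟨v, rfl⟩ := hx
    change F (F' (q' v)) = q' v
    rw [hF', hF]

/-- `toTwist` as a map into the carrier of the conic quantum space `A_ψ`. -/
def twistEquiv (A : ConicSpace k) (ψ : CounitalCocycle k A.gen) (h : Admissible A ψ.toFun) :
    A.carrier ≃ₗ[k] (twist A ψ h).carrier :=
  toTwist A ψ h

theorem evMap_twistEquiv (A : ConicSpace k) (ψ : CounitalCocycle k A.gen)
    (h : Admissible A ψ.toFun) (ρ : V →ₗ[k] A.gen) (θ : OneCochain k V)
    (h0 : θ 0 = LinearEquiv.refl k _) (h1 : θ 1 = LinearEquiv.refl k _)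
    (hρ : IsTranslation ρ (coboundary θ) ψ.toFun) (n : ℕ) (x : ⨂[k]^n V) :
    evMap ((twistEquiv A ψ h).toLinearMap ∘ₗ A.gen.subtype ∘ₗ ρ) n x =
      twistEquiv A ψ h (evMap (A.gen.subtype ∘ₗ ρ) n (θ n x)) :=
  evMap_toTwist A ψ h ρ θ h0 h1 hρ n x

theorem twistEquiv_mem_gen (A : ConicSpace k) (ψ : CounitalCocycle k A.gen)
    (h : Admissible A ψ.toFun) {a : A.carrier} (ha : a ∈ A.gen) :
    twistEquiv A ψ h a ∈ (twist A ψ h).gen := ⟨a, ha, rfl⟩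

theorem map_twistEquiv_gen (A : ConicSpace k) (ψ : CounitalCocycle k A.gen)
    (h : Admissible A ψ.toFun) :
    A.gen.map (twistEquiv A ψ h).toLinearMap = (twist A ψ h).gen := rfl

/-- A conic quantum space with relations `θ J` is gauge equivalent to one with relations `J`. -/
theorem gaugeEquivalent_of_evMap {θ : OneCochain k V} (h0 : θ 0 = LinearEquiv.refl k _)
    (h1 : θ 1 = LinearEquiv.refl k _) {J : ∀ n, Submodule k (⨂[k]^n V)}
    (hJ : ∀ n, Stable (coboundary fun n => (θ n).symm) (J n)) {G G' : ConicSpace k}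
    (p : V ≃ₗ[k] G.gen) (hp : ∀ n, LinearMap.ker (evMap (G.gen.subtype ∘ₗ p.toLinearMap) n) =
      (J n).map (θ n).toLinearMap)
    (q : V →ₗ[k] G'.carrier) (hq : LinearMap.range q = G'.gen)
    (hqJ : ∀ n, LinearMap.ker (evMap q n) = J n) : GaugeEquivalent G G' := by
  have htr := isTranslation_conjOne p θ
  have hs : ∀ n, Stable (coboundary θ)
      (LinearMap.ker (evMap (G.gen.subtype ∘ₗ p.toLinearMap) n)) := fun n => by
    rw [hp]
    exact (hJ n).map_primitive
  let χ := coboundaryCocycle (conjOne p θ) (conjOne_eq_refl p θ 0 h0)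
  have hadm : Admissible G χ.toFun := admissible_of_isTranslation G p.toLinearMap p.surjective
    (coboundary θ) _ htr fun r s => map_ker_tensorMap_of_stable _ _ _ (hs r) (hs s)
  refine ⟨χ, hadm, exists_iso_of_evMap ((twistEquiv G χ hadm).toLinearMap ∘ₗ G.gen.subtype ∘ₗ
    p.toLinearMap) ?_ q hq fun n x => ?_⟩
  · rw [LinearMap.range_comp, LinearMap.range_comp, LinearEquiv.range, Submodule.map_subtype_top,
      map_twistEquiv_gen]
  -- A word `x` evaluates in the twist to the evaluation of `θ x` in `G`, so its relations are
  -- `θ⁻¹(θ J) = J`.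
  · rw [evMap_twistEquiv G χ hadm p.toLinearMap θ h0 h1 htr, LinearEquiv.map_eq_zero_iff,
      ← LinearMap.mem_ker, hp, ← LinearMap.mem_ker, hqJ, Submodule.mem_map_equiv,
      LinearEquiv.symm_apply_apply]

end Kernels
end
end QuantumSpace

namespace QuantumSpace

noncomputable section

/-! ### Relations and presentations of coHom objects. -/

section CoHom

variable {k : Type u} [Field k]

theorem segreVal_injective (H B : ConicSpace k) : Function.Injective (segreVal H B) :=
  Subtype.val_injective

theorem segreVal_segreGen (H B : ConicSpace k) (t : H.gen ⊗[k] B.gen) :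
    segreVal H B (segreGen H B t : (segre H B).carrier) =
      TensorProduct.map H.gen.subtype B.gen.subtype t := rfl

theorem segreVal_segreMap {H G : ConicSpace k} (α : H ⟶ G) (B : ConicSpace k)
    (z : (segre H B).carrier) : segreVal G B ((segreMap α B).toAlgHom z) =
      Algebra.TensorProduct.map α.toAlgHom (AlgHom.id k B.carrier) (segreVal H B z) := rfl

/-- The coefficients `X^* ⊗ Y → G` of a linear map `Y → G ⊗ X`. -/
def coeffMap {X Y G : Type u} [AddCommGroup X] [Module k X] [AddCommGroup Y] [Module k Y]
    [AddCommGroup G] [Module k G] (c : Y →ₗ[k] G ⊗[k] X) : Module.Dual k X ⊗[k] Y →ₗ[k] G :=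
  TensorProduct.lift (LinearMap.mk₂ k (fun f y => contract G f (c y))
    (fun f f' y => by simp [contract, LinearMap.lTensor_add])
    (fun a f y => by simp [contract, LinearMap.lTensor_smul])
    (fun f y y' => by simp) (fun a f y => by simp))

theorem coeffMap_tmul {X Y G : Type u} [AddCommGroup X] [Module k X] [AddCommGroup Y] [Module k Y]
    [AddCommGroup G] [Module k G] (c : Y →ₗ[k] G ⊗[k] X) (f : Module.Dual k X) (y : Y) :
    coeffMap c (f ⊗ₜ y) = contract G f (c y) := rfl

variable {A B : ConicSpace k}

theorem map_map_id {M N P Q L : Type u} [AddCommGroup M] [Module k M] [AddCommGroup N] [Module k N]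
    [AddCommGroup P] [Module k P] [AddCommGroup Q] [Module k Q] [AddCommGroup L] [Module k L]
    (f : N →ₗ[k] P) (g : L →ₗ[k] Q) (q : M →ₗ[k] N) (t : M ⊗[k] L) :
    TensorProduct.map f g (TensorProduct.map q LinearMap.id t) =
      TensorProduct.map (f ∘ₗ q) g t := by
  rw [← LinearMap.comp_apply, ← TensorProduct.map_comp, LinearMap.comp_id]

theorem map_coeffMap_coev {H : ConicSpace k} (c : A.gen →ₗ[k] H.gen ⊗[k] B.gen) (a : A.gen) :
    TensorProduct.map (H.gen.subtype ∘ₗ coeffMap c) B.gen.subtype (coev k B.gen A.gen a) =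
      TensorProduct.map H.gen.subtype B.gen.subtype (c a) := by
  rw [← map_coev (coeffMap c) c (coeffMap_tmul c) a, map_map_id]

/-- Inclusion of `B₁` in `B` stays injective after tensoring, so a coefficient map can be recovered
by contraction from the degree one part of `φ`. -/
theorem coeff_ext {S : Type u} [AddCommGroup S] [Module k S]
    {Q Q' : Module.Dual k B.gen ⊗[k] A.gen →ₗ[k] S}
    (h : ∀ a, TensorProduct.map Q B.gen.subtype (coev k B.gen A.gen a) =
      TensorProduct.map Q' B.gen.subtype (coev k B.gen A.gen a)) : Q = Q' := by
  have h1 : ∀ (Q : Module.Dual k B.gen ⊗[k] A.gen →ₗ[k] S) t,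
      TensorProduct.map Q B.gen.subtype t = TensorProduct.map LinearMap.id B.gen.subtype
        (TensorProduct.map Q LinearMap.id t) := fun Q t => by
    rw [map_map_id, LinearMap.id_comp]
  have h2 : Function.Injective (TensorProduct.map (LinearMap.id : S →ₗ[k] S) B.gen.subtype) :=
    TensorProduct.map_injective_of_flat_flat _ _ Function.injective_id Subtype.val_injective
  refine TensorProduct.ext' fun f a => ?_
  have h3 := h a
  rw [h1, h1 Q'] at h3
  rw [apply_eq_contract_map_coev, apply_eq_contract_map_coev Q', h2 h3]

/-- The gauge is the identity on the `B₁`-letters; it therefore acts only on the coefficient factor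
of the coevaluated word. -/
theorem evMap_jointOne_coev {S : Type u} [Ring S] [Algebra k S]
    (q : Module.Dual k B.gen ⊗[k] A.gen →ₗ[k] S)
    (θ : OneCochain k (Module.Dual k B.gen ⊗[k] A.gen)) (n : ℕ) (x : ⨂[k]^n A.gen) :
    evMap (TensorProduct.map q B.gen.subtype) n (jointOne θ (idOne k B.gen) n
      (PiTensorProduct.map (fun _ => coev k B.gen A.gen) x)) =
    TensorProduct.map (evMap q n ∘ₗ (θ n).toLinearMap) (ev B n) (coevPow k B.gen A.gen n x) := by
  rw [← shuffle_coevPow, jointOne_shuffle, evMap_shuffle, ev_eq_evMap]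
  generalize coevPow k B.gen A.gen n x = z
  suffices h : TensorProduct.map (evMap q n) (evMap B.gen.subtype n) ∘ₗ
      TensorProduct.map (θ n).toLinearMap LinearMap.id =
      TensorProduct.map (evMap q n ∘ₗ (θ n).toLinearMap) (evMap B.gen.subtype n) from
    LinearMap.congr_fun h z
  rw [← TensorProduct.map_comp, LinearMap.comp_id]

/-- The relations of the coHom object: the span of `β ⊗ x` with `x` a relation of `A` and `β` a form
vanishing on the relations of `B`. -/
def coHomRel (A B : ConicSpace k) (n : ℕ) :
    Submodule k (⨂[k]^n (Module.Dual k B.gen ⊗[k] A.gen)) :=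
  shuffleSub (perp (LinearMap.ker (ev B n))) (LinearMap.ker (ev A n))

/-- This explains the choice of `coHomRel`: killing its transform by `θ` is precisely the condition
that the deformed extension of a coefficient map descends from words to `A`. -/
theorem map_coHomRel_le_iff {S : Type u} [Ring S] [Algebra k S]
    (q : Module.Dual k B.gen ⊗[k] A.gen →ₗ[k] S)
    (θ : OneCochain k (Module.Dual k B.gen ⊗[k] A.gen)) (n : ℕ) :
    (coHomRel A B n).map (θ n).toLinearMap ≤ LinearMap.ker (evMap q n) ↔
      ∀ x, ev A n x = 0 → evMap (TensorProduct.map q B.gen.subtype) n (jointOne θ (idOne k B.gen) n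
        (PiTensorProduct.map (fun _ => coev k B.gen A.gen) x)) = 0 := by
  rw [Submodule.map_le_iff_le_comap, ← LinearMap.ker_comp, coHomRel, shuffleSub_perp_le_ker_iff]
  simp only [evMap_jointOne_coev, LinearMap.mem_ker]

theorem ker_ev_zero (A : ConicSpace k) : LinearMap.ker (ev A 0) = ⊥ := by
  rw [LinearMap.ker_eq_bot']
  intro x hx
  obtain ⟨c, rfl⟩ := exists_smul_tprod_zero x
  rw [map_smul, ev_zero, smul_eq_zero] at hx
  rw [hx.resolve_right one_ne_zero, zero_smul]

theorem ker_ev_one (A : ConicSpace k) : LinearMap.ker (ev A 1) = ⊥ := by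
  rw [LinearMap.ker_eq_bot']
  intro x hx
  obtain ⟨v, rfl⟩ := exists_tprod_one x
  rw [ev_eq_evMap, evMap_one] at hx
  have hv : v = 0 := Subtype.ext hx
  subst hv
  exact (PiTensorProduct.tprod k).map_coord_zero 0 rfl

/-- `A` has no relations in degrees `0` and `1`. Hence the quotient is nontrivial and has `V` itself
as its space of generators. -/
theorem genIdeal_coHomRel_eq_bot (A B : ConicSpace k) (n : ℕ) (hn : n ≤ 1) :
    genIdeal (coHomRel A B) n = ⊥ := by
  refine genIdeal_eq_bot _ n fun j hj => ?_
  have : LinearMap.ker (ev A j) = ⊥ := by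
    obtain rfl | rfl : j = 0 ∨ j = 1 := by omega
    · exact ker_ev_zero A
    · exact ker_ev_one A
  rw [coHomRel, this]
  exact Submodule.map₂_bot_right _ _

theorem le_genIdeal {V : Type u} [AddCommGroup V] [Module k V] (R : ∀ n, Submodule k (⨂[k]^n V))
    (n : ℕ) : R n ≤ genIdeal R n := by
  refine le_trans (le_of_eq ?_) (map_cast_placed_le R (show 0 + n + 0 = n by omega))
  have h : placed R 0 n 0 = (R n).map (TensorPower.cast k V (zero_add n).symm).toLinearMap := by
    rw [placed, concSub_top_zero, concSub_zero_top]
  rw [h]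
  refine Eq.trans ?_ (map_cast_map_cast (zero_add n).symm (zero_add n) (R n)).symm
  simp

/-- Stability of the relations of the coHom object under the gauge transformation `θ`. -/
abbrev StableRel (A B : ConicSpace k) (θ : OneCochain k (Module.Dual k B.gen ⊗[k] A.gen)) : Prop :=
  ∀ i j l, Stable (coboundary fun n => (θ n).symm) (placed (coHomRel A B) i j l)

/-- `p` presents `H` by the relations `θ J`, with `J` the relations of the coHom object. -/
abbrev Presents (θ : OneCochain k (Module.Dual k B.gen ⊗[k] A.gen)) (H : ConicSpace k)
    (p : (Module.Dual k B.gen ⊗[k] A.gen) ≃ₗ[k] H.gen) : Prop :=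
  ∀ n, LinearMap.ker (evMap (H.gen.subtype ∘ₗ p.toLinearMap) n) =
    (genIdeal (coHomRel A B) n).map (θ n).toLinearMap

variable {θ : OneCochain k (Module.Dual k B.gen ⊗[k] A.gen)}

theorem exists_presents (hs : StableRel A B θ) : ∃ (H : ConicSpace k)
    (p : (Module.Dual k B.gen ⊗[k] A.gen) ≃ₗ[k] H.gen), Presents θ H p := by
  have hJ := isIdealFamily_map_genIdeal hs
  have hbot : ∀ n ≤ 1, (genIdeal (coHomRel A B) n).map (θ n).toLinearMap = ⊥ := fun n hn => by
    rw [genIdeal_coHomRel_eq_bot A B n hn, Submodule.map_bot]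
  exact ⟨hJ.conic (hbot 0 zero_le_one), hJ.genEquiv (hbot 0 zero_le_one) (hbot 1 le_rfl),
    fun n => Submodule.ext fun x => hJ.evMap_genEquiv _ _ n x⟩

theorem Presents.evMap_eq_zero {H : ConicSpace k}
    {p : (Module.Dual k B.gen ⊗[k] A.gen) ≃ₗ[k] H.gen} (hp : Presents θ H p) (n : ℕ)
    (x : ⨂[k]^n A.gen) (hx : ev A n x = 0) :
    evMap (TensorProduct.map (H.gen.subtype ∘ₗ p.toLinearMap) B.gen.subtype) n
      (jointOne θ (idOne k B.gen) n (PiTensorProduct.map (fun _ => coev k B.gen A.gen) x)) = 0 := by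
  refine (map_coHomRel_le_iff _ θ n).1 ?_ x hx
  rw [hp]
  exact Submodule.map_mono (le_genIdeal _ n)

/-- The universal property of the presentation: a coefficient map with a well-defined deformed
extension kills `θ R`, hence all of `θ J` by `map_genIdeal_le`. -/
theorem Presents.exists_hom {H : ConicSpace k}
    {p : (Module.Dual k B.gen ⊗[k] A.gen) ≃ₗ[k] H.gen} (hp : Presents θ H p)
    (hs : StableRel A B θ) (G : ConicSpace k) (q : Module.Dual k B.gen ⊗[k] A.gen →ₗ[k] G.gen)
    (hq : ∀ n x, ev A n x = 0 → evMap (TensorProduct.map (G.gen.subtype ∘ₗ q) B.gen.subtype) n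
      (jointOne θ (idOne k B.gen) n (PiTensorProduct.map (fun _ => coev k B.gen A.gen) x)) = 0) :
    ∃ g : H ⟶ G, ∀ v, g.toAlgHom (p v) = q v := by
  obtain ⟨F, hF⟩ := H.exists_algHom (H.gen.subtype ∘ₗ p.toLinearMap)
    (by rw [LinearMap.range_comp, LinearEquiv.range, Submodule.map_subtype_top])
    (G.gen.subtype ∘ₗ q) fun n x hx => by
      rw [← LinearMap.mem_ker, hp] at hx
      exact map_genIdeal_le hs (isIdealFamily_ker_evMap (G.gen.subtype ∘ₗ q))
        (fun n => (map_coHomRel_le_iff _ θ n).2 (hq n)) n hx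
  refine ⟨⟨F, fun x hx => ?_⟩, hF⟩
  obtain ⟨v, hv⟩ := p.surjective ⟨x, hx⟩
  have h2 := hF v
  have h3 : (H.gen.subtype ∘ₗ p.toLinearMap) v = x := congrArg Subtype.val hv
  rw [h3] at h2
  rw [h2]
  exact (q v).2

theorem hom_ext_of_gen {V : Type u} [AddCommGroup V] [Module k V] {H G : ConicSpace k}
    (p : V ≃ₗ[k] H.gen) {g g' : H ⟶ G}
    (h : ∀ v, g.toAlgHom (p v) = g'.toAlgHom (p v)) : g = g' := by
  refine ConicSpace.hom_ext (H.algHom_ext fun x hx => ?_)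
  obtain ⟨v, hv⟩ := p.surjective ⟨x, hx⟩
  have h3 : (p v : H.carrier) = x := congrArg Subtype.val hv
  rw [← h3, h]

/-- Initial objects are unique only up to isomorphism; this carries the presentation from the
constructed object to an arbitrary initial one. -/
theorem Presents.of_iso {H G : ConicSpace k}
    {p : (Module.Dual k B.gen ⊗[k] A.gen) ≃ₗ[k] H.gen} (hp : Presents θ H p) (e : H ≅ G) :
    ∃ p' : (Module.Dual k B.gen ⊗[k] A.gen) ≃ₗ[k] G.gen, Presents θ G p' := by
  have h1 : ∀ x, e.inv.toAlgHom (e.hom.toAlgHom x) = x := fun x =>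
    congrArg (fun f : H ⟶ H => f.toAlgHom x) e.hom_inv_id
  have h2 : ∀ x, e.hom.toAlgHom (e.inv.toAlgHom x) = x := fun x =>
    congrArg (fun f : G ⟶ G => f.toAlgHom x) e.inv_hom_id
  let ε : H.gen ≃ₗ[k] G.gen := LinearEquiv.ofLinearMap
    (e.hom.toAlgHom.toLinearMap.restrict e.hom.map_gen)
    (e.inv.toAlgHom.toLinearMap.restrict e.inv.map_gen)
    (LinearMap.ext fun x => Subtype.ext (h2 x)) (LinearMap.ext fun x => Subtype.ext (h1 x))
  refine ⟨p ≪≫ₗ ε, fun n => ?_⟩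
  rw [← hp]
  ext x
  have h3 : G.gen.subtype ∘ₗ (p ≪≫ₗ ε).toLinearMap =
      e.hom.toAlgHom.toLinearMap ∘ₗ H.gen.subtype ∘ₗ p.toLinearMap := rfl
  rw [LinearMap.mem_ker, LinearMap.mem_ker, h3, ← map_evMap]
  exact ⟨fun h => by rw [← h1 (evMap _ n x), h, map_zero], fun h => by rw [h, map_zero]⟩

theorem algTensorMap_map {S T R : Type u} [Ring S] [Algebra k S] [Ring T] [Algebra k T] [Ring R]
    [Algebra k R] {V W : Type u} [AddCommGroup V] [Module k V] [AddCommGroup W] [Module k W]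
    (F : S →ₐ[k] T) (q : V →ₗ[k] S) (q' : W →ₗ[k] R) :
    (Algebra.TensorProduct.map F (AlgHom.id k R)).toLinearMap ∘ₗ TensorProduct.map q q' =
      TensorProduct.map (F.toLinearMap ∘ₗ q) q' :=
  TensorProduct.ext' fun v w => by simp

/-! ### The untwisted case: the initial object of `CoHomCat A B`. -/

section Proper

theorem exists_coeff {H : ConicSpace k} (f : A ⟶ segre H B) :
    ∃ q : Module.Dual k B.gen ⊗[k] A.gen →ₗ[k] H.gen, ∀ a : A.gen,
      segreVal H B (f.toAlgHom a) =
        TensorProduct.map (H.gen.subtype ∘ₗ q) B.gen.subtype (coev k B.gen A.gen a) := by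
  refine ⟨coeffMap ((segreGen H B).symm.toLinearMap ∘ₗ
    f.toAlgHom.toLinearMap.restrict f.map_gen), fun a => ?_⟩
  rw [map_coeffMap_coev, ← segreVal_segreGen, LinearMap.comp_apply,
    LinearEquiv.coe_coe, LinearEquiv.apply_symm_apply]
  rfl

theorem jointOne_idOne {X Y : Type u} [AddCommGroup X] [Module k X] [AddCommGroup Y] [Module k Y]
    (n : ℕ) : jointOne (idOne k X) (idOne k Y) n = LinearEquiv.refl k _ :=
  jointOne_eq_refl _ _ n rfl rfl

theorem evMap_eq_zero_of_hom {H : ConicSpace k} (f : A ⟶ segre H B)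
    {Q : Module.Dual k B.gen ⊗[k] A.gen →ₗ[k] H.carrier} (hQ : ∀ a : A.gen,
      segreVal H B (f.toAlgHom a) = TensorProduct.map Q B.gen.subtype (coev k B.gen A.gen a))
    (n : ℕ) (x : ⨂[k]^n A.gen) (hx : ev A n x = 0) :
    evMap (TensorProduct.map Q B.gen.subtype) n (jointOne (idOne k _) (idOne k B.gen) n
      (PiTensorProduct.map (fun _ => coev k B.gen A.gen) x)) = 0 := by
  rw [jointOne_idOne, LinearEquiv.refl_apply, evMap_map]
  have h : TensorProduct.map Q B.gen.subtype ∘ₗ coev k B.gen A.gen =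
      ((segreVal H B).comp f.toAlgHom).toLinearMap ∘ₗ A.gen.subtype :=
    LinearMap.ext fun a => (hQ a).symm
  rw [h, ← map_evMap, ← ev_eq_evMap, hx, map_zero]

theorem exists_hom_segre {H : ConicSpace k} (q : Module.Dual k B.gen ⊗[k] A.gen →ₗ[k] H.gen)
    (hq : ∀ n x, ev A n x = 0 → evMap (TensorProduct.map (H.gen.subtype ∘ₗ q) B.gen.subtype) n
      (jointOne (idOne k _) (idOne k B.gen) n
        (PiTensorProduct.map (fun _ => coev k B.gen A.gen) x)) = 0) :
    ∃ f : A ⟶ segre H B, ∀ a : A.gen, segreVal H B (f.toAlgHom a) =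
      TensorProduct.map (H.gen.subtype ∘ₗ q) B.gen.subtype (coev k B.gen A.gen a) := by
  let c : A.gen →ₗ[k] (segre H B).gen := (segreGen H B).toLinearMap ∘ₗ
    TensorProduct.map q LinearMap.id ∘ₗ coev k B.gen A.gen
  have hc : (segreVal H B).toLinearMap ∘ₗ (segre H B).gen.subtype ∘ₗ c =
      TensorProduct.map (H.gen.subtype ∘ₗ q) B.gen.subtype ∘ₗ coev k B.gen A.gen := by
    refine LinearMap.ext fun a => ?_
    change TensorProduct.map H.gen.subtype B.gen.subtype (TensorProduct.map q LinearMap.id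
      (coev k B.gen A.gen a)) = _
    rw [map_map_id, LinearMap.comp_apply]
  obtain ⟨F, hF⟩ := A.exists_algHom A.gen.subtype (Submodule.range_subtype _)
    ((segre H B).gen.subtype ∘ₗ c) fun n x hx => by
      apply segreVal_injective H B
      rw [map_evMap, hc, map_zero, ← evMap_map]
      have := hq n x hx
      rwa [jointOne_idOne, LinearEquiv.refl_apply] at this
  have hF' : ∀ a : A.gen, F a = c a := hF
  refine ⟨⟨F, fun x hx => ?_⟩, fun a => ?_⟩
  · rw [hF' ⟨x, hx⟩]
    exact (c _).2
  · change segreVal H B (F a) = _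
    rw [hF']
    exact LinearMap.congr_fun hc a

theorem hom_segre_ext {H : ConicSpace k} {f g : A ⟶ segre H B}
    (h : ∀ a : A.gen, segreVal H B (f.toAlgHom a) = segreVal H B (g.toAlgHom a)) : f = g :=
  ConicSpace.hom_ext (A.algHom_ext fun x hx => segreVal_injective H B (h ⟨x, hx⟩))

theorem exists_initial_coHom {H : ConicSpace k}
    {p : (Module.Dual k B.gen ⊗[k] A.gen) ≃ₗ[k] H.gen} (hp : Presents (idOne k _) H p)
    (hs : StableRel A B (idOne k _)) :
    ∃ Y : CoHomCat A B, Y.right = H ∧ Nonempty (Limits.IsInitial Y) := by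
  obtain ⟨f, hf⟩ := exists_hom_segre p.toLinearMap hp.evMap_eq_zero
  refine ⟨StructuredArrow.mk (S := A) (T := segreRight B) (Y := H) f, rfl, ?_⟩
  -- Morphisms to `Y` in the comma category become morphisms of `H` with prescribed values on
  -- generators: two maps into `Y.right ∘ B` agree iff their coefficients do.
  have key : ∀ Y : CoHomCat A B, ∃ q : Module.Dual k B.gen ⊗[k] A.gen →ₗ[k] Y.right.gen,
      (∀ n x, ev A n x = 0 → evMap (TensorProduct.map (Y.right.gen.subtype ∘ₗ q) B.gen.subtype) n
        (jointOne (idOne k _) (idOne k B.gen) n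
          (PiTensorProduct.map (fun _ => coev k B.gen A.gen) x)) = 0) ∧
      ∀ g : H ⟶ Y.right, f ≫ (segreRight B).map g = Y.hom ↔ ∀ v, g.toAlgHom (p v) = q v := by
    intro Y
    let y : A ⟶ segre Y.right B := Y.hom
    obtain ⟨q, hq⟩ := exists_coeff y
    refine ⟨q, evMap_eq_zero_of_hom y hq, fun g => ?_⟩
    have h1 : ∀ a : A.gen, segreVal Y.right B ((f ≫ (segreRight B).map g).toAlgHom a) =
        TensorProduct.map (g.toAlgHom.toLinearMap ∘ₗ H.gen.subtype ∘ₗ p.toLinearMap) B.gen.subtype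
          (coev k B.gen A.gen a) := fun a => by
      refine (segreVal_segreMap g B (f.toAlgHom a)).trans ?_
      rw [hf, ← algTensorMap_map]
      rfl
    constructor
    · intro h
      have h2 : g.toAlgHom.toLinearMap ∘ₗ H.gen.subtype ∘ₗ p.toLinearMap =
          Y.right.gen.subtype ∘ₗ q := by
        refine coeff_ext fun a => ?_
        rw [← h1, h, ← hq]
        rfl
      exact fun v => LinearMap.congr_fun h2 v
    · intro h
      have h2 : g.toAlgHom.toLinearMap ∘ₗ H.gen.subtype ∘ₗ p.toLinearMap =
          Y.right.gen.subtype ∘ₗ q := LinearMap.ext h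
      refine hom_segre_ext (g := y) fun a => ?_
      rw [hq, ← h2]
      exact h1 a
  choose q hq hq' using key
  choose g hg using fun Y : CoHomCat A B => hp.exists_hom hs Y.right (q Y) (hq Y)
  exact ⟨Limits.IsInitial.ofUniqueHom
    (fun Y => StructuredArrow.homMk (g Y) ((hq' Y _).2 (hg Y))) fun Y m => by
      refine StructuredArrow.hom_ext _ _ (hom_ext_of_gen p fun v => ?_)
      exact ((hq' Y m.right).1 (StructuredArrow.w m) v).trans (hg Y v).symm⟩

end Proper

end CoHom
end
end QuantumSpace

namespace QuantumSpace

noncomputable section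

/-! ### The twisted case: the initial object of `Ω`. -/

section Omega

variable {k : Type u} [Field k] {A B : ConicSpace k}

theorem LinearArrow.coeff_eq_coeffMap (X : LinearArrow A B) : X.coeff = coeffMap X.comp1 := rfl

theorem LinearArrow.segreGen_comp1 (X : LinearArrow A B) (a : A.gen) :
    (segreGen X.right B (X.comp1 a) : (segre X.right B).carrier) =
      X.comp 1 ⟨a, (pow_one A.gen).symm ▸ a.2⟩ := by
  rw [LinearArrow.comp1, LinearMap.comp_apply, LinearEquiv.coe_coe, LinearEquiv.apply_symm_apply]
  rfl

theorem LinearArrow.map_coeff_coev (X : LinearArrow A B) (a : A.gen) :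
    TensorProduct.map (X.right.gen.subtype ∘ₗ X.coeff) B.gen.subtype (coev k B.gen A.gen a) =
      segreVal X.right B (X.comp 1 ⟨a, (pow_one A.gen).symm ▸ a.2⟩) := by
  rw [X.coeff_eq_coeffMap, map_coeffMap_coev, ← segreVal_segreGen, segreGen_comp1]

/-- The inclusion `H^φ ∘ B → H ⊗ B`. -/
def LinearArrow.subVal (X : LinearArrow A B) :
    (segre X.sub B).carrier →ₐ[k] X.right.carrier ⊗[k] B.carrier :=
  (segreVal X.right B).comp (segreMap X.subIncl B).toAlgHom

theorem LinearArrow.subVal_injective (X : LinearArrow A B) : Function.Injective X.subVal := by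
  have h : Function.Injective (TensorProduct.map X.subIncl.toAlgHom.toLinearMap
      (LinearMap.id : B.carrier →ₗ[k] B.carrier)) :=
    TensorProduct.map_injective_of_flat_flat _ _ Subtype.val_injective Function.injective_id
  exact fun x y hxy => segreVal_injective X.sub B (h hxy)

theorem LinearArrow.subVal_genProj (X : LinearArrow A B) :
    X.subVal.toLinearMap ∘ₗ (segre X.sub B).gen.subtype ∘ₗ X.genProj =
      TensorProduct.map (X.right.gen.subtype ∘ₗ X.coeff) B.gen.subtype :=
  TensorProduct.ext' fun _ _ => rfl

theorem LinearArrow.proj_surjective (X : LinearArrow A B) : Function.Surjective X.proj := by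
  intro z
  obtain ⟨_, ⟨x, rfl⟩, hx⟩ : (z : X.sub.carrier).1 ∈ X.coeffSpace := z.2
  exact ⟨x, Subtype.ext (Subtype.ext hx)⟩

theorem LinearArrow.proj_injective (X : LinearArrow A B) (h : Function.Injective X.coeff) :
    Function.Injective X.proj := fun _ _ hxy =>
  h (Subtype.ext (congrArg (fun z : X.sub.gen => X.subIncl.toAlgHom z) hxy))

theorem LinearArrow.genProj_bijective (X : LinearArrow A B) (h : Function.Injective X.coeff) :
    Function.Bijective X.genProj := by
  rw [LinearArrow.genProj, LinearMap.coe_comp]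
  refine (segreGen X.sub B).bijective.comp ⟨?_, ?_⟩
  · exact Module.Flat.rTensor_preserves_injective_linearMap _ (X.proj_injective h)
  · exact LinearMap.rTensor_surjective _ X.proj_surjective

variable {θ : OneCochain k (Module.Dual k B.gen ⊗[k] A.gen)}

/-- The components of `φ` are the multiplicative extensions of its component of degree `1`,
deformed by `θ`. -/
def LinearArrow.IsDeformed (X : LinearArrow A B)
    (θ : OneCochain k (Module.Dual k B.gen ⊗[k] A.gen)) : Prop :=
  ∀ n x, segreVal X.right B (X.comp n ⟨ev A n x, range_ev A n ▸ ⟨x, rfl⟩⟩) =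
    evMap (TensorProduct.map (X.right.gen.subtype ∘ₗ X.coeff) B.gen.subtype) n
      (jointOne θ (idOne k B.gen) n (PiTensorProduct.map (fun _ => coev k B.gen A.gen) x))

/-- Evaluation in the twist, read inside the untwisted algebra `H ⊗ B`, introduces the primitive of
`ω`, which is `θ` on the coefficient letters. -/
theorem evMap_twist_coev (h0 : θ 0 = LinearEquiv.refl k _) (h1 : θ 1 = LinearEquiv.refl k _)
    (X : LinearArrow A B) (χ : CounitalCocycle k (segre X.sub B).gen)
    (h : Admissible (segre X.sub B) χ.toFun)
    (htr : IsTranslation X.genProj (coboundary (jointOne θ (idOne k B.gen))) χ.toFun)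
    (n : ℕ) (x : ⨂[k]^n A.gen) :
    X.subVal ((twistEquiv _ χ h).symm (evMap ((twistEquiv _ χ h).toLinearMap ∘ₗ
      (segre X.sub B).gen.subtype ∘ₗ X.genProj ∘ₗ coev k B.gen A.gen) n x)) =
    evMap (TensorProduct.map (X.right.gen.subtype ∘ₗ X.coeff) B.gen.subtype) n
      (jointOne θ (idOne k B.gen) n (PiTensorProduct.map (fun _ => coev k B.gen A.gen) x)) := by
  have h2 := evMap_twistEquiv (segre X.sub B) χ h X.genProj _
    (jointOne_eq_refl θ (idOne k B.gen) 0 h0 rfl) (jointOne_eq_refl θ (idOne k B.gen) 1 h1 rfl) htr n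
    (PiTensorProduct.map (fun _ => coev k B.gen A.gen) x)
  rw [evMap_map] at h2
  refine (congrArg (fun z => X.subVal ((twistEquiv _ χ h).symm z)) h2).trans ?_
  rw [LinearEquiv.symm_apply_apply, map_evMap, X.subVal_genProj]

/-- A morphism into the twist is determined by its degree one part, and its value on a word is the
twisted product of the letters. The formula obtained no longer mentions the cocycle on `H^φ ∘ B`. -/
theorem IsOmega.isDeformed (h0 : θ 0 = LinearEquiv.refl k _) (h1 : θ 1 = LinearEquiv.refl k _)
    {X : LinearArrow A B} (hX : IsOmega (coboundary (jointOne θ (idOne k B.gen))) X) :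
    X.IsDeformed θ := by
  obtain ⟨χ, h, htr, f, hf⟩ := hX
  intro n x
  rw [← hf, ← evMap_twist_coev h0 h1 X χ h htr]
  change X.subVal ((twistEquiv _ χ h).symm (f.toAlgHom (ev A n x))) = _
  rw [ev_eq_evMap, map_evMap]
  -- In degree one `f` is given by the coefficients of `X`; only the component `n = 1` of the
  -- compatibility with `φ` is used.
  have key : f.toAlgHom.toLinearMap ∘ₗ A.gen.subtype = (twistEquiv _ χ h).toLinearMap ∘ₗ
      (segre X.sub B).gen.subtype ∘ₗ X.genProj ∘ₗ coev k B.gen A.gen := by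
    refine LinearMap.ext fun a => (twistEquiv _ χ h).symm.injective (X.subVal_injective ?_)
    have h3 := congrArg (segreVal X.right B) (hf 1 ⟨a, (pow_one A.gen).symm ▸ a.2⟩)
    rw [← X.map_coeff_coev, ← X.subVal_genProj] at h3
    exact h3
  rw [key]

/-- After rearranging letters, the evaluation is the tensor product of a `V`-part and a `W`-part,
and the cochain acts on the `V`-part alone, so stability there suffices. -/
theorem map_ker_evMap_joint {V W R S : Type u} [AddCommGroup V] [Module k V] [AddCommGroup W]
    [Module k W] [Ring R] [Algebra k R] [Ring S] [Algebra k S] (q : V →ₗ[k] R) (q' : W →ₗ[k] S)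
    (D : TwoCochain k V) (hs : ∀ n, Stable D (LinearMap.ker (evMap q n))) (r s : ℕ) :
    (LinearMap.ker (TensorProduct.map (evMap (TensorProduct.map q q') r)
      (evMap (TensorProduct.map q q') s))).map (joint D (idCochain k W) r s).toLinearMap =
    LinearMap.ker (TensorProduct.map (evMap (TensorProduct.map q q') r)
      (evMap (TensorProduct.map q q') s)) := by
  have hJ : TensorProduct.map (evMap (TensorProduct.map q q') r)
        (evMap (TensorProduct.map q q') s) ∘ₗ (jointEquiv k V W r s).toLinearMap =
      (TensorProduct.tensorTensorTensorComm k R R S S).toLinearMap ∘ₗ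
        TensorProduct.map (TensorProduct.map (evMap q r) (evMap q s))
          (TensorProduct.map (evMap q' r) (evMap q' s)) := by
    refine TensorProduct.ext_fourfold' fun x x' y y' => ?_
    simp only [LinearMap.comp_apply, LinearEquiv.coe_coe, jointEquiv_tmul,
      TensorProduct.map_tmul, evMap_shuffle, TensorProduct.tensorTensorTensorComm_tmul]
  have hK : LinearMap.ker (TensorProduct.map (evMap (TensorProduct.map q q') r)
        (evMap (TensorProduct.map q q') s)) =
      (LinearMap.ker (TensorProduct.map (TensorProduct.map (evMap q r) (evMap q s))
          (TensorProduct.map (evMap q' r) (evMap q' s)))).map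
        (jointEquiv k V W r s).toLinearMap := by
    have h1 := congrArg LinearMap.ker hJ
    rw [LinearMap.ker_comp_of_ker_eq_bot _
      (LinearEquiv.ker (TensorProduct.tensorTensorTensorComm k R R S S)), LinearMap.ker_comp] at h1
    rw [← h1, Submodule.map_comap_eq_of_surjective (jointEquiv k V W r s).surjective]
  have hD : (joint D (idCochain k W) r s).toLinearMap ∘ₗ (jointEquiv k V W r s).toLinearMap =
      (jointEquiv k V W r s).toLinearMap ∘ₗ
        (TensorProduct.congr (D r s) (LinearEquiv.refl k _)).toLinearMap :=
    LinearMap.ext fun z => joint_jointEquiv D (idCochain k W) r s z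
  rw [hK, ← Submodule.map_comp, hD, Submodule.map_comp, map_ker_tensorMap_congr_refl]
  exact map_ker_tensorMap_of_stable _ _ _ (hs r) (hs s)

/-- Passing from `H^φ ∘ B` to `H ⊗ B` is injective and does not change kernels; admissibility may
thus be checked in `H ⊗ B`. -/
theorem LinearArrow.ker_evMap_genProj (X : LinearArrow A B) (r s : ℕ) :
    LinearMap.ker (TensorProduct.map (evMap ((segre X.sub B).gen.subtype ∘ₗ X.genProj) r)
        (evMap ((segre X.sub B).gen.subtype ∘ₗ X.genProj) s)) =
      LinearMap.ker (TensorProduct.map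
        (evMap (TensorProduct.map (X.right.gen.subtype ∘ₗ X.coeff) B.gen.subtype) r)
        (evMap (TensorProduct.map (X.right.gen.subtype ∘ₗ X.coeff) B.gen.subtype) s)) := by
  have hinj : Function.Injective (TensorProduct.map X.subVal.toLinearMap X.subVal.toLinearMap) :=
    TensorProduct.map_injective_of_flat_flat _ _ X.subVal_injective X.subVal_injective
  have hev : ∀ n, X.subVal.toLinearMap ∘ₗ evMap ((segre X.sub B).gen.subtype ∘ₗ X.genProj) n =
      evMap (TensorProduct.map (X.right.gen.subtype ∘ₗ X.coeff) B.gen.subtype) n := fun n =>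
    LinearMap.ext fun x => by
      rw [← X.subVal_genProj]
      exact map_evMap X.subVal ((segre X.sub B).gen.subtype ∘ₗ X.genProj) n x
  rw [← hev, ← hev, TensorProduct.map_comp,
    LinearMap.ker_comp_of_ker_eq_bot _ (LinearMap.ker_eq_bot.2 hinj)]

/-- A converse to `IsOmega.isDeformed`. With injective coefficients `ω` descends for free, being
transported along an isomorphism of generators; stability yields admissibility, and the formula for
the components shows that relations of `A` go to zero in the twist. -/
theorem LinearArrow.IsDeformed.isOmega (h0 : θ 0 = LinearEquiv.refl k _)
    (h1 : θ 1 = LinearEquiv.refl k _) {X : LinearArrow A B} (hX : X.IsDeformed θ)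
    (hc : Function.Injective X.coeff)
    (hs : ∀ n, Stable (coboundary θ) (LinearMap.ker (evMap (X.right.gen.subtype ∘ₗ X.coeff) n))) :
    IsOmega (coboundary (jointOne θ (idOne k B.gen))) X := by
  let Θ := jointOne θ (idOne k B.gen)
  let e := LinearEquiv.ofBijective X.genProj (X.genProj_bijective hc)
  let χ := coboundaryCocycle (conjOne e Θ) (conjOne_eq_refl e Θ 0 (jointOne_eq_refl θ _ 0 h0 rfl))
  have htr : IsTranslation X.genProj (coboundary Θ) χ.toFun := isTranslation_conjOne e Θ
  have h : Admissible (segre X.sub B) χ.toFun := by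
    refine admissible_of_isTranslation _ X.genProj e.surjective (coboundary Θ) _ htr fun r s => ?_
    rw [X.ker_evMap_genProj, coboundary_jointOne, coboundary_idOne]
    exact map_ker_evMap_joint _ _ _ hs r s
  let Q' := (twistEquiv _ χ h).toLinearMap ∘ₗ
      (segre X.sub B).gen.subtype ∘ₗ X.genProj ∘ₗ coev k B.gen A.gen
  have hQ : ∀ n x, X.subVal ((twistEquiv _ χ h).symm (evMap Q' n x)) =
      segreVal X.right B (X.comp n ⟨ev A n x, range_ev A n ▸ ⟨x, rfl⟩⟩) := fun n x =>
    (evMap_twist_coev h0 h1 X χ h htr n x).trans (hX n x).symm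
  obtain ⟨F, hF⟩ := A.exists_algHom A.gen.subtype (Submodule.range_subtype _) Q' fun n x hx => by
    apply (twistEquiv _ χ h).symm.injective
    apply X.subVal_injective
    rw [hQ, map_zero, map_zero]
    have : (⟨ev A n x, range_ev A n ▸ ⟨x, rfl⟩⟩ : ↥(A.gen ^ n)) = 0 := Subtype.ext hx
    rw [this, map_zero, ZeroMemClass.coe_zero, map_zero]
  have hFQ : F.toLinearMap ∘ₗ A.gen.subtype = Q' := LinearMap.ext hF
  refine ⟨χ, h, htr, ⟨F, fun a ha => ?_⟩, fun n a => ?_⟩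
  · rw [show F a = Q' ⟨a, ha⟩ from hF ⟨a, ha⟩]
    exact twistEquiv_mem_gen _ χ h (X.genProj _).2
  · obtain ⟨a, ha⟩ := a
    obtain ⟨x, rfl⟩ : a ∈ LinearMap.range (ev A n) := (range_ev A n).symm ▸ ha
    apply segreVal_injective X.right B
    have hFe : F (ev A n x) = evMap Q' n x := by
      rw [ev_eq_evMap, map_evMap, hFQ]
    exact (congrArg (fun z => X.subVal ((twistEquiv _ χ h).symm z)) hFe).trans (hQ n x)

theorem IsOmega.evMap_eq_zero (h0 : θ 0 = LinearEquiv.refl k _) (h1 : θ 1 = LinearEquiv.refl k _)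
    {X : LinearArrow A B} (hX : IsOmega (coboundary (jointOne θ (idOne k B.gen))) X)
    (n : ℕ) (x : ⨂[k]^n A.gen) (hx : ev A n x = 0) :
    evMap (TensorProduct.map (X.right.gen.subtype ∘ₗ X.coeff) B.gen.subtype) n
      (jointOne θ (idOne k B.gen) n (PiTensorProduct.map (fun _ => coev k B.gen A.gen) x)) = 0 := by
  rw [← hX.isDeformed h0 h1]
  have : (⟨ev A n x, range_ev A n ▸ ⟨x, rfl⟩⟩ : ↥(A.gen ^ n)) = 0 := Subtype.ext hx
  rw [this, map_zero, ZeroMemClass.coe_zero, map_zero]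

/-- The universal `φ` is in general not multiplicative for the untwisted product, so it is built
separately in each degree by descending the deformed extension from words to `A`. -/
theorem exists_linearArrow (h1 : θ 1 = LinearEquiv.refl k _) {H : ConicSpace k}
    {p : (Module.Dual k B.gen ⊗[k] A.gen) ≃ₗ[k] H.gen} (hp : Presents θ H p) :
    ∃ φ : ∀ n : ℕ, ↥(A.gen ^ n) →ₗ[k] ↥((segre H B).gen ^ n),
      let X : LinearArrow A B := StructuredArrow.mk (S := (forgetGraded k).obj A)
        (T := segreRight B ⋙ forgetGraded k) (Y := H) fun n => ModuleCat.ofHom (φ n)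
      X.coeff = p.toLinearMap ∧ X.IsDeformed θ := by
  let Q : Module.Dual k B.gen ⊗[k] A.gen →ₗ[k] H.carrier := H.gen.subtype ∘ₗ p.toLinearMap
  let ρ : (Module.Dual k B.gen ⊗[k] A.gen) ⊗[k] B.gen →ₗ[k] (segre H B).carrier :=
    (segre H B).gen.subtype ∘ₗ (segreGen H B).toLinearMap ∘ₗ
      TensorProduct.map p.toLinearMap LinearMap.id
  have hρ : (segreVal H B).toLinearMap ∘ₗ ρ = TensorProduct.map Q B.gen.subtype :=
    TensorProduct.ext' fun _ _ => rfl
  let T : ∀ n : ℕ, (⨂[k]^n A.gen) →ₗ[k] (segre H B).carrier := fun n =>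
    evMap ρ n ∘ₗ (jointOne θ (idOne k B.gen) n).toLinearMap ∘ₗ
      PiTensorProduct.map fun _ => coev k B.gen A.gen
  have hT : ∀ n x, segreVal H B (T n x) = evMap (TensorProduct.map Q B.gen.subtype) n
      (jointOne θ (idOne k B.gen) n (PiTensorProduct.map (fun _ => coev k B.gen A.gen) x)) :=
    fun n x => by
      rw [← hρ]
      exact map_evMap _ _ _ _
  have hex : ∀ n, ∃ l : A.carrier →ₗ[k] (segre H B).carrier, ∀ x, l (ev A n x) = T n x := fun n =>
    exists_factor (ev A n) (T n) fun x hx => segreVal_injective H B <| by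
      rw [hT, map_zero]
      exact hp.evMap_eq_zero n x hx
  choose l hl using hex
  have hmem : ∀ n, ∀ a ∈ A.gen ^ n, l n a ∈ (segre H B).gen ^ n := by
    intro n a ha
    rw [← range_ev] at ha
    obtain ⟨x, rfl⟩ := ha
    rw [hl]
    exact evMap_mem_pow ρ _ (fun v => Subtype.prop _) n _
  refine ⟨fun n => (l n).restrict (hmem n), ?_⟩
  intro X
  have hX : ∀ n x, segreVal H B (X.comp n ⟨ev A n x, range_ev A n ▸ ⟨x, rfl⟩⟩).1 =
      evMap (TensorProduct.map Q B.gen.subtype) n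
        (jointOne θ (idOne k B.gen) n (PiTensorProduct.map (fun _ => coev k B.gen A.gen) x)) :=
    fun n x => (congrArg (segreVal H B) (hl n x)).trans (hT n x)
  -- Since `θ 1` is the identity, the degree one component is undeformed and has coefficients `p`.
  have hc : X.coeff = p.toLinearMap := by
    have h2 : H.gen.subtype ∘ₗ X.coeff = Q := by
      refine coeff_ext fun a => (X.map_coeff_coev a).trans ?_
      have h3 := hX 1 (PiTensorProduct.tprod k fun _ => a)
      rw [jointOne_eq_refl θ _ 1 h1 rfl, LinearEquiv.refl_apply, PiTensorProduct.map_tprod,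
        evMap_one] at h3
      rw [← h3]
      congr 3
      refine Subtype.ext ?_
      change (a : A.carrier) = ev A 1 (PiTensorProduct.tprod k fun _ => a)
      rw [ev_eq_evMap, evMap_one]
      rfl
    exact LinearMap.ext fun v => Subtype.ext (LinearMap.congr_fun h2 v)
  refine ⟨hc, fun n x => ?_⟩
  rw [hc]
  exact hX n x

theorem exists_initial_omega (h0 : θ 0 = LinearEquiv.refl k _) (h1 : θ 1 = LinearEquiv.refl k _)
    (hs : StableRel A B θ) {H : ConicSpace k}
    {p : (Module.Dual k B.gen ⊗[k] A.gen) ≃ₗ[k] H.gen} (hp : Presents θ H p) :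
    ∃ X : OmegaCat A B (coboundary (jointOne θ (idOne k B.gen))),
      X.obj.right = H ∧ Nonempty (Limits.IsInitial X) := by
  obtain ⟨φ, hc, hd⟩ := exists_linearArrow h1 hp
  let X₀ : LinearArrow A B := StructuredArrow.mk (S := (forgetGraded k).obj A)
    (T := segreRight B ⋙ forgetGraded k) (Y := H) fun n => ModuleCat.ofHom (φ n)
  have hc' : X₀.coeff = p.toLinearMap := hc
  have hd' : X₀.IsDeformed θ := hd
  have hst : ∀ n, Stable (coboundary θ)
      (LinearMap.ker (evMap (X₀.right.gen.subtype ∘ₗ X₀.coeff) n)) := fun n => by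
    rw [hc', show LinearMap.ker (evMap (X₀.right.gen.subtype ∘ₗ p.toLinearMap) n) = _ from hp n]
    exact (stable_genIdeal hs n).map_primitive
  have hΩ := hd'.isOmega h0 h1 (by rw [hc']; exact p.injective) hst
  refine ⟨⟨X₀, hΩ⟩, rfl, ?_⟩
  -- Compatibility in degree one already fixes `g` on generators; conversely, the deformed formula
  -- propagates agreement on generators to every degree.
  have key : ∀ (X : LinearArrow A B), X.IsDeformed θ → ∀ g : H ⟶ X.right,
      X₀.hom ≫ (segreRight B ⋙ forgetGraded k).map g = X.hom ↔
        ∀ v, g.toAlgHom (p v) = X.coeff v := by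
    intro X hX g
    have h2 : ∀ n x, segreVal X.right B ((segreMap g B).toAlgHom
        (X₀.comp n ⟨ev A n x, range_ev A n ▸ ⟨x, rfl⟩⟩).1) =
        evMap (TensorProduct.map (g.toAlgHom.toLinearMap ∘ₗ H.gen.subtype ∘ₗ p.toLinearMap)
          B.gen.subtype) n (jointOne θ (idOne k B.gen) n
            (PiTensorProduct.map (fun _ => coev k B.gen A.gen) x)) := fun n x => by
      have h3 : segreVal H B (X₀.comp n ⟨ev A n x, range_ev A n ▸ ⟨x, rfl⟩⟩).1 =
          evMap (TensorProduct.map (H.gen.subtype ∘ₗ p.toLinearMap) B.gen.subtype) n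
            (jointOne θ (idOne k B.gen) n
              (PiTensorProduct.map (fun _ => coev k B.gen A.gen) x)) := by
        have h4 := hd' n x
        rw [hc'] at h4
        exact h4
      refine (segreVal_segreMap g B _).trans ?_
      refine (congrArg (Algebra.TensorProduct.map g.toAlgHom (AlgHom.id k B.carrier)) h3).trans ?_
      rw [map_evMap, algTensorMap_map]
    constructor
    · intro h
      have h3 : g.toAlgHom.toLinearMap ∘ₗ H.gen.subtype ∘ₗ p.toLinearMap =
          X.right.gen.subtype ∘ₗ X.coeff := by
        refine coeff_ext fun a => ?_
        have h4 := h2 1 (PiTensorProduct.tprod k fun _ => a)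
        have h5 := hX 1 (PiTensorProduct.tprod k fun _ => a)
        rw [jointOne_eq_refl θ _ 1 h1 rfl, LinearEquiv.refl_apply, PiTensorProduct.map_tprod,
          evMap_one] at h4 h5
        rw [← h4, ← h5]
        have h6 : ∀ b : ↥(A.gen ^ 1), ((X₀.hom ≫ (segreRight B ⋙ forgetGraded k).map g) 1).hom b =
            (X.hom 1).hom b := fun b => by rw [h]
        exact congrArg (fun z : ↥((segre X.right B).gen ^ 1) => segreVal X.right B z.1) (h6 _)
      exact fun v => LinearMap.congr_fun h3 v
    · intro h
      have h3 : g.toAlgHom.toLinearMap ∘ₗ H.gen.subtype ∘ₗ p.toLinearMap =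
          X.right.gen.subtype ∘ₗ X.coeff := LinearMap.ext h
      funext n
      refine ModuleCat.hom_ext (LinearMap.ext fun a => ?_)
      obtain ⟨a, ha⟩ := a
      obtain ⟨x, rfl⟩ : a ∈ LinearMap.range (ev A n) := (range_ev A n).symm ▸ ha
      refine Subtype.ext (segreVal_injective X.right B ?_)
      refine (h2 n x).trans ?_
      rw [h3]
      exact (hX n x).symm
  have hX : ∀ X : OmegaCat A B (coboundary (jointOne θ (idOne k B.gen))), X.obj.IsDeformed θ :=
    fun X => X.property.isDeformed h0 h1
  choose g hg using fun X : OmegaCat A B (coboundary (jointOne θ (idOne k B.gen))) =>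
    hp.exists_hom hs X.obj.right X.obj.coeff (X.property.evMap_eq_zero h0 h1)
  exact ⟨Limits.IsInitial.ofUniqueHom
    (fun X => ObjectProperty.homMk (StructuredArrow.homMk (g X) ((key _ (hX X) _).2 (hg X))))
    fun X m => by
      refine ObjectProperty.hom_ext _ (StructuredArrow.hom_ext _ _ (hom_ext_of_gen p fun v => ?_))
      exact ((key _ (hX X) m.hom.right).1 (StructuredArrow.w m.hom) v).trans (hg X v).symm⟩

/-- The gauge transformation `𝔧(θ_B^!, θ_A)`, where `θ` denotes primitives. -/
def coHomGauge (ψA : CounitalCocycle k A.gen) (ψB : CounitalCocycle k B.gen) :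
    OneCochain k (Module.Dual k B.gen ⊗[k] A.gen) :=
  jointOne (contraOne ψB.primitive) ψA.primitive

theorem coboundary_coHomGauge (ψA : CounitalCocycle k A.gen) (ψB : CounitalCocycle k B.gen) :
    coboundary (jointOne (coHomGauge ψA ψB) (idOne k B.gen)) =
      joint (joint (contragredient ψB.toFun) ψA.toFun) (idCochain k B.gen) := by
  rw [coboundary_jointOne, coHomGauge, coboundary_jointOne, coboundary_contraOne,
    ψA.coboundary_primitive, ψB.coboundary_primitive, coboundary_idOne]

/-- Second admissibility gives stability of the placed relations of `A` and, by duality, of the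
placed annihilators for `B`; shuffling them gives the placed relations of the coHom object. -/
theorem stableRel_coHomGauge {ψA : CounitalCocycle k A.gen} {ψB : CounitalCocycle k B.gen}
    (hA : SecondAdmissible A ψA.inv) (hB : SecondAdmissible B ψB.inv) :
    StableRel A B (coHomGauge ψA ψB) := by
  intro i j l
  -- Inverting a `1`-cochain commutes with forming contragredient and joint cochains, so the gauge
  -- inverses of `ψA` and `ψB` appear.
  have h : coboundary (fun n => (coHomGauge ψA ψB n).symm) =
      joint (contragredient ψB.inv) ψA.inv := by
    rw [CounitalCocycle.inv, CounitalCocycle.inv, ← coboundary_contraOne, ← coboundary_jointOne]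
    rfl
  rw [h, show coHomRel A B = fun n => shuffleSub (perp (LinearMap.ker (ev B n)))
    (LinearMap.ker (ev A n)) from rfl, placed_shuffleSub, ← perp_placed]
  exact (hB.stable i j l).perp.joint (hA.stable i j l)

theorem stableRel_idOne : StableRel A B (idOne k (Module.Dual k B.gen ⊗[k] A.gen)) := by
  intro i j l s
  have h : coboundary (fun n => (idOne k (Module.Dual k B.gen ⊗[k] A.gen) n).symm) =
      idCochain k _ := coboundary_idOne
  rw [h]
  exact ⟨Submodule.map_id _, Submodule.map_id _⟩

end Omega
end
end QuantumSpace

open QuantumSpace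
-- Comparison of the two initial objects.
theorem mainTheorem4 {k : Type u} [Field k]
    (ω : ∀ A B : ConicSpace k, CounitalCocycle k ((Module.Dual k B.gen ⊗[k] A.gen) ⊗[k] B.gen))
    (ψ : ∀ A : ConicSpace k, CounitalCocycle k A.gen)
    (hω : IsFactorization ω ψ)
    (hψ : ∀ A : ConicSpace k, SecondAdmissible A (ψ A).inv)
    (A B : ConicSpace k) :
    (∃ X : OmegaCat A B (ω A B).toFun, Nonempty (Limits.IsInitial X)) ∧
    (∃ Y : CoHomCat A B, Nonempty (Limits.IsInitial Y)) ∧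
    ∀ (X : OmegaCat A B (ω A B).toFun) (Y : CoHomCat A B),
      Limits.IsInitial X → Limits.IsInitial Y → GaugeEquivalent X.obj.right Y.right := by
  have hs : StableRel A B (coHomGauge (ψ A) (ψ B)) := stableRel_coHomGauge (hψ A) (hψ B)
  have h0 : coHomGauge (ψ A) (ψ B) 0 = LinearEquiv.refl k _ :=
    jointOne_eq_refl _ _ 0 (contraOne_eq_refl _ 0 rfl) rfl
  have h1 : coHomGauge (ψ A) (ψ B) 1 = LinearEquiv.refl k _ :=
    jointOne_eq_refl _ _ 1 (contraOne_eq_refl _ 1 (ψ B).primitive_one) (ψ A).primitive_one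
  obtain ⟨H, p, hp⟩ := exists_presents hs
  -- The proper coHom object is the case of the trivial gauge, with relations `J` in place of `θ J`.
  obtain ⟨G, q, hq⟩ := exists_presents (A := A) (B := B) stableRel_idOne
  obtain ⟨X₀, rfl, ⟨hX₀⟩⟩ := exists_initial_omega h0 h1 hs hp
  obtain ⟨Y₀, rfl, ⟨hY₀⟩⟩ := exists_initial_coHom hq stableRel_idOne
  rw [hω A B, ← coboundary_coHomGauge]
  refine ⟨⟨X₀, ⟨hX₀⟩⟩, ⟨Y₀, ⟨hY₀⟩⟩, fun X Y hX hY => ?_⟩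
  -- An isomorphism of initial objects induces one of the underlying conic spaces, so the given `X`
  -- and `Y` have the same presentations as the constructed ones.
  obtain ⟨p', hp'⟩ : ∃ p' : _ ≃ₗ[k] X.obj.right.gen, Presents _ X.obj.right p' :=
    hp.of_iso (((IsOmega _).ι ⋙ StructuredArrow.proj _ _).mapIso (hX₀.uniqueUpToIso hX))
  obtain ⟨q', hq'⟩ : ∃ q' : _ ≃ₗ[k] Y.right.gen, Presents (idOne k _) Y.right q' :=
    hq.of_iso ((StructuredArrow.proj _ _).mapIso (hY₀.uniqueUpToIso hY))
  refine gaugeEquivalent_of_evMap h0 h1 (stable_genIdeal hs) p' hp'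
    (Y.right.gen.subtype ∘ₗ q'.toLinearMap) ?_ fun n => ?_
  · rw [LinearMap.range_comp, LinearEquiv.range, Submodule.map_subtype_top]
  · exact (hq' n).trans (Submodule.map_id _)
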